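/- Let $d\ge 0$ be an integer and let $\mathcal L_d=\{\mathbf 0,\mathbf 1,\vee,\wedge,-\}\cup\{C^0,\dots,C^d\}$ be the first-order language with two constants, binary function symbols $\vee,\wedge,-$ and unary function symbols $C^i$. **Definitions.** A *TC-lattice* is a bounded lattice in which $a-b$ is the least $c$ with $a\le b\vee c$. In an $\mathcal L_d$-structure whose lattice reduct is a bounded lattice, write $b\ll a$ if $b<a$ and $b\vee c<a$ for all $c<a$. The *sc-dimension* of $a$ is $$\operatorname{sc\text{-}dim}a=\min\Bigl\{-1\le l\le d : a=\bigvee_{0\le i\le l}C^i(a)\Bigr\}$$ (with empty join $\mathbf 0$ and $\min\emptyset=\infty$). The *lattice dimension* $\dim a\in\{-1,0,1,\dots,\infty\}$ is the supremum of the $n$ such that there are prime filters $\mathfrak p_0\subsetneq\dots\subsetneq\mathfrak p_n$ all containing $a$ (and $-1$ if no prime filter contains $a$). A *$d$-subscaled lattice* is an $\mathcal L_d$-structure that is a TC-lattice and satisfies, for all elements $a,b$ and all $i,j,k\in\{0,\dots,d\}$: 1. $\bigvee_{0\le i\le d}C^i(a)=a$; 2. for all $I\subseteq\{0,\dots,d\}$,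 $C^k\bigl(\bigvee_{i\in I}C^i(a)\bigr)$ equals $C^k(a)$ if $k\in I$ and $\mathbf 0$ if $k\notin I$; 3. $C^k(a\vee b)=C^k(a)\vee C^k(b)$ if $k\ge\max(\operatorname{sc\text{-}dim}a,\operatorname{sc\text{-}dim}b)$; 4. $\operatorname{sc\text{-}dim}\bigl(C^i(a)\wedge C^j(a)\bigr)<\min(i,j)$ if $i\ne j$; 5. $C^k(a)-b=C^k(a)-C^k(b)$ if $k\ge\operatorname{sc\text{-}dim}b$; 6. if $b\ll a$ then $\operatorname{sc\text{-}dim}b<\operatorname{sc\text{-}dim}a$. An element $a$ is *$k$-pure* if $\dim(a-b)=k$ whenever $a-b\ne\mathbf 0$; it *has pure dimension $k$* if moreover $a\neq\mathbf 0$. A *super $d$-scaled lattice* is a $d$-subscaled lattice satisfying: - *Scaling*: $\operatorname{sc\text{-}dim}a=\dim a$ for all $a$. - *Catenarity*: for all integers $0\le r\le q\le p$ and all $c\le a$, if $a$ has pure dimension $p$ and $c$ has pure dimension $r$, then there is a $q$-pure $b$ with $c\le b\le a$. - *Splitting*: for all $b_1,b_2,a$ with $b_1\vee b_2\ll a$ there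 are nonzero $a_1\ge b_1$ and $a_2\ge b_2$ with $a_1=a-a_2$, $a_2=a-a_1$ and $a_1\wedge a_2=b_1\wedge b_2$. A $d$-subscaled lattice is *prime* if it contains no proper $d$-subscaled lattice as a substructure. For a prime $d$-subscaled lattice $L_0$, let $T_d(L_0)$ be the theory of the super $d$-scaled lattices that contain a copy of $L_0$ (an $\mathcal L_d$-substructure isomorphic to $L_0$), and let $\bar T_d$ be the theory of all super $d$-scaled lattices. A theory is *decidable* if the set of Gödel numbers of its logical consequences is recursive; $\aleph_0$-*categorical* means that any two models of cardinality $\aleph_0$ are isomorphic; *complete* includes consistent. **Statement.** 1. For every prime $d$-subscaled lattice $L_0$, the theory $T_d(L_0)$ is $\aleph_0$-categorical, complete and decidable, and it is finitely axiomatizable: there is a finite set of $\mathcal L_d$-sentences whose models are exactly the super $d$-scaled lattices that contain a copy of $L_0$. 2. Up to isomorphism there are only finitely many prime $d$-subscaled lattices. 3. Every completion of $\bar T_d$ is of this form: every complete $\mathcal L_d$-theory that implies $\bar T_d$ has the same consequences as $T_d(L_0)$ for some prime $d$-subscaled lattice $L_0$. 4. The theory $\bar T_d$ is decidable. -/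

import Mathlib

open FirstOrder FirstOrder.Language

namespace ScaledLattice

universe u v

/-- Function symbols of the language of lattices with `0`, `1`, `∨`, `∧`, enriched with a binary
symbol `-` and unary symbols `C⁰, …, Cᵈ`. -/
inductive Fn (d : ℕ) : ℕ → Type
  | zero : Fn d 0
  | one : Fn d 0
  | comp (i : Fin (d + 1)) : Fn d 1
  | join : Fn d 2
  | meet : Fn d 2
  | diff : Fn d 2

/-- The finite first-order language `{0, 1, ∨, ∧, -} ∪ {Cⁱ : 0 ≤ i ≤ d}`. -/
abbrev lang (d : ℕ) : FirstOrder.Language.{0, 0} := ⟨Fn d, fun _ => Empty⟩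

section Operations

variable (d : ℕ) {M : Type u} [(lang d).Structure M]

/-- The constant `0`. -/
def bot : M := Structure.funMap (L := lang d) Fn.zero ![]

/-- The constant `1`. -/
def top : M := Structure.funMap (L := lang d) Fn.one ![]

/-- `a ∨ b`. -/
def join (a b : M) : M := Structure.funMap (L := lang d) Fn.join ![a, b]

/-- `a ∧ b`. -/
def meet (a b : M) : M := Structure.funMap (L := lang d) Fn.meet ![a, b]

/-- `a - b`. -/
def diff (a b : M) : M := Structure.funMap (L := lang d) Fn.diff ![a, b]

/-- `Cⁱ(a)`. -/
def comp (i : Fin (d + 1)) (a : M) : M := Structure.funMap (L := lang d) (Fn.comp i) ![a]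

/-- `a ≤ b`, an abbreviation for `a ∨ b = b`. -/
def le (a b : M) : Prop := join d a b = b

/-- `a < b`. -/
def lt (a b : M) : Prop := le d a b ∧ a ≠ b

/-- `b ≪ a`: `b < a` and `b ∨ c < a` for every `c < a`. -/
def ll (b a : M) : Prop := lt d b a ∧ ∀ c : M, lt d c a → lt d (join d b c) a

/-- The finite join of the `Cⁱ(a)`, `i ∈ I` (it is `0` when `I` is empty). -/
def joinComp (I : Finset (Fin (d + 1))) (a : M) : M :=
  ((List.finRange (d + 1)).filter (fun i => decide (i ∈ I))).foldr
    (fun i x => join d (comp d i a) x) (bot d)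

open Classical in
/-- The sc-dimension of `a`: the least `l ∈ {-1, 0, …, d}` with `a = C⁰(a) ∨ ⋯ ∨ Cˡ(a)`, and `∞`
if there is none. Here `-1` is `⊥` and `∞` is `⊤`. -/
noncomputable def scdim (a : M) : WithBot ℕ∞ :=
  sInf {l : WithBot ℕ∞ | l ≤ (d : WithBot ℕ∞) ∧
    a = joinComp d (Finset.univ.filter fun i : Fin (d + 1) => ((i : ℕ) : WithBot ℕ∞) ≤ l) a}

/-- Prime filters of `M`. -/
structure IsPrimeFilter (F : Set M) : Prop where
  top_mem : top d ∈ F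
  bot_notMem : bot d ∉ F
  mem_of_le : ∀ a b : M, le d a b → a ∈ F → b ∈ F
  meet_mem : ∀ a b : M, a ∈ F → b ∈ F → meet d a b ∈ F
  mem_or_mem : ∀ a b : M, join d a b ∈ F → a ∈ F ∨ b ∈ F

/-- The lattice dimension of `a`: the supremum in `{-1, 0, 1, …, ∞}` of the `n` such that there
are prime filters `p₀ ⊂ ⋯ ⊂ pₙ` all containing `a`. -/
noncomputable def dim (a : M) : WithBot ℕ∞ :=
  Order.krullDim {F : Set M // IsPrimeFilter d F ∧ a ∈ F}

/-- `a` is `k`-pure: every nonzero `a - b` has lattice dimension `k`. -/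
def IsPure (k : ℕ) (a : M) : Prop :=
  ∀ b : M, diff d a b ≠ bot d → dim d (diff d a b) = (k : WithBot ℕ∞)

/-- `a` has pure dimension `k`: it is `k`-pure and nonzero. -/
def HasPureDim (k : ℕ) (a : M) : Prop := IsPure d k a ∧ a ≠ bot d

end Operations

section Classes

variable (d : ℕ) (M : Type u) [(lang d).Structure M]

/-- Topologically complemented lattices: bounded lattices in which `a - b` is the least `c` with
`a ≤ b ∨ c`. -/
structure IsTCLattice : Prop where
  join_comm : ∀ a b : M, join d a b = join d b a
  meet_comm : ∀ a b : M, meet d a b = meet d b a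
  join_assoc : ∀ a b c : M, join d (join d a b) c = join d a (join d b c)
  meet_assoc : ∀ a b c : M, meet d (meet d a b) c = meet d a (meet d b c)
  join_meet_self : ∀ a b : M, join d a (meet d a b) = a
  meet_join_self : ∀ a b : M, meet d a (join d a b) = a
  bot_le : ∀ a : M, le d (bot d) a
  le_top : ∀ a : M, le d a (top d)
  le_join_diff : ∀ a b : M, le d a (join d b (diff d a b))
  diff_le : ∀ a b c : M, le d a (join d b c) → le d (diff d a b) c

/-- `d`-subscaled lattices. -/
structure IsSubscaled : Prop extends IsTCLattice d M where
  joinComp_univ : ∀ a : M, joinComp d Finset.univ a = a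
  comp_joinComp : ∀ (I : Finset (Fin (d + 1))) (k : Fin (d + 1)) (a : M),
    (k ∉ I → comp d k (joinComp d I a) = bot d) ∧
    (k ∈ I → comp d k (joinComp d I a) = comp d k a)
  comp_join : ∀ (k : Fin (d + 1)) (a b : M),
    max (scdim d a) (scdim d b) ≤ ((k : ℕ) : WithBot ℕ∞) →
    comp d k (join d a b) = join d (comp d k a) (comp d k b)
  scdim_meet_lt : ∀ (i j : Fin (d + 1)) (a : M), i ≠ j →
    scdim d (meet d (comp d i a) (comp d j a)) < ((min (i : ℕ) (j : ℕ) : ℕ) : WithBot ℕ∞)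
  comp_diff : ∀ (k : Fin (d + 1)) (a b : M),
    scdim d b ≤ ((k : ℕ) : WithBot ℕ∞) →
    diff d (comp d k a) b = diff d (comp d k a) (comp d k b)
  scdim_lt_of_ll : ∀ a b : M, ll d b a → scdim d b < scdim d a

/-- `d`-scaled lattices: `d`-subscaled lattices in which the sc-dimension of every element is its
lattice dimension. -/
structure IsScaled : Prop extends IsSubscaled d M where
  scdim_eq_dim : ∀ a : M, scdim d a = dim d a

/-- Super `d`-scaled lattices. -/
structure IsSuperScaled : Prop extends IsScaled d M where
  catenarity : ∀ (r q p : ℕ), r ≤ q → q ≤ p → ∀ c a : M, le d c a →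
    HasPureDim d p a → HasPureDim d r c →
    ∃ b : M, IsPure d q b ∧ le d c b ∧ le d b a
  splitting : ∀ b₁ b₂ a : M, ll d (join d b₁ b₂) a →
    ∃ a₁ a₂ : M, a₁ ≠ bot d ∧ a₂ ≠ bot d ∧ le d b₁ a₁ ∧ le d b₂ a₂ ∧
      a₁ = diff d a a₂ ∧ a₂ = diff d a a₁ ∧ meet d a₁ a₂ = meet d b₁ b₂

/-- Prime `d`-subscaled lattices: those which contain no proper `d`-subscaled lattice. -/
def IsPrimeSubscaled : Prop :=
  IsSubscaled d M ∧ ∀ S : (lang d).Substructure M, IsSubscaled d S → S = ⊤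

end Classes

section Theories

/-- The theory of super `d`-scaled lattices. -/
def superTheory (d : ℕ) : (lang d).Theory :=
  {φ | ∀ (M : Type) [(lang d).Structure M], IsSuperScaled d M → M ⊨ φ}

/-- The theory of super `d`-scaled lattices containing a copy of `L₀`. -/
def superTheoryOver (d : ℕ) (L₀ : Type u) [(lang d).Structure L₀] : (lang d).Theory :=
  {φ | ∀ (M : Type) [(lang d).Structure M], IsSuperScaled d M → Nonempty (L₀ ↪[lang d] M) → M ⊨ φ}

end Theories

section Decidability

variable {d : ℕ}

/-- Gödel numbers of terms whose variables are `x₀, …, xₙ₋₁`. -/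
def termCode {n : ℕ} : (lang d).Term (Empty ⊕ Fin n) → ℕ
  | .var (.inl e) => e.elim
  | .var (.inr i) => Nat.pair 0 i
  | .func Fn.zero _ => Nat.pair 1 0
  | .func Fn.one _ => Nat.pair 2 0
  | .func (Fn.comp i) ts => Nat.pair 3 (Nat.pair i (termCode (ts 0)))
  | .func Fn.join ts => Nat.pair 4 (Nat.pair (termCode (ts 0)) (termCode (ts 1)))
  | .func Fn.meet ts => Nat.pair 5 (Nat.pair (termCode (ts 0)) (termCode (ts 1)))
  | .func Fn.diff ts => Nat.pair 6 (Nat.pair (termCode (ts 0)) (termCode (ts 1)))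

/-- Gödel numbers of formulas whose free variables are `x₀, …, xₙ₋₁`. -/
def formulaCode : ∀ {n : ℕ}, (lang d).BoundedFormula Empty n → ℕ
  | _, .falsum => Nat.pair 0 0
  | _, .equal s t => Nat.pair 1 (Nat.pair (termCode s) (termCode t))
  | _, .rel R _ => Empty.elim R
  | _, .imp φ ψ => Nat.pair 2 (Nat.pair (formulaCode φ) (formulaCode ψ))
  | _, .all φ => Nat.pair 3 (formulaCode φ)

/-- A theory is decidable if the set of Gödel numbers of its consequences is recursive. -/
def IsDecidableTheory (T : (lang d).Theory) : Prop :=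
  ComputablePred fun n : ℕ => ∃ φ : (lang d).Sentence, formulaCode φ = n ∧ T ⊨ᵇ φ

end Decidability

end ScaledLattice

open ScaledLattice

universe u v

/-! The proof rests on a duality with labelled posets. Order the prime filters of a `d`-subscaled
lattice by reverse inclusion and label each one by the least sc-dimension of its elements. The
axioms force labels in `{0, …, d}` that increase strictly, and `a ↦ {p | a ∈ p}` embeds the lattice
in the lower sets of this graded poset, onto them if the lattice is finite (`IsSubscaled.repr`,
`IsSubscaled.repr_surjective`). Conversely the lower sets of any graded poset form a `d`-subscaled
lattice, and surjective p-morphisms dualize to embeddings. Finite `d`-subscaled lattices can thus be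
handled as finite graded posets.

Local finiteness. Chains of the poset have at most `d + 1` points, so finitely many lower sets
distinguish only finitely many types of points, and a finitely generated substructure is finite
(`IsSubscaled.exists_finite_substructure`). The axioms are universal, so every substructure is again
subscaled; hence the prime lattices are those generated by the constants, and their size is bounded
in terms of `d`.

Extension. An embedding of a substructure of a finite `P` in a super `d`-scaled lattice extends to
`P` (`IsSuperElementary.exists_extension`). A proper substructure never separates some pair of twin
points of the dual poset (`exists_twin`), so it is enough to separate one such pair: Splitting does
it for two points with the same label and the same points strictly above, Splitting followed by
Catenarity for a point and its least strict upper bound. With local finiteness this gives a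
back-and-forth between any two super `d`-scaled lattices sharing a finite substructure, hence
isomorphism in the countable case; completeness follows by Löwenheim–Skolem.

Existence. Any instance of an existential axiom over a finite lattice is solved in a larger finite
one, by adding points to the dual poset or by separating a lower set into two sheets
(`exists_solution_lowerSet`); a direct limit is super `d`-scaled (`FiniteSubscaled.exists_super`).

Axioms and decidability. Scaling speaks of prime filters but is equivalent to the first-order
condition `Descending`, so that the class over a finite `L₀` is defined by one sentence. A complete
theory with the models of one sentence is decidable because unsatisfiability is recursively
enumerable; here this is obtained without a proof calculus, by turning satisfiability into that of a
primitive recursive set of propositional clauses with Henkin witnesses. Every super `d`-scaled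
lattice contains the prime lattice generated by its constants, so the completions are the `T_d(L₀)`,
and the theory of all of them is a finite intersection of decidable theories. -/

namespace ScaledLattice

universe w

/-! ### Embeddings and the operations of the language. -/

section Maps

variable {d : ℕ} {M : Type u} {N : Type v} [(lang d).Structure M] [(lang d).Structure N]

theorem map_bot (g : M ↪[lang d] N) : g (bot d) = bot d :=
  (g.map_fun Fn.zero ![]).trans (congrArg _ (Subsingleton.elim _ _))

theorem map_top (g : M ↪[lang d] N) : g (top d) = top d :=
  (g.map_fun Fn.one ![]).trans (congrArg _ (Subsingleton.elim _ _))

theorem map_comp (g : M ↪[lang d] N) (i : Fin (d + 1)) (a : M) :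
    g (comp d i a) = comp d i (g a) :=
  (g.map_fun (Fn.comp i) ![a]).trans
    (congrArg _ (by funext j; fin_cases j; rfl))

theorem map_join (g : M ↪[lang d] N) (a b : M) : g (join d a b) = join d (g a) (g b) :=
  (g.map_fun Fn.join ![a, b]).trans (congrArg _ (by funext j; fin_cases j <;> rfl))

theorem map_meet (g : M ↪[lang d] N) (a b : M) : g (meet d a b) = meet d (g a) (g b) :=
  (g.map_fun Fn.meet ![a, b]).trans (congrArg _ (by funext j; fin_cases j <;> rfl))

theorem map_diff (g : M ↪[lang d] N) (a b : M) : g (diff d a b) = diff d (g a) (g b) :=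
  (g.map_fun Fn.diff ![a, b]).trans (congrArg _ (by funext j; fin_cases j <;> rfl))

/-- An injective map which preserves all operations is an embedding. -/
def mkEmbedding (f : M → N) (inj : Function.Injective f) (hbot : f (bot d) = bot d)
    (htop : f (top d) = top d) (hjoin : ∀ a b, f (join d a b) = join d (f a) (f b))
    (hmeet : ∀ a b, f (meet d a b) = meet d (f a) (f b))
    (hdiff : ∀ a b, f (diff d a b) = diff d (f a) (f b))
    (hcomp : ∀ i a, f (comp d i a) = comp d i (f a)) : M ↪[lang d] N where
  toFun := f
  inj' := inj
  map_fun' := by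
    intro n F x
    have e1 : ∀ y : Fin 1 → M, y = ![y 0] := fun y => by funext j; fin_cases j; rfl
    have e2 : ∀ y : Fin 2 → M, y = ![y 0, y 1] := fun y => by funext j; fin_cases j <;> rfl
    have e1' : ∀ y : Fin 1 → N, y = ![y 0] := fun y => by funext j; fin_cases j; rfl
    have e2' : ∀ y : Fin 2 → N, y = ![y 0, y 1] := fun y => by funext j; fin_cases j <;> rfl
    cases F with
    | zero =>
      rw [Subsingleton.elim x ![], Subsingleton.elim (f ∘ ![]) (![])]
      exact hbot
    | one =>
      rw [Subsingleton.elim x ![], Subsingleton.elim (f ∘ ![]) (![])]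
      exact htop
    | comp i => rw [e1 x, e1' (f ∘ _)]; exact hcomp i _
    | join => rw [e2 x, e2' (f ∘ _)]; exact hjoin _ _
    | meet => rw [e2 x, e2' (f ∘ _)]; exact hmeet _ _
    | diff => rw [e2 x, e2' (f ∘ _)]; exact hdiff _ _
  map_rel' := fun r => Empty.elim r

theorem map_joinComp (g : M ↪[lang d] N) (I : Finset (Fin (d + 1))) (a : M) :
    g (joinComp d I a) = joinComp d I (g a) := by
  unfold joinComp
  induction (List.finRange (d + 1)).filter (fun i => decide (i ∈ I)) with
  | nil => exact map_bot g
  | cons i l ih => simp only [List.foldr_cons, map_join, map_comp, ih]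

theorem map_le (g : M ↪[lang d] N) (a b : M) : le d (g a) (g b) ↔ le d a b := by
  rw [le, le, ← map_join, g.injective.eq_iff]

theorem scdim_map (g : M ↪[lang d] N) (a : M) : scdim d (g a) = scdim d a := by
  simp only [scdim, ← map_joinComp, g.injective.eq_iff]

end Maps

/-! ### Sc-dimension in terms of finite joins of components. -/

section Low

variable (d : ℕ) {M : Type u} [(lang d).Structure M]

/-- The finite set of the `i ≤ d` with `i < n`. -/
abbrev below (n : ℕ) : Finset (Fin (d + 1)) := Finset.univ.filter fun i => (i : ℕ) < n

/-- `a` is the join of its components of index less than `n`. -/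
def Low (n : ℕ) (a : M) : Prop := joinComp d (below d n) a = a

variable {d}

/-- This is used in arbitrary structures, where `Low` need not be monotone in its index; hence the
existential quantifier. The index `m` is `l + 1` for a value `l` admitted in the minimum, with `m =
0` for `l = -1`, so `l ≤ d` becomes `m ≤ d + 1`. -/
theorem scdim_lt_iff_exists (n : ℕ) (a : M) :
    scdim d a < (n : WithBot ℕ∞) ↔ ∃ m ≤ n, m ≤ d + 1 ∧ Low d m a := by
  classical
  unfold scdim
  rw [sInf_lt_iff]
  constructor
  · rintro ⟨l, ⟨hl, ha⟩, hn⟩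
    induction l with
    | bot =>
      refine ⟨0, by simp, by simp, ?_⟩
      rw [Low]
      convert ha.symm using 2
      ext i
      simp
    | coe l =>
      have hl' : l ≤ (d : ℕ∞) := by exact_mod_cast hl
      obtain ⟨k, rfl⟩ := ENat.ne_top_iff_exists.1 (ne_top_of_le_ne_top (ENat.natCast_ne_top d) hl')
      have hkn : k < n := by exact_mod_cast hn
      have hkd : k ≤ d := by exact_mod_cast hl'
      refine ⟨k + 1, hkn, by omega, ?_⟩
      rw [Low]
      convert ha.symm using 2
      ext i
      simp only [Finset.mem_filter, Finset.mem_univ, true_and, Nat.lt_succ_iff]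
      exact_mod_cast Iff.rfl
  · rintro ⟨m, hm, hmd, ha⟩
    cases m with
    | zero =>
      refine ⟨⊥, ⟨bot_le, ?_⟩, by exact_mod_cast WithBot.bot_lt_coe (n : ℕ∞)⟩
      rw [Low] at ha
      convert ha.symm using 2
      ext i
      simp
    | succ k =>
      refine ⟨((k : ℕ) : WithBot ℕ∞), ⟨by exact_mod_cast Nat.le_of_succ_le_succ hmd, ?_⟩,
        by exact_mod_cast hm⟩
      rw [Low] at ha
      convert ha.symm using 2
      ext i
      simp only [Finset.mem_filter, Finset.mem_univ, true_and, Nat.lt_succ_iff]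
      exact_mod_cast Iff.rfl

theorem scdim_le_iff_lt (n : ℕ) (a : M) :
    scdim d a ≤ (n : WithBot ℕ∞) ↔ scdim d a < ((n + 1 : ℕ) : WithBot ℕ∞) := by
  cases h : scdim d a with
  | bot => simp
  | coe l =>
    cases l with
    | top =>
      have h1 : ((⊤ : ℕ∞) : WithBot ℕ∞) = ⊤ := rfl
      constructor
      · intro hh
        have : (⊤ : ℕ∞) ≤ n := by exact_mod_cast hh
        simp at this
      · intro hh
        have : (⊤ : ℕ∞) < (n + 1 : ℕ) := by exact_mod_cast hh
        simp at this
    | coe k =>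
      constructor
      · intro hh
        have : k ≤ n := by exact_mod_cast hh
        exact_mod_cast Nat.lt_succ_of_le this
      · intro hh
        have : k < n + 1 := by exact_mod_cast hh
        exact_mod_cast Nat.le_of_lt_succ this

end Low

/-! ### The axioms of subscaled lattices are universal. -/

section Universal

variable (d : ℕ) {M : Type u} [(lang d).Structure M]

/-- The instances at `a, b, c` of the axioms of `d`-subscaled lattices, in quantifier-free form. -/
structure AxiomsAt (a b c : M) : Prop where
  join_comm : join d a b = join d b a
  meet_comm : meet d a b = meet d b a
  join_assoc : join d (join d a b) c = join d a (join d b c)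
  meet_assoc : meet d (meet d a b) c = meet d a (meet d b c)
  join_meet_self : join d a (meet d a b) = a
  meet_join_self : meet d a (join d a b) = a
  bot_le : le d (bot d) a
  le_top : le d a (top d)
  le_join_diff : le d a (join d b (diff d a b))
  diff_le : le d a (join d b c) → le d (diff d a b) c
  joinComp_univ : joinComp d Finset.univ a = a
  comp_joinComp : ∀ (I : Finset (Fin (d + 1))) (k : Fin (d + 1)),
    (k ∉ I → comp d k (joinComp d I a) = bot d) ∧
    (k ∈ I → comp d k (joinComp d I a) = comp d k a)
  comp_join : ∀ (k : Fin (d + 1)),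
    max (scdim d a) (scdim d b) ≤ ((k : ℕ) : WithBot ℕ∞) →
    comp d k (join d a b) = join d (comp d k a) (comp d k b)
  scdim_meet_lt : ∀ (i j : Fin (d + 1)), i ≠ j →
    scdim d (meet d (comp d i a) (comp d j a)) < ((min (i : ℕ) (j : ℕ) : ℕ) : WithBot ℕ∞)
  comp_diff : ∀ (k : Fin (d + 1)), scdim d b ≤ ((k : ℕ) : WithBot ℕ∞) →
    diff d (comp d k a) b = diff d (comp d k a) (comp d k b)
  scdim_lt : le d b a → diff d a b = a → a ≠ bot d → scdim d b < scdim d a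

variable {d}

theorem IsTCLattice.le_refl (h : IsTCLattice d M) (a : M) : le d a a := by
  have := h.join_meet_self a (join d a a)
  rwa [h.meet_join_self] at this

theorem IsTCLattice.le_trans (h : IsTCLattice d M) {a b c : M} (h1 : le d a b) (h2 : le d b c) :
    le d a c := by
  unfold le at *
  rw [← h2, ← h.join_assoc, h1]

theorem IsTCLattice.le_antisymm (h : IsTCLattice d M) {a b : M} (h1 : le d a b)
    (h2 : le d b a) : a = b := by
  unfold le at *
  rw [← h1, h.join_comm, h2]

theorem IsTCLattice.le_join_left (h : IsTCLattice d M) (a b : M) : le d a (join d a b) := by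
  unfold le
  rw [← h.join_assoc, h.le_refl]

theorem IsTCLattice.le_join_right (h : IsTCLattice d M) (a b : M) : le d b (join d a b) := by
  rw [h.join_comm]; exact h.le_join_left b a

theorem IsTCLattice.join_le (h : IsTCLattice d M) {a b c : M} (h1 : le d a c) (h2 : le d b c) :
    le d (join d a b) c := by
  unfold le at *
  rw [h.join_assoc, h2, h1]

theorem IsTCLattice.diff_le_iff (h : IsTCLattice d M) (a b c : M) :
    le d (diff d a b) c ↔ le d a (join d b c) :=
  ⟨fun h1 => h.le_trans (h.le_join_diff a b)
    (h.join_le (h.le_join_left _ _) (h.le_trans h1 (h.le_join_right _ _))), h.diff_le a b c⟩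

/-- The difference absorbs the quantifier hidden in `≪`: if `a - b < a`, then `c = a - b` violates
the definition, since `a ≤ b ∨ (a - b)`; conversely `b ∨ c = a` forces `a - b ≤ c`. -/
theorem IsTCLattice.ll_iff (h : IsTCLattice d M) (a b : M) :
    ll d b a ↔ le d b a ∧ diff d a b = a ∧ a ≠ bot d := by
  constructor
  · rintro ⟨⟨h1, h2⟩, h3⟩
    have hle : le d (diff d a b) a := (h.diff_le_iff _ _ _).2 (h.le_join_right _ _)
    have hd : diff d a b = a := by
      by_contra hne
      obtain ⟨h4, h5⟩ := h3 _ ⟨hle, hne⟩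
      exact h5 (h.le_antisymm h4 (h.le_join_diff a b))
    refine ⟨h1, hd, fun h0 => h2 ?_⟩
    exact h.le_antisymm h1 (h0 ▸ h.bot_le b)
  · rintro ⟨h1, h2, h3⟩
    refine ⟨⟨h1, fun h4 => h3 ?_⟩, fun c ⟨hc1, hc2⟩ => ⟨h.join_le h1 hc1, fun h4 => hc2 ?_⟩⟩
    · subst h4
      refine h.le_antisymm ?_ (h.bot_le b)
      rw [← h2]
      exact (h.diff_le_iff _ _ _).2 (h.le_join_left _ _)
    · refine h.le_antisymm hc1 ?_
      rw [← h2]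
      refine (h.diff_le_iff _ _ _).2 ?_
      rw [h4]; exact h.le_refl _

/-- Only axiom 6 hides a quantifier over elements, in `≪`, and `IsTCLattice.ll_iff` removes it.
Closure under substructures and direct limits and definability by one sentence all rest on this
form. -/
theorem isSubscaled_iff : IsSubscaled d M ↔ ∀ a b c : M, AxiomsAt d a b c := by
  constructor
  · intro h a b c
    refine ⟨h.join_comm a b, h.meet_comm a b, h.join_assoc a b c, h.meet_assoc a b c,
      h.join_meet_self a b, h.meet_join_self a b, h.bot_le a, h.le_top a, h.le_join_diff a b,
      h.diff_le a b c, h.joinComp_univ a, fun I k => h.comp_joinComp I k a,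
      fun k => h.comp_join k a b, fun i j => h.scdim_meet_lt i j a, fun k => h.comp_diff k a b,
      fun h1 h2 h3 => h.scdim_lt_of_ll a b ((h.toIsTCLattice.ll_iff a b).2 ⟨h1, h2, h3⟩)⟩
  · intro h
    have htc : IsTCLattice d M := ⟨fun a b => (h a b a).join_comm, fun a b => (h a b a).meet_comm,
      fun a b c => (h a b c).join_assoc, fun a b c => (h a b c).meet_assoc,
      fun a b => (h a b a).join_meet_self, fun a b => (h a b a).meet_join_self,
      fun a => (h a a a).bot_le, fun a => (h a a a).le_top, fun a b => (h a b a).le_join_diff,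
      fun a b c => (h a b c).diff_le⟩
    refine ⟨htc, fun a => (h a a a).joinComp_univ, fun I k a => (h a a a).comp_joinComp I k,
      fun k a b => (h a b a).comp_join k, fun i j a => (h a a a).scdim_meet_lt i j,
      fun k a b => (h a b a).comp_diff k, fun a b hll => ?_⟩
    obtain ⟨h1, h2, h3⟩ := (htc.ll_iff a b).1 hll
    exact (h a b a).scdim_lt h1 h2 h3

theorem axiomsAt_map {N : Type v} [(lang d).Structure N] (g : M ↪[lang d] N) (a b c : M) :
    AxiomsAt d (g a) (g b) (g c) ↔ AxiomsAt d a b c := by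
  constructor
  · rintro ⟨h1, h2, h3, h4, h5, h6, h7, h8, h9, h10, h11, h12, h13, h14, h15, h16⟩
    simp only [← map_bot g, ← map_top g, ← map_join, ← map_meet, ← map_diff, ← map_comp,
      ← map_joinComp, map_le, g.injective.eq_iff, g.injective.ne_iff, scdim_map] at *
    exact ⟨h1, h2, h3, h4, h5, h6, h7, h8, h9, h10, h11, h12, h13, h14, h15, h16⟩
  · rintro ⟨h1, h2, h3, h4, h5, h6, h7, h8, h9, h10, h11, h12, h13, h14, h15, h16⟩
    constructor <;>
    simp only [← map_bot g, ← map_top g, ← map_join, ← map_meet, ← map_diff, ← map_comp,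
      ← map_joinComp, map_le, g.injective.eq_iff, g.injective.ne_iff, scdim_map] <;>
    assumption

theorem IsSubscaled.of_embedding {N : Type v} [(lang d).Structure N] (g : M ↪[lang d] N)
    (h : IsSubscaled d N) : IsSubscaled d M :=
  isSubscaled_iff.2 fun a b c => (axiomsAt_map g a b c).1 (isSubscaled_iff.1 h _ _ _)

theorem IsSubscaled.substructure (h : IsSubscaled d M) (S : (lang d).Substructure M) :
    IsSubscaled d S :=
  .of_embedding S.subtype h

end Universal

/-- A poset with strictly increasing labels in `{0, …, d}`. -/
class GradedPoset (d : ℕ) (K : Type u) [PartialOrder K] where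
  lab : K → ℕ
  lab_lt : ∀ {x y : K}, x < y → lab x < lab y
  lab_le : ∀ x : K, lab x ≤ d

open ScaledLattice.GradedPoset (lab)

/-! ### The subscaled lattice of lower sets of a graded poset. -/

section LowerSets

variable (d : ℕ) {K : Type u} [PartialOrder K] [GradedPoset d K]

theorem GradedPoset.lab_mono {x y : K} (h : x ≤ y) : lab d x ≤ lab d y := by
  rcases h.eq_or_lt with rfl | h
  · rfl
  · exact (GradedPoset.lab_lt h).le

/-- The set of maximal points of `A` with label `i`, closed downwards. -/
def LowerSet.comp (i : ℕ) (A : LowerSet K) : LowerSet K :=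
  lowerClosure {x | Maximal (· ∈ A) x ∧ lab d x = i}

/-- The scaled structure of the lattice of lower sets of a graded poset. -/
instance lowerSetStructure : (lang d).Structure (LowerSet K) where
  funMap := fun F x => match F, x with
    | Fn.zero, _ => ⊥
    | Fn.one, _ => ⊤
    | Fn.comp i, x => LowerSet.comp d i (x 0)
    | Fn.join, x => x 0 ⊔ x 1
    | Fn.meet, x => x 0 ⊓ x 1
    | Fn.diff, x => lowerClosure ((x 0 : Set K) \ x 1)
  RelMap := fun r => Empty.elim r

variable {d} {A B : LowerSet K} {x : K}

theorem lowerSet_join : join d A B = A ⊔ B := rfl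

@[simp] theorem notMem_lowerSet_bot : x ∉ (bot d : LowerSet K) := fun h => h

@[simp] theorem mem_lowerSet_top : x ∈ (top d : LowerSet K) := trivial

@[simp] theorem mem_lowerSet_join : x ∈ join d A B ↔ x ∈ A ∨ x ∈ B := Iff.rfl

theorem mem_lowerSet_diff : x ∈ diff d A B ↔ ∃ y ∈ A, y ∉ B ∧ x ≤ y := by
  change x ∈ lowerClosure ((A : Set K) \ B) ↔ _
  simp [mem_lowerClosure, and_assoc]

theorem mem_lowerSet_comp {i : Fin (d + 1)} :
    x ∈ comp d i A ↔ ∃ y, Maximal (· ∈ A) y ∧ lab d y = i ∧ x ≤ y := by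
  change x ∈ LowerSet.comp d i A ↔ _
  simp [LowerSet.comp, mem_lowerClosure, and_assoc]

theorem lowerSet_le_iff : le d A B ↔ A ≤ B := by
  rw [le, lowerSet_join, sup_eq_right]

/-- Labels grow strictly and never exceed `d`, so climbing inside `A` stops. -/
theorem exists_maximal_ge (d : ℕ) [GradedPoset d K] (hx : x ∈ A) : ∃ y,
    Maximal (· ∈ A) y ∧ x ≤ y := by
  induction h : d - lab d x using Nat.strong_induction_on generalizing x with
  | _ n ih =>
    by_cases hm : Maximal (· ∈ A) x
    · exact ⟨x, hm, le_rfl⟩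
    · simp only [Maximal, not_and, not_forall] at hm
      obtain ⟨z, hz, hxz, hzx⟩ := hm hx
      have hlt : x < z := lt_of_le_not_ge hxz hzx
      have h1 := GradedPoset.lab_lt (d := d) hlt
      have h2 := GradedPoset.lab_le (d := d) z
      obtain ⟨y, hy, hzy⟩ := ih _ (by omega) hz rfl
      exact ⟨y, hy, hxz.trans hzy⟩

theorem mem_joinComp {I : Finset (Fin (d + 1))} :
    x ∈ joinComp d I A ↔ ∃ i ∈ I, x ∈ comp d i A := by
  have : ∀ l : List (Fin (d + 1)),
      x ∈ l.foldr (fun i X => join d (comp d i A) X) (bot d) ↔ ∃ i ∈ l, x ∈ comp d i A := by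
    intro l
    induction l with
    | nil => simp
    | cons i l ih => simp [ih]
  rw [joinComp, this]
  simp

theorem mem_joinComp_iff_maximal {I : Finset (Fin (d + 1))} :
    x ∈ joinComp d I A ↔ ∃ y, Maximal (· ∈ A) y ∧ (∃ i ∈ I, lab d y = i) ∧ x ≤ y := by
  rw [mem_joinComp]
  constructor
  · rintro ⟨i, hi, h⟩
    obtain ⟨y, hy, hyi, hxy⟩ := mem_lowerSet_comp.1 h
    exact ⟨y, hy, ⟨i, hi, hyi⟩, hxy⟩
  · rintro ⟨y, hy, ⟨i, hi, hyi⟩, hxy⟩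
    exact ⟨i, hi, mem_lowerSet_comp.2 ⟨y, hy, hyi, hxy⟩⟩

theorem joinComp_le_self {I : Finset (Fin (d + 1))} : joinComp d I A ≤ A := by
  intro x hx
  obtain ⟨y, hy, -, hxy⟩ := mem_joinComp_iff_maximal.1 hx
  exact A.lower hxy hy.1

theorem comp_le_self {i : Fin (d + 1)} : comp d i A ≤ A := by
  intro x hx
  obtain ⟨y, hy, -, hxy⟩ := mem_lowerSet_comp.1 hx
  exact A.lower hxy hy.1

/-- Every point lies below a maximal point, whose label is at least as large; the sc-dimension of a
lower set is therefore its greatest label. -/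
theorem low_lowerSet_iff {n : ℕ} : Low d n A ↔ ∀ x ∈ A, lab d x < n := by
  constructor
  · intro h x hx
    rw [← h] at hx
    obtain ⟨y, -, ⟨i, hi, hyi⟩, hxy⟩ := mem_joinComp_iff_maximal.1 hx
    have := GradedPoset.lab_mono d hxy
    simp only [below, Finset.mem_filter, Finset.mem_univ, true_and] at hi
    omega
  · intro h
    refine le_antisymm joinComp_le_self fun x hx => ?_
    obtain ⟨y, hy, hxy⟩ := exists_maximal_ge d hx
    refine mem_joinComp_iff_maximal.2 ⟨y, hy, ⟨⟨lab d y,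
        Nat.lt_succ_of_le (GradedPoset.lab_le y)⟩, ?_, rfl⟩, hxy⟩
    simpa using h y hy.1

theorem scdim_lowerSet_lt_iff {n : ℕ} :
    scdim d A < (n : WithBot ℕ∞) ↔ ∀ x ∈ A, lab d x < n := by
  rw [scdim_lt_iff_exists]
  constructor
  · rintro ⟨m, hm, -, h⟩ x hx
    exact (low_lowerSet_iff.1 h x hx).trans_le hm
  · intro h
    refine ⟨min n (d + 1), min_le_left _ _, min_le_right _ _, low_lowerSet_iff.2 fun x hx => ?_⟩
    exact lt_min (h x hx) (Nat.lt_succ_of_le (GradedPoset.lab_le x))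

theorem scdim_lowerSet_le_iff {n : ℕ} :
    scdim d A ≤ (n : WithBot ℕ∞) ↔ ∀ x ∈ A, lab d x ≤ n := by
  rw [scdim_le_iff_lt, scdim_lowerSet_lt_iff]
  simp only [Nat.lt_succ_iff]

theorem scdim_lowerSet_lt_scdim (h : ∀ x ∈ B, ∃ y ∈ A, lab d x < lab d y)
    (hA : ∃ x, x ∈ A) : scdim d B < scdim d A := by
  by_contra hlt
  rw [not_lt] at hlt
  by_cases hB : ∃ x, x ∈ B
  -- A point of `B` with the greatest label computes the sc-dimension of `B`; it exists since labels
  -- are bounded by `d`.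
  · obtain ⟨x, hx, hmax⟩ : ∃ x ∈ B, ∀ y ∈ B, lab d y ≤ lab d x := by
      have hfin : {n | ∃ x ∈ B, lab d x = n}.Finite :=
        (Set.finite_Iic d).subset fun n ⟨x, _, hx⟩ => hx ▸ GradedPoset.lab_le x
      obtain ⟨n, ⟨x, hx, rfl⟩, hn⟩ := hfin.exists_maximal
        (by obtain ⟨x, hx⟩ := hB; exact ⟨_, x, hx, rfl⟩)
      refine ⟨x, hx, fun y hy => ?_⟩
      by_contra hc
      exact hc (hn ⟨y, hy, rfl⟩ (by omega))
    obtain ⟨y, hy, hxy⟩ := h x hx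
    have := scdim_lowerSet_le_iff.1 (hlt.trans (scdim_lowerSet_le_iff.2 hmax)) y hy
    omega
  · obtain ⟨x, hx⟩ := hA
    have h0 : scdim d B < ((0 : ℕ) : WithBot ℕ∞) :=
      scdim_lowerSet_lt_iff.2 fun y hy => absurd ⟨y, hy⟩ hB
    have := scdim_lowerSet_lt_iff.1 (hlt.trans_lt h0) x hx
    omega

theorem maximal_mem_joinComp {I : Finset (Fin (d + 1))} :
    Maximal (· ∈ joinComp d I A) x ↔ Maximal (· ∈ A) x ∧ ∃ i ∈ I, lab d x = i := by
  constructor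
  · intro h
    obtain ⟨y, hy, hi, hxy⟩ := mem_joinComp_iff_maximal.1 h.1
    have : y ∈ joinComp d I A := mem_joinComp_iff_maximal.2 ⟨y, hy, hi, le_rfl⟩
    obtain rfl := le_antisymm hxy (h.2 this hxy)
    exact ⟨hy, hi⟩
  · rintro ⟨h, hi⟩
    exact ⟨mem_joinComp_iff_maximal.2 ⟨x, h, hi, le_rfl⟩,
      fun y hy hxy => h.2 (joinComp_le_self hy) hxy⟩

-- Each axiom is a remark on maximal points. Axiom 3: when no label exceeds `k`, the component of
-- index `k` is generated by the points of label `k`. Axiom 4: a point common to two components of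
-- different index is strictly below a maximal point of each. Axiom 5: when no label of `B` exceeds
-- `k`, a point of `B` of label `k` is maximal in `B`. Axiom 6: if `A - B = A`, every point of `B ⊆
-- A` is strictly below a point of `A`.
variable (d K) in
theorem isSubscaled_lowerSet : IsSubscaled d (LowerSet K) := by
  rw [isSubscaled_iff]
  intro A B C
  refine ⟨sup_comm A B, inf_comm A B, sup_assoc A B C, inf_assoc A B C, sup_inf_self,
    inf_sup_self, lowerSet_le_iff.2 _root_.bot_le, lowerSet_le_iff.2 _root_.le_top,
    lowerSet_le_iff.2 fun x hx => ?_, fun h => lowerSet_le_iff.2 fun x hx => ?_, ?_, ?_, ?_, ?_, ?_,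
    ?_⟩
  · by_cases hB : x ∈ B
    · exact Or.inl hB
    · exact Or.inr (mem_lowerSet_diff.2 ⟨x, hx, hB, le_rfl⟩)
  · obtain ⟨y, hy, hyB, hxy⟩ := mem_lowerSet_diff.1 hx
    exact C.lower hxy ((lowerSet_le_iff.1 h hy).resolve_left hyB)
  · refine le_antisymm joinComp_le_self fun x hx => ?_
    obtain ⟨y, hy, hxy⟩ := exists_maximal_ge d hx
    exact mem_joinComp_iff_maximal.2
      ⟨y, hy, ⟨⟨lab d y, Nat.lt_succ_of_le (GradedPoset.lab_le y)⟩, by simp, rfl⟩, hxy⟩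
  · intro I k
    refine ⟨fun hk => ?_, fun hk => ?_⟩
    · refine le_antisymm (fun x hx => ?_) _root_.bot_le
      obtain ⟨y, hy, hyk, -⟩ := mem_lowerSet_comp.1 hx
      obtain ⟨-, i, hi, hyi⟩ := maximal_mem_joinComp.1 hy
      exact absurd ((Fin.ext (hyi.symm.trans hyk)) ▸ hi) hk
    · ext x
      simp only [SetLike.mem_coe, mem_lowerSet_comp, maximal_mem_joinComp]
      constructor
      · rintro ⟨y, ⟨hy, -⟩, h⟩
        exact ⟨y, hy, h⟩
      · rintro ⟨y, hy, hyk, h⟩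
        exact ⟨y, ⟨hy, k, hk, hyk⟩, hyk, h⟩
  · intro k hk
    rw [max_le_iff, scdim_lowerSet_le_iff, scdim_lowerSet_le_iff] at hk
    have key : ∀ X : LowerSet K, (∀ x ∈ X, lab d x ≤ k) → ∀ x, x ∈ comp d k X ↔
        ∃ y ∈ X, lab d y = k ∧ x ≤ y := by
      intro X hX x
      rw [mem_lowerSet_comp]
      constructor
      · rintro ⟨y, hy, h⟩
        exact ⟨y, hy.1, h⟩
      · rintro ⟨y, hy, hyk, h⟩
        refine ⟨y, ⟨hy, fun z hz hyz => ?_⟩, hyk, h⟩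
        by_contra hzy
        have := GradedPoset.lab_lt (d := d) (lt_of_le_not_ge hyz hzy)
        have := hX z hz
        omega
    ext x
    simp only [SetLike.mem_coe, mem_lowerSet_join]
    rw [key _ hk.1, key _ hk.2, key _ (by rintro x (hx | hx); exacts [hk.1 x hx, hk.2 x hx])]
    simp only [mem_lowerSet_join, or_and_right, exists_or]
  · intro i j hij
    rw [scdim_lowerSet_lt_iff]
    rintro x ⟨h1, h2⟩
    obtain ⟨y, hy, hyi, hxy⟩ := mem_lowerSet_comp.1 h1
    obtain ⟨z, hz, hzj, hxz⟩ := mem_lowerSet_comp.1 h2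
    have hne : y ≠ z := by
      rintro rfl
      exact hij (Fin.ext (hyi.symm.trans hzj))
    have h3 : x < y := hxy.lt_of_ne fun h => hne <| by
      subst h
      exact le_antisymm hxz (hy.2 hz.1 hxz)
    have h4 : x < z := hxz.lt_of_ne fun h => hne <| by
      subst h
      exact le_antisymm (hz.2 hy.1 hxy) hxy
    rw [← hyi, ← hzj]
    exact lt_min (GradedPoset.lab_lt h3) (GradedPoset.lab_lt h4)
  · intro k hk
    rw [scdim_lowerSet_le_iff] at hk
    ext x
    simp only [SetLike.mem_coe, mem_lowerSet_diff]
    constructor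
    · rintro ⟨y, hy, hyB, hxy⟩
      exact ⟨y, hy, fun h => hyB (comp_le_self h), hxy⟩
    · rintro ⟨y, hy, hyB, hxy⟩
      obtain ⟨z, hz, hzk, hyz⟩ := mem_lowerSet_comp.1 hy
      have hzB : z ∉ comp d k B := fun h => hyB ((comp d k B).lower hyz h)
      refine ⟨z, mem_lowerSet_comp.2 ⟨z, hz, hzk, le_rfl⟩, fun h => hzB ?_, hxy.trans hyz⟩
      refine mem_lowerSet_comp.2 ⟨z, ⟨h, fun t ht hzt => ?_⟩, hzk, le_rfl⟩
      by_contra htz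
      have := GradedPoset.lab_lt (d := d) (lt_of_le_not_ge hzt htz)
      have := hk t ht
      omega
  · intro h1 h2 h3
    rw [lowerSet_le_iff] at h1
    refine scdim_lowerSet_lt_scdim (fun x hx => ?_) ?_
    · have := h1 hx
      rw [← h2] at this
      obtain ⟨y, hy, hyB, hxy⟩ := mem_lowerSet_diff.1 this
      exact ⟨y, hy, GradedPoset.lab_lt (hxy.lt_of_ne fun h => hyB (h ▸ hx))⟩
    · by_contra hc
      exact h3 (le_antisymm (fun x hx => absurd ⟨x, hx⟩ hc) _root_.bot_le)

end LowerSets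

/-! ### P-morphisms and the embeddings dual to them. -/

section PMorphisms

variable (d : ℕ) {K : Type u} {J : Type v} [PartialOrder K] [PartialOrder J] [GradedPoset d K]
  [GradedPoset d J]

/-- The maps between graded posets which are dual to homomorphisms of subscaled lattices. -/
structure IsPMorphism (f : K → J) : Prop where
  mono : Monotone f
  lift : ∀ x y, f x ≤ y → ∃ z, x ≤ z ∧ f z = y ∧ lab d z = lab d y

/-- The preimage of a lower set under a monotone map. -/
def preimage (f : K → J) (hf : Monotone f) (A : LowerSet J) : LowerSet K :=
  ⟨f ⁻¹' A, fun _ _ h hx => A.lower (hf h) hx⟩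

variable {d}

@[simp] theorem mem_preimage {f : K → J} {hf : Monotone f} {A : LowerSet J} {x : K} :
    x ∈ preimage f hf A ↔ f x ∈ A := Iff.rfl

/-- The lifting condition at `f x` itself gives a point above `x` with the label of `f x`. The
inequality may be strict: a point can be merged with its least strict upper bound. -/
theorem IsPMorphism.lab_le {f : K → J} (hf : IsPMorphism d f) (x : K) :
    lab d x ≤ lab d (f x) := by
  obtain ⟨z, hz, -, h⟩ := hf.lift x (f x) le_rfl
  exact h ▸ GradedPoset.lab_mono d hz

theorem IsPMorphism.preimage_diff {f : K → J} (hf : IsPMorphism d f) (A B : LowerSet J) :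
    preimage f hf.mono (diff d A B) = diff d (preimage f hf.mono A) (preimage f hf.mono B) := by
  ext x
  simp only [SetLike.mem_coe, mem_preimage, mem_lowerSet_diff]
  constructor
  · rintro ⟨y, hy, hyB, h⟩
    obtain ⟨z, hz, rfl, -⟩ := hf.lift x y h
    exact ⟨z, hy, hyB, hz⟩
  · rintro ⟨y, hy, hyB, h⟩
    exact ⟨f y, hy, hyB, hf.mono h⟩

/-- A maximal point `y` of the preimage keeps its label, since the lift of `f y` lies above `y`
inside the preimage and so equals `y`. Conversely the lift `z` of a maximal point of `A` has the
label of its image, which bounds the label of any `t ≥ z` with the same image; so `z` is maximal. -/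
theorem IsPMorphism.preimage_comp {f : K → J} (hf : IsPMorphism d f) (i : Fin (d + 1))
    (A : LowerSet J) : preimage f hf.mono (comp d i A) = comp d i (preimage f hf.mono A) := by
  ext x
  simp only [SetLike.mem_coe, mem_preimage, mem_lowerSet_comp]
  constructor
  · rintro ⟨y, hy, hyi, h⟩
    obtain ⟨z, hz, rfl, hzl⟩ := hf.lift x y h
    refine ⟨z, ⟨hy.1, fun t ht hzt => ?_⟩, hzl.trans hyi, hz⟩
    have h1 : f t = f z := le_antisymm (hy.2 ht (hf.mono hzt)) (hf.mono hzt)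
    by_contra hc
    have h2 := GradedPoset.lab_lt (d := d) (lt_of_le_not_ge hzt hc)
    have h3 := hf.lab_le t
    rw [h1] at h3
    omega
  · rintro ⟨y, hy, hyi, h⟩
    refine ⟨f y, ⟨hy.1, fun t ht hyt => ?_⟩, ?_, hf.mono h⟩
    · obtain ⟨z, hz, rfl, -⟩ := hf.lift y t hyt
      exact hf.mono (hy.2 ht hz)
    · obtain ⟨z, hz, hzy, hzl⟩ := hf.lift y (f y) le_rfl
      have hzA : z ∈ preimage f hf.mono A := by
        rw [mem_preimage, hzy]; exact hy.1
      rw [← hzl, le_antisymm (hy.2 hzA hz) hz]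
      exact hyi

/-- The embedding of lattices of lower sets dual to a surjective p-morphism. -/
def IsPMorphism.embedding {f : K → J} (hf : IsPMorphism d f) (hs : Function.Surjective f) :
    LowerSet J ↪[lang d] LowerSet K :=
  mkEmbedding (preimage f hf.mono)
    (fun A B h => by
      ext x
      obtain ⟨y, rfl⟩ := hs x
      exact Set.ext_iff.1 (congrArg SetLike.coe h) y)
    rfl rfl (fun _ _ => rfl) (fun _ _ => rfl) hf.preimage_diff hf.preimage_comp

end PMorphisms

theorem mem_finset_sup {K ι : Type*} [PartialOrder K] {s : Finset ι} {f : ι → LowerSet K} {x : K} :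
    x ∈ s.sup f ↔ ∃ i ∈ s, x ∈ f i := by
  classical
  induction s using Finset.induction_on with
  | empty => simp
  | insert i s hi ih => simp [ih]

theorem mem_finset_inf {K ι : Type*} [PartialOrder K] {s : Finset ι} {f : ι → LowerSet K} {x : K} :
    x ∈ s.inf f ↔ ∀ i ∈ s, x ∈ f i := by
  classical
  induction s using Finset.induction_on with
  | empty => simp
  | insert i s hi ih => simp [ih]

/-! ### The prime spectrum of a topologically complemented lattice. -/

section Spectrum

variable (d : ℕ) (M : Type u) [(lang d).Structure M]

/-- The prime filters of `M`, ordered by reverse inclusion. -/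
def Spec : Type u := {F : Set M // IsPrimeFilter d F}

instance : PartialOrder (Spec d M) :=
  inferInstanceAs (PartialOrder {F : Set M // IsPrimeFilter d F}ᵒᵈ)

instance : SetLike (Spec d M) M := ⟨fun p => p.1, Subtype.val_injective⟩

variable {d M}

theorem Spec.le_iff {p q : Spec d M} : p ≤ q ↔ ∀ a ∈ q, a ∈ p := Iff.rfl

/-- A topologically complemented lattice is distributive. -/
abbrev IsTCLattice.distribLattice (h : IsTCLattice d M) : DistribLattice M :=
  have inf_le (a b : M) : le d (meet d a b) a := by
    unfold le; rw [h.join_comm, h.join_meet_self]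
  have le_inf (a b c : M) (h1 : le d a b) (h2 : le d a c) : le d a (meet d b c) := by
    have e (x y : M) (hxy : le d x y) : meet d x y = x := by
      rw [← show join d x y = y from hxy, h.meet_join_self]
    have : meet d a (meet d b c) = a := by rw [← h.meet_assoc, e a b h1, e a c h2]
    rw [← this]
    unfold le
    rw [h.join_comm, h.meet_comm a, h.join_meet_self]
  have inf_le' (a b : M) : le d (meet d a b) b := by rw [h.meet_comm]; exact inf_le b a
  { le := le d
    le_refl := h.le_refl
    le_trans := fun _ _ _ => h.le_trans
    le_antisymm := fun _ _ => h.le_antisymm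
    sup := join d
    inf := meet d
    le_sup_left := h.le_join_left
    le_sup_right := h.le_join_right
    sup_le := fun _ _ _ => h.join_le
    inf_le_left := inf_le
    inf_le_right := inf_le'
    le_inf := le_inf
    -- Joining with `a` has the left adjoint `· - a`, so it preserves binary meets.
    le_sup_inf := fun a b c => (h.diff_le_iff _ _ _).1 <| le_inf _ _ _
      ((h.diff_le_iff _ _ _).2 (inf_le _ _)) ((h.diff_le_iff _ _ _).2 (inf_le' _ _)) }

/-- The filter is the complement of a prime ideal that contains `I` and is disjoint from the
principal filter of `a`. -/
theorem IsTCLattice.exists_prime (h : IsTCLattice d M) {I : Set M} (h0 : bot d ∈ I)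
    (hI : ∀ a b, a ∈ I → b ∈ I → join d a b ∈ I) (hl : ∀ a b, le d a b → b ∈ I → a ∈ I) {a : M}
    (ha : a ∉ I) : ∃ p : Spec d M, a ∈ p ∧ ∀ b ∈ I, b ∉ p := by
  let := h.distribLattice
  let I' : Order.Ideal M :=
    { carrier := I
      lower' := fun x y hxy hx => hl y x hxy hx
      nonempty' := ⟨_, h0⟩
      directed' := fun x hx y hy => ⟨_, hI x y hx hy, le_sup_left (a := x), le_sup_right (a := x)⟩ }
  have hd : Disjoint ((Order.PFilter.principal a : Order.PFilter M) : Set M) (I' : Set M) := by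
    rw [Set.disjoint_left]
    intro x hx hxI
    exact ha (hl a x (Order.PFilter.mem_principal.1 hx) hxI)
  obtain ⟨J, hJ, hIJ, hJa⟩ := DistribLattice.prime_ideal_of_disjoint_filter_ideal hd
  have haJ : a ∉ J := Set.disjoint_left.1 hJa (Order.PFilter.mem_principal.2 (_root_.le_refl a))
  refine ⟨⟨{x | x ∉ J}, ?_, ?_, ?_, ?_, ?_⟩, haJ, fun b hb hbJ => hbJ (hIJ hb)⟩
  · exact fun ht => haJ (J.lower (show a ≤ top d from h.le_top a) ht)
  · exact fun hb => hb (hIJ h0)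
  · exact fun x y hxy hx hy => hx (J.lower (show x ≤ y from hxy) hy)
  · intro x y hx hy hxy
    rcases hJ.mem_or_mem (x := x) (y := y) hxy with h1 | h1
    exacts [hx h1, hy h1]
  · intro x y hxy
    by_contra hc
    simp only [Set.mem_ofPred_eq, not_or, not_not] at hc
    exact hxy (Order.Ideal.sup_mem hc.1 hc.2)

section TC

variable (h : IsTCLattice d M) {p : Spec d M} {a b c : M}
include h

omit h in
theorem mem_of_le (hab : le d a b) (ha : a ∈ p) : b ∈ p := p.2.mem_of_le a b hab ha

theorem IsTCLattice.mem_join : join d a b ∈ p ↔ a ∈ p ∨ b ∈ p :=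
  ⟨p.2.mem_or_mem a b, fun h1 => h1.elim (mem_of_le (h.le_join_left a b))
    (mem_of_le (h.le_join_right a b))⟩

theorem IsTCLattice.mem_meet : meet d a b ∈ p ↔ a ∈ p ∧ b ∈ p := by
  let := h.distribLattice
  exact ⟨fun h1 => ⟨mem_of_le (inf_le_left (a := a) (b := b)) h1,
    mem_of_le (inf_le_right (a := a) (b := b)) h1⟩, fun h1 => p.2.meet_mem a b h1.1 h1.2⟩

theorem IsTCLattice.le_iff_forall_mem : le d a b ↔ ∀ p : Spec d M, a ∈ p → b ∈ p := by
  refine ⟨fun h1 p => mem_of_le h1, fun h1 => ?_⟩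
  by_contra hc
  obtain ⟨p, hp, hb⟩ := h.exists_prime (I := {x | le d x b}) (h.bot_le b)
    (fun x y hx hy => h.join_le hx hy) (fun x y hxy hy => h.le_trans hxy hy) hc
  exact hb b (h.le_refl b) (h1 p hp)

theorem IsTCLattice.eq_iff_forall_mem : a = b ↔ ∀ p : Spec d M, a ∈ p ↔ b ∈ p := by
  refine ⟨fun h1 p => h1 ▸ Iff.rfl, fun h1 => h.le_antisymm ?_ ?_⟩
  · exact h.le_iff_forall_mem.2 fun p => (h1 p).1
  · exact h.le_iff_forall_mem.2 fun p => (h1 p).2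

/-- The prime `q` separates `a` from the ideal generated by `b` and the complement of `p`. That
ideal does not contain `a`: from `a ≤ b ∨ z` follows `a - b ≤ z`, so `z ∈ p`. -/
theorem IsTCLattice.mem_diff : diff d a b ∈ p ↔ ∃ q, p ≤ q ∧ a ∈ q ∧ b ∉ q := by
  constructor
  · intro h1
    obtain ⟨q, hq, hI⟩ := h.exists_prime (I := {x | ∃ z ∉ p, le d x (join d b z)}) (a := a)
      ⟨bot d, p.2.bot_notMem, h.bot_le _⟩
      (fun x y ⟨z, hz, hx⟩ ⟨t, ht, hy⟩ => ⟨join d z t, fun hzt => (h.mem_join.1 hzt).elim hz ht, by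
        refine h.join_le (h.le_trans hx (h.join_le (h.le_join_left _ _) ?_))
          (h.le_trans hy (h.join_le (h.le_join_left _ _) ?_))
        · exact h.le_trans (h.le_join_left _ _) (h.le_join_right _ _)
        · exact h.le_trans (h.le_join_right _ _) (h.le_join_right _ _)⟩)
      (fun x y hxy ⟨z, hz, hy⟩ => ⟨z, hz, h.le_trans hxy hy⟩)
      (fun ⟨z, hz, haz⟩ => hz (mem_of_le ((h.diff_le_iff _ _ _).2 haz) h1))
    refine ⟨q, fun z hz => ?_, hq, hI b ⟨bot d, p.2.bot_notMem, h.le_join_left _ _⟩⟩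
    by_contra hzp
    exact hI z ⟨z, hzp, h.le_join_right _ _⟩ hz
  · rintro ⟨q, hpq, ha, hb⟩
    exact hpq ((h.mem_join.1 (mem_of_le (h.le_join_diff a b) ha)).resolve_left hb)

theorem IsTCLattice.mem_joinComp {I : Finset (Fin (d + 1))} :
    joinComp d I a ∈ p ↔ ∃ i ∈ I, comp d i a ∈ p := by
  have : ∀ l : List (Fin (d + 1)),
      l.foldr (fun i X => join d (comp d i a) X) (bot d) ∈ p ↔ ∃ i ∈ l, comp d i a ∈ p := by
    intro l
    induction l with
    | nil => exact iff_of_false p.2.bot_notMem (by simp)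
    | cons i l ih => simp [ih, h.mem_join]
  rw [joinComp, this]
  simp

theorem IsTCLattice.joinComp_singleton (i : Fin (d + 1)) : joinComp d {i} a = comp d i a :=
  h.eq_iff_forall_mem.2 fun p => by simp [h.mem_joinComp]

end TC

theorem Spec.bot_notMem (p : Spec d M) : bot d ∉ p := p.2.bot_notMem

theorem Spec.top_mem (p : Spec d M) : top d ∈ p := p.2.top_mem

end Spectrum

/-! ### Representation of subscaled lattices over their spectra. -/

section Subscaled

variable {d : ℕ} {M : Type u} [(lang d).Structure M] (h : IsSubscaled d M) {a b : M}
include h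

theorem IsSubscaled.tc : IsTCLattice d M := h.toIsTCLattice

theorem IsSubscaled.comp_le (i : Fin (d + 1)) (a : M) : le d (comp d i a) a :=
  h.tc.le_iff_forall_mem.2 fun p hp => by
    rw [← h.joinComp_univ a, h.tc.mem_joinComp]
    exact ⟨i, Finset.mem_univ _, hp⟩

theorem IsSubscaled.comp_comp_self (i : Fin (d + 1)) (a : M) :
    comp d i (comp d i a) = comp d i a := by
  have := (h.comp_joinComp {i} i a).2 (by simp)
  rwa [h.tc.joinComp_singleton] at this

theorem IsSubscaled.comp_comp_ne {i j : Fin (d + 1)} (hij : i ≠ j) (a : M) :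
    comp d i (comp d j a) = bot d := by
  have := (h.comp_joinComp {j} i a).1 (by simpa using hij)
  rwa [h.tc.joinComp_singleton] at this

theorem IsSubscaled.joinComp_le (I : Finset (Fin (d + 1))) (a : M) : le d (joinComp d I a) a :=
  h.tc.le_iff_forall_mem.2 fun p hp => by
    obtain ⟨i, -, hi⟩ := h.tc.mem_joinComp.1 hp
    exact mem_of_le (h.comp_le i a) hi

theorem IsSubscaled.low_iff {n : ℕ} :
    Low d n a ↔ ∀ i : Fin (d + 1), n ≤ i → comp d i a = bot d := by
  constructor
  · intro hl i hi
    rw [← hl]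
    exact (h.comp_joinComp _ i a).1 (by simpa using hi)
  · intro hl
    refine h.tc.le_antisymm (h.joinComp_le _ a) (h.tc.le_iff_forall_mem.2 fun p hp => ?_)
    rw [← h.joinComp_univ a, h.tc.mem_joinComp] at hp
    obtain ⟨i, -, hi⟩ := hp
    refine h.tc.mem_joinComp.2 ⟨i, ?_, hi⟩
    simp only [below, Finset.mem_filter, Finset.mem_univ, true_and]
    by_contra hc
    rw [hl i (by omega)] at hi
    exact p.bot_notMem hi

theorem IsSubscaled.low_mono {m n : ℕ} (hmn : m ≤ n) (ha : Low d m a) : Low d n a :=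
  h.low_iff.2 fun i hi => h.low_iff.1 ha i (hmn.trans hi)

theorem IsSubscaled.low_of_gt {n : ℕ} (hn : d < n) : Low d n a :=
  h.low_iff.2 fun i hi => absurd i.2 (by omega)

theorem IsSubscaled.scdim_lt_iff {n : ℕ} : scdim d a < (n : WithBot ℕ∞) ↔ Low d n a := by
  rw [scdim_lt_iff_exists]
  constructor
  · rintro ⟨m, hm, -, hl⟩
    exact h.low_mono hm hl
  · intro hl
    rcases le_or_gt n (d + 1) with hn | hn
    · exact ⟨n, le_rfl, hn, hl⟩
    · exact ⟨d + 1, hn.le, le_rfl, h.low_of_gt (by omega)⟩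

theorem IsSubscaled.scdim_le_iff {n : ℕ} : scdim d a ≤ (n : WithBot ℕ∞) ↔ Low d (n + 1) a := by
  rw [scdim_le_iff_lt, h.scdim_lt_iff]

theorem IsSubscaled.low_comp (i : Fin (d + 1)) (a : M) : Low d (i + 1) (comp d i a) :=
  h.low_iff.2 fun j hj => h.comp_comp_ne (by rintro rfl; omega) a

theorem IsSubscaled.low_zero : Low d 0 a ↔ a = bot d := by
  have : joinComp d (below d 0) a = bot d :=
    h.tc.eq_iff_forall_mem.2 fun p => by simp [h.tc.mem_joinComp, p.bot_notMem]
  rw [Low, this, eq_comm]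

/-- Downward induction on the index of the component: once the components of `a` of index above `i`
vanish, axiom 3 applies to `a ∨ b = b` at index `i` and gives `Cⁱ(a) ≤ Cⁱ(b) = 0`. -/
theorem IsSubscaled.low_of_le {n : ℕ} (hab : le d a b) (hb : Low d n b) : Low d n a := by
  have key : ∀ m, ∀ i : Fin (d + 1), d - i ≤ m → n ≤ i → comp d i a = bot d := by
    intro m
    induction m using Nat.strong_induction_on with
    | _ m ih =>
      intro i him hi
      have ha : Low d (i + 1) a := h.low_iff.2 fun j hj => ih (d - j) (by omega) j le_rfl (by omega)
      have := h.comp_join i a b (max_le (h.scdim_le_iff.2 ha)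
        (h.scdim_le_iff.2 (h.low_mono (by omega) hb)))
      rw [show join d a b = b from hab, h.low_iff.1 hb i hi] at this
      refine h.tc.le_antisymm ?_ (h.bot_le _)
      exact h.tc.le_trans (h.tc.le_join_left _ (bot d)) (this ▸ h.tc.le_refl _)
  exact h.low_iff.2 fun i => key _ i le_rfl

theorem IsSubscaled.low_of_diff_eq {n : ℕ} (hba : le d b a) (hd : diff d a b = a)
    (ha : Low d (n + 1) a) : Low d n b := by
  by_cases h0 : a = bot d
  · refine h.low_mono (Nat.zero_le n) (h.low_zero.2 (h.tc.le_antisymm ?_ (h.bot_le _)))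
    exact h0 ▸ hba
  · exact h.scdim_lt_iff.1 ((h.scdim_lt_of_ll a b ((h.tc.ll_iff a b).2 ⟨hba, hd, h0⟩)).trans_le
      (h.scdim_le_iff.2 ha))

omit h in
open Classical in
/-- The label of a prime filter: the least sc-dimension of its elements. -/
noncomputable def Spec.label (p : Spec d M) : ℕ := sInf {n | ∃ a ∈ p, Low d (n + 1) a}

theorem IsSubscaled.exists_low_label (p : Spec d M) : ∃ a ∈ p, Low d (p.label + 1) a :=
  Nat.sInf_mem (s := {n | ∃ a ∈ p, Low d (n + 1) a})
    ⟨d, top d, p.top_mem, h.low_of_gt (Nat.lt_succ_self d)⟩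

theorem IsSubscaled.label_lt {p : Spec d M} {n : ℕ} (ha : a ∈ p) (hl : Low d n a) :
    p.label < n := by
  cases n with
  | zero => exact absurd (h.low_zero.1 hl ▸ ha) p.bot_notMem
  | succ k => exact Nat.lt_succ_of_le (Nat.sInf_le ⟨a, ha, hl⟩)

/-- Take `a ∈ q` of least sc-dimension and `x` in `p` but not in `q`. Then `a - x ∈ q`, while `x ∧
(a - x)` belongs to `p` and is `≪ a - x`; axiom 6 makes its sc-dimension smaller. -/
theorem IsSubscaled.label_lt_label {p q : Spec d M} (hpq : p < q) : p.label < q.label := by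
  obtain ⟨a, ha, hl⟩ := h.exists_low_label q
  obtain ⟨x, hxp, hxq⟩ : ∃ x ∈ p, x ∉ q := by
    by_contra hc
    push Not at hc
    exact hpq.not_ge hc
  have he : ∀ r : Spec d M, a ∈ r → x ∉ r → diff d a x ∈ r := fun r h1 h2 =>
    (h.tc.mem_join.1 (mem_of_le (h.le_join_diff a x) h1)).resolve_left h2
  have hea : le d (diff d a x) a := (h.tc.diff_le_iff _ _ _).2 (h.tc.le_join_right _ _)
  refine h.label_lt (a := meet d x (diff d a x)) (h.tc.mem_meet.2 ⟨hxp, hpq.le (he q ha hxq)⟩)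
    (h.low_of_diff_eq (a := diff d a x) ?_ ?_ (h.low_of_le hea hl))
  · exact h.tc.le_iff_forall_mem.2 fun r hr => (h.tc.mem_meet.1 hr).2
  · refine h.tc.eq_iff_forall_mem.2 fun r => ⟨fun hr => ?_, fun hr => ?_⟩
    · obtain ⟨s, hs, h1, -⟩ := h.tc.mem_diff.1 hr
      exact hs h1
    · obtain ⟨s, hs, h1, h2⟩ := h.tc.mem_diff.1 hr
      exact h.tc.mem_diff.2 ⟨s, hs, he s h1 h2, fun h3 => h2 (h.tc.mem_meet.1 h3).1⟩

/-- The spectrum of a `d`-subscaled lattice is a graded poset. -/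
@[reducible] noncomputable def IsSubscaled.gradedSpec : GradedPoset d (Spec d M) where
  lab := Spec.label
  lab_lt := h.label_lt_label
  lab_le p := Nat.le_of_lt_succ (h.label_lt p.top_mem (h.low_of_gt (Nat.lt_succ_self d)))

/-- Otherwise `p` contains some `e` of sc-dimension less than `i`, and axiom 5 gives `Cⁱ(a) - e =
Cⁱ(a) - 0`. So some prime `q ≥ p` contains `Cⁱ(a)` but not `e`; by maximality `q = p`, which
contains `e`. -/
theorem IsSubscaled.label_of_maximal_comp {p : Spec d M} {i : Fin (d + 1)}
    (hp : Maximal (comp d i a ∈ ·) p) : p.label = i := by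
  have h1 := h.label_lt hp.1 (h.low_comp i a)
  by_contra hne
  obtain ⟨e, he, hl⟩ := h.exists_low_label p
  have hl' : Low d i e := h.low_mono (by omega) hl
  have h2 := h.comp_diff i a e (h.scdim_le_iff.2 (h.low_mono (Nat.le_succ _) hl'))
  rw [h.low_iff.1 hl' i le_rfl] at h2
  have h3 : diff d (comp d i a) e ∈ p := h2 ▸ h.tc.mem_diff.2 ⟨p, le_rfl, hp.1, p.bot_notMem⟩
  obtain ⟨q, hpq, hq, heq⟩ := h.tc.mem_diff.1 h3
  exact heq (hp.2 hq hpq he)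

/-- A maximal prime `p` of `Cⁱ(a)` is still maximal for `a`: a prime of `a` above it lies in some
`Cʲ(a)`, and `j ≠ i` would put `Cⁱ(a) ∧ Cʲ(a)` in `p`, which has label `i`, against axiom 4. -/
theorem IsSubscaled.mem_comp {q : Spec d M} {i : Fin (d + 1)} :
    comp d i a ∈ q ↔ ∃ p, Maximal (a ∈ ·) p ∧ p.label = (i : ℕ) ∧ q ≤ p := by
  let := h.gradedSpec
  constructor
  · intro hq
    let A : LowerSet (Spec d M) := ⟨{p | comp d i a ∈ p}, fun p p' hp h1 => hp h1⟩
    obtain ⟨p, hp, hqp⟩ := exists_maximal_ge (A := A) d hq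
    have hpi := h.label_of_maximal_comp hp
    refine ⟨p, ⟨mem_of_le (h.comp_le i a) hp.1, fun p' hp' hpp' => ?_⟩, hpi, hqp⟩
    rw [← h.joinComp_univ a, h.tc.mem_joinComp] at hp'
    obtain ⟨j, -, hj⟩ := hp'
    by_cases hij : i = j
    · subst hij
      exact hp.2 hj hpp'
    · have h1 := h.label_lt (h.tc.mem_meet.2 ⟨hp.1, hpp' hj⟩)
        (h.scdim_lt_iff.1 (h.scdim_meet_lt i j a hij))
      omega
  · rintro ⟨p, hp, hpi, hqp⟩
    have h1 := hp.1
    rw [← h.joinComp_univ a, h.tc.mem_joinComp] at h1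
    obtain ⟨j, -, hj⟩ := h1
    have h2 := h.label_of_maximal_comp (i := j)
      ⟨hj, fun p' hp' hpp' => hp.2 (mem_of_le (h.comp_le j a) hp') hpp'⟩
    obtain rfl : j = i := Fin.ext (h2.symm.trans hpi)
    exact hqp hj

/-- Every `d`-subscaled lattice embeds in the lattice of lower sets of its spectrum. -/
noncomputable def IsSubscaled.repr :
    letI := h.gradedSpec
    M ↪[lang d] LowerSet (Spec d M) :=
  letI := h.gradedSpec
  mkEmbedding (fun a => ⟨{p | a ∈ p}, fun _ _ hp h1 => hp h1⟩)
    (fun a b hab => h.tc.eq_iff_forall_mem.2 fun p => Set.ext_iff.1 (congrArg SetLike.coe hab) p)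
    (by ext p; exact iff_of_false p.bot_notMem notMem_lowerSet_bot)
    (by ext p; exact iff_of_true p.top_mem mem_lowerSet_top)
    (fun a b => by ext p; exact h.tc.mem_join)
    (fun a b => by ext p; exact h.tc.mem_meet)
    (fun a b => by
      ext p
      refine h.tc.mem_diff.trans (Iff.trans ?_ mem_lowerSet_diff.symm)
      exact ⟨fun ⟨q, h1, h2, h3⟩ => ⟨q, h2, h3, h1⟩, fun ⟨q, h2, h3, h1⟩ => ⟨q, h1, h2, h3⟩⟩)
    (fun i a => by
      ext p
      exact h.mem_comp.trans (mem_lowerSet_comp (d := d) (i := i) (x := p)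
        (A := (⟨{p | a ∈ p}, fun _ _ hp h1 => hp h1⟩ : LowerSet (Spec d M)))).symm)

theorem IsSubscaled.mem_repr {p : Spec d M} :
    letI := h.gradedSpec
    p ∈ h.repr a ↔ a ∈ p := Iff.rfl

/-- In a finite lattice the principal lower set of `p` is represented by the meet of all elements of
`p`, and every lower set is a finite join of principal ones. -/
theorem IsSubscaled.repr_surjective [Finite M] :
    letI := h.gradedSpec
    Function.Surjective h.repr := by
  classical
  let := h.gradedSpec
  intro A
  have : Finite (Spec d M) := inferInstanceAs (Finite {F : Set M // IsPrimeFilter d F})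
  let := Fintype.ofFinite M
  let := Fintype.ofFinite (Spec d M)
  have hIic : ∀ p : Spec d M, LowerSet.Iic p ∈ Set.range h.repr := by
    intro p
    have e : LowerSet.Iic p = (Finset.univ.filter (· ∈ p)).inf h.repr := by
      ext q
      simp only [SetLike.mem_coe, LowerSet.mem_Iic_iff, Spec.le_iff, mem_finset_inf]
      simp [h.mem_repr]
    rw [e]
    refine Finset.inf_induction ⟨top d, map_top _⟩ ?_ fun a _ => ⟨a, rfl⟩
    rintro _ ⟨a, rfl⟩ _ ⟨b, rfl⟩
    exact ⟨meet d a b, map_meet _ _ _⟩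
  have e : A = (Finset.univ.filter (· ∈ A)).sup LowerSet.Iic := by
    ext q
    simp only [SetLike.mem_coe, mem_finset_sup, Finset.mem_filter, Finset.mem_univ,
      true_and, LowerSet.mem_Iic_iff]
    exact ⟨fun hq => ⟨q, hq, le_rfl⟩, fun ⟨p, hp, hqp⟩ => A.lower hqp hp⟩
  rw [e]
  refine Finset.sup_induction (p := (· ∈ Set.range h.repr)) ⟨bot d, map_bot _⟩ ?_
    fun p _ => hIic p
  rintro _ ⟨a, rfl⟩ _ ⟨b, rfl⟩
  exact ⟨join d a b, map_join _ _ _⟩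

end Subscaled

/-! ### Types of points and local finiteness. -/

section LocallyFinite

/-- The possible isomorphism types of depth `k` of a point of a graded poset, relative to a family
of lower sets indexed by `ι`. -/
def TypeSpace (d : ℕ) (ι : Type w) : ℕ → Type w
  | 0 => Fin (d + 1) × Set ι
  | k + 1 => (Fin (d + 1) × Set ι) × Set (TypeSpace d ι k)

instance TypeSpace.finite (d : ℕ) (ι : Type w) [Finite ι] : ∀ k, Finite (TypeSpace d ι k)
  | 0 => inferInstanceAs (Finite (Fin (d + 1) × Set ι))
  | k + 1 =>
    have := TypeSpace.finite d ι k
    inferInstanceAs (Finite ((Fin (d + 1) × Set ι) × Set (TypeSpace d ι k)))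

variable {d : ℕ} {ι : Type w} {K : Type u} [PartialOrder K] [GradedPoset d K]

/-- The label of `x` and the indices of the members of the family which contain `x`. -/
def color (d : ℕ) [GradedPoset d K] (A : ι → LowerSet K) (x : K) : Fin (d + 1) × Set ι :=
  (⟨lab d x, Nat.lt_succ_of_le (GradedPoset.lab_le x)⟩, {i | x ∈ A i})

/-- The type of depth `k` of `x`. -/
def typeAt (d : ℕ) [GradedPoset d K] (A : ι → LowerSet K) : (k : ℕ) → K → TypeSpace d ι k
  | 0, x => color d A x
  | k + 1, x => (color d A x, typeAt d A k '' {y | x < y})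

theorem color_eq_of_typeAt_eq {A : ι → LowerSet K} {k : ℕ} {x y : K}
    (h : typeAt d A k x = typeAt d A k y) : color d A x = color d A y := by
  cases k with
  | zero => exact h
  | succ k => exact congrArg Prod.fst h

theorem lab_eq_of_color_eq {A : ι → LowerSet K} {x y : K} (h : color d A x = color d A y) :
    lab d x = lab d y := Fin.ext_iff.1 (congrArg Prod.fst h)

/-- Depth `d - lab x` already determines all types: each step strictly upwards raises the label, and
nothing lies above a point of label `d`. -/
theorem typeAt_eq_of_typeAt_eq {A : ι → LowerSet K} {k : ℕ} {x y : K}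
    (h : typeAt d A k x = typeAt d A k y) (hk : d ≤ k + lab d x) (m : ℕ) :
    typeAt d A m x = typeAt d A m y := by
  induction k generalizing x y m with
  | zero =>
    have hc := color_eq_of_typeAt_eq h
    have hl := lab_eq_of_color_eq hc
    cases m with
    | zero => exact hc
    | succ m =>
      have e : ∀ z : K, d ≤ lab d z → {t | z < t} = ∅ := fun z hz => by
        ext t
        simp only [Set.mem_ofPred_eq, Set.mem_empty_iff_false, iff_false]
        intro hzt
        have := GradedPoset.lab_lt (d := d) hzt
        have := GradedPoset.lab_le (d := d) t
        omega
      refine Prod.ext hc ?_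
      change typeAt d A m '' _ = typeAt d A m '' _
      rw [e x (by omega), e y (by omega)]
  | succ k ih =>
    have hc := color_eq_of_typeAt_eq h
    have hl := lab_eq_of_color_eq hc
    cases m with
    | zero => exact hc
    | succ m =>
      have h2 : typeAt d A k '' {z | x < z} = typeAt d A k '' {z | y < z} := congrArg Prod.snd h
      refine Prod.ext hc (Set.Subset.antisymm ?_ ?_)
      · rintro _ ⟨z, hz, rfl⟩
        obtain ⟨t, ht, hzt⟩ := h2.subset ⟨z, hz, rfl⟩
        have := GradedPoset.lab_lt (d := d) (show x < z from hz)
        exact ⟨t, ht, (ih hzt.symm (by omega) m).symm⟩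
      · rintro _ ⟨z, hz, rfl⟩
        obtain ⟨t, ht, hzt⟩ := h2.superset ⟨z, hz, rfl⟩
        have := GradedPoset.lab_lt (d := d) (show y < z from hz)
        have := lab_eq_of_color_eq (color_eq_of_typeAt_eq hzt)
        exact ⟨t, ht, ih hzt (by omega) m⟩

/-- Two points are similar if they have the same types of all depths. -/
def Similar (d : ℕ) [GradedPoset d K] (A : ι → LowerSet K) (x y : K) : Prop :=
  ∀ m, typeAt d A m x = typeAt d A m y

theorem Similar.symm {A : ι → LowerSet K} {x y : K} (h : Similar d A x y) : Similar d A y x :=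
  fun m => (h m).symm

/-- Similarity is a bisimulation: the type of depth `d + 1` records the types of depth `d` of the
points above, and those determine all the others. -/
theorem Similar.lift {A : ι → LowerSet K} {x y z : K} (h : Similar d A x y) (hz : x ≤ z) :
    ∃ t, y ≤ t ∧ Similar d A z t := by
  rcases hz.eq_or_lt with rfl | hz
  · exact ⟨y, le_rfl, h⟩
  · have h2 : typeAt d A d '' {z | x < z} = typeAt d A d '' {z | y < z} :=
      congrArg Prod.snd (h (d + 1))
    obtain ⟨t, ht, hzt⟩ := h2.subset ⟨z, hz, rfl⟩
    exact ⟨t, le_of_lt ht, typeAt_eq_of_typeAt_eq hzt.symm (by omega)⟩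

theorem Similar.lab_eq {A : ι → LowerSet K} {x y : K} (h : Similar d A x y) :
    lab d x = lab d y := lab_eq_of_color_eq (h 0)

/-- The lower sets which are unions of similarity classes. -/
def invariantSubstructure (d : ℕ) [GradedPoset d K] (A : ι → LowerSet K) :
    (lang d).Substructure (LowerSet K) where
  carrier := {S | ∀ x y, Similar d A x y → x ∈ S → y ∈ S}
  fun_mem := by
    intro n F v hv
    cases F with
    | zero => exact fun x y _ hx => hx
    | one => exact fun x y _ hx => hx
    | comp i =>
      intro x y hxy hx
      obtain ⟨z, hz, hzi, hxz⟩ := mem_lowerSet_comp.1 (show x ∈ comp d i (v 0) from hx)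
      obtain ⟨t, ht, hzt⟩ := hxy.lift hxz
      refine mem_lowerSet_comp.2 ⟨t, ⟨hv 0 _ _ hzt hz.1, fun s hs hts => ?_⟩,
        hzt.lab_eq ▸ hzi, ht⟩
      obtain ⟨r, hr, hsr⟩ := hzt.symm.lift hts
      have h1 := hz.2 (hv 0 _ _ hsr hs) hr
      by_contra hc
      have h2 := GradedPoset.lab_lt (d := d) (lt_of_le_not_ge hts hc)
      rw [hsr.lab_eq, ← hzt.lab_eq] at h2
      exact absurd (GradedPoset.lab_mono d h1) (by omega)
    | join =>
      exact fun x y hxy hx => Or.imp (hv 0 x y hxy) (hv 1 x y hxy) hx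
    | meet =>
      exact fun x y hxy hx => And.imp (hv 0 x y hxy) (hv 1 x y hxy) hx
    | diff =>
      intro x y hxy hx
      obtain ⟨z, hz, hzi, hxz⟩ := mem_lowerSet_diff.1 (show x ∈ diff d (v 0) (v 1) from hx)
      obtain ⟨t, ht, hzt⟩ := hxy.lift hxz
      exact (mem_lowerSet_diff (d := d)).2 ⟨t, hv 0 _ _ hzt hz, fun h =>
          hzi (hv 1 _ _ hzt.symm h), ht⟩

/-- The target does not depend on `K`, which bounds the number of invariant lower sets uniformly. -/
theorem invariantSubstructure_injective (A : ι → LowerSet K) : Function.Injective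
    fun S : invariantSubstructure d A => typeAt d A d '' (S.1 : Set K) := by
  intro S T hST
  have key : ∀ S T : invariantSubstructure d A,
      typeAt d A d '' (S.1 : Set K) ⊆ typeAt d A d '' (T.1 : Set K) → S.1 ≤ T.1 := by
    intro S T h x hx
    obtain ⟨y, hy, hxy⟩ := h ⟨x, hx, rfl⟩
    exact T.2 y x (typeAt_eq_of_typeAt_eq (d := d) hxy (by omega)) hy
  exact Subtype.ext (le_antisymm (key S T hST.subset) (key T S hST.superset))

variable {M : Type u} [(lang d).Structure M]

/-- The substructure consists of the elements represented by invariant lower sets. Its bound depends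
only on `d` and `ι`; for empty `ι` it bounds all prime subscaled lattices at once. -/
theorem IsSubscaled.exists_finite_substructure (h : IsSubscaled d M) [Finite ι] (a : ι → M) :
    ∃ S : (lang d).Substructure M, (∀ i, a i ∈ S) ∧ Finite S ∧
      Nat.card S ≤ Nat.card (Set (TypeSpace d ι d)) := by
  let := h.gradedSpec
  let A : ι → LowerSet (Spec d M) := fun i => h.repr (a i)
  let f : (invariantSubstructure d A).comap h.repr.toHom → Set (TypeSpace d ι d) :=
    fun S => typeAt d A d '' (h.repr S.1 : Set (Spec d M))
  have hf : Function.Injective f := by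
    intro S T hST
    have := @invariantSubstructure_injective _ _ _ _ _ A ⟨h.repr S.1, S.2⟩ ⟨h.repr T.1, T.2⟩ hST
    exact Subtype.ext (h.repr.injective (Subtype.ext_iff.1 this))
  refine ⟨_, fun i => ?_, Finite.of_injective f hf, Nat.card_le_card_of_injective f hf⟩
  -- The type of depth `0` records which members of the family contain the point.
  exact fun x y hxy hx => (Set.ext_iff.1 (congrArg Prod.snd (hxy 0)) i).1 hx

theorem IsSubscaled.finite_of_fg (h : IsSubscaled d M) {S : (lang d).Substructure M} (hS : S.FG) :
    Finite S := by
  obtain ⟨s, rfl⟩ := hS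
  obtain ⟨T, hT, hfin, -⟩ := h.exists_finite_substructure (fun i : s => (i : M))
  have hle : Substructure.closure (lang d) (s : Set M) ≤ T :=
    Substructure.closure_le.2 fun x hx => hT ⟨x, hx⟩
  exact Finite.of_injective _ (Substructure.inclusion hle).injective

end LocallyFinite

theorem eq_of_forall_lt_natCast_iff {x y : WithBot ℕ∞}
    (h : ∀ n : ℕ, x < (n : WithBot ℕ∞) ↔ y < (n : WithBot ℕ∞)) : x = y := by
  have key : ∀ x y : WithBot ℕ∞, (∀ n : ℕ, y < (n : WithBot ℕ∞) → x < (n : WithBot ℕ∞)) →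
      x ≤ y := by
    intro x y h
    cases y with
    | bot =>
      have := h 0 (by exact_mod_cast WithBot.bot_lt_coe (0 : ℕ∞))
      cases x with
      | bot => exact le_rfl
      | coe x =>
        have h0 : x < 0 := by exact_mod_cast this
        simp at h0
    | coe y =>
      cases y with
      | top => exact le_top
      | coe m =>
        have := h (m + 1) (by exact_mod_cast Nat.lt_succ_self m)
        cases x with
        | bot => exact _root_.bot_le
        | coe x =>
          have h0 : x < (m + 1 : ℕ) := by exact_mod_cast this
          obtain ⟨k, rfl⟩ := ENat.ne_top_iff_exists.1 (ne_top_of_lt h0)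
          have h1 : k < m + 1 := by exact_mod_cast h0
          exact_mod_cast Nat.le_of_lt_succ h1
  exact le_antisymm (key x y fun n => (h n).2) (key y x fun n => (h n).1)

/-! ### Scaling and purity as first-order conditions. -/

section Dimension

variable {d : ℕ} {M : Type u} [(lang d).Structure M]

/-- The prime filters which contain `a`, ordered by inclusion. -/
abbrev PrimesOver (d : ℕ) {M : Type u} [(lang d).Structure M] (a : M) : Type u :=
  {F : Set M // IsPrimeFilter d F ∧ a ∈ F}

/-- A prime filter which contains `a`, as a point of the spectrum. -/
def PrimesOver.toSpec {a : M} (F : PrimesOver d a) : Spec d M := ⟨F.1, F.2.1⟩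

theorem PrimesOver.mem_toSpec {a : M} (F : PrimesOver d a) : a ∈ F.toSpec := F.2.2

variable (h : IsSubscaled d M) {a b : M}
include h

theorem IsSubscaled.label_toSpec_lt {F G : PrimesOver d a} (hFG : F < G) :
    G.toSpec.label < F.toSpec.label := h.label_lt_label (p := G.toSpec) (q := F.toSpec) hFG

theorem IsSubscaled.label_ltSeries (s : LTSeries (PrimesOver d a)) (i j : Fin (s.length + 1))
    (hij : i ≤ j) : (s j).toSpec.label + (j - i : ℕ) ≤ (s i).toSpec.label := by
  induction j using Fin.induction with
  | zero =>
    obtain rfl : i = 0 := le_antisymm hij (Fin.zero_le _)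
    simp
  | succ j ih =>
    rcases hij.eq_or_lt with rfl | hlt
    · simp
    · have h1 := ih (Fin.le_castSucc_iff.2 hlt)
      have h2 := h.label_toSpec_lt (s.step j)
      have h3 : (i : ℕ) < j + 1 := by simpa using Fin.lt_def.1 hlt
      simp only [Fin.val_succ, Fin.val_castSucc] at *
      omega

/-- One half of Scaling is automatic: the primes containing `a` have labels below `n`, and labels
drop along a chain of growing filters. -/
theorem IsSubscaled.dim_lt_of_low {n : ℕ} (hl : Low d n a) : dim d a < (n : WithBot ℕ∞) := by
  by_contra hc
  obtain ⟨s, hs⟩ := Order.le_krullDim_iff.1 (not_lt.1 hc)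
  have h1 := h.label_ltSeries s 0 (Fin.last _) (Fin.zero_le _)
  have h2 := h.label_lt (PrimesOver.mem_toSpec (s 0)) hl
  simp only [Fin.val_last, Fin.coe_ofNat_eq_mod, Nat.zero_mod] at h1
  omega

theorem IsSubscaled.diff_eq_of_low {i : Fin (d + 1)} (ha : comp d i a = a) (hb : Low d i b) :
    diff d a b = a := by
  have h1 := h.comp_diff i a b (h.scdim_le_iff.2 (h.low_mono (Nat.le_succ _) hb))
  rw [h.low_iff.1 hb i le_rfl, ha] at h1
  rw [h1]
  exact h.tc.eq_iff_forall_mem.2 fun p => h.tc.mem_diff.trans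
    ⟨fun ⟨q, h1, h2, _⟩ => h1 h2, fun h2 => ⟨p, le_rfl, h2, p.bot_notMem⟩⟩

theorem IsSubscaled.exists_mem_of_ne_bot (ha : a ≠ bot d) : ∃ p : Spec d M, a ∈ p := by
  by_contra hc
  push Not at hc
  exact ha (h.tc.eq_iff_forall_mem.2 fun p => iff_of_false (hc p) p.bot_notMem)

theorem IsSubscaled.eq_bot_of_le_bot (ha : le d a (bot d)) : a = bot d :=
  h.tc.le_antisymm ha (h.bot_le a)

theorem IsSubscaled.low_of_low_succ {i : Fin (d + 1)} (hl : Low d (i + 1) a)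
    (hi : comp d i a = bot d) : Low d i a := by
  refine h.low_iff.2 fun j hj => ?_
  rcases Nat.eq_or_lt_of_le hj with hj | hj
  · rwa [← Fin.ext hj]
  · exact h.low_iff.1 hl j hj

variable (d M) in
omit h in
/-- Every nonzero component of index `i + 1` is above an element whose component of index `i` is
nonzero. -/
def Descending : Prop := ∀ i j : Fin (d + 1), (j : ℕ) = i + 1 → ∀ a : M, comp d j a ≠ bot d →
    ∃ b : M, le d b (comp d j a) ∧ comp d i b ≠ bot d

/-- Choose `b ≤ Cⁿ⁺¹(a)` with `Cⁿ(b) ≠ 0` and a chain of length `n` over `Cⁿ(b)`. Its first filter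
contains `Cⁿ⁺¹(a) - Cⁿ(b)`, which equals `Cⁿ⁺¹(a)` by axiom 5, so it contains a smaller prime filter
that avoids `Cⁿ(b)`; prepend it. -/
theorem IsSubscaled.exists_ltSeries (hd : Descending d M) (n : ℕ) (hn : n < d + 1) (a : M)
    (ha : comp d ⟨n, hn⟩ a ≠ bot d) : ∃ s : LTSeries (PrimesOver d a), s.length = n := by
  induction n generalizing a with
  | zero =>
    obtain ⟨p, hp⟩ := h.exists_mem_of_ne_bot ha
    exact ⟨RelSeries.singleton _ ⟨p.1, p.2, mem_of_le (p := p) (h.comp_le _ a) hp⟩, rfl⟩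
  | succ n ih =>
    obtain ⟨b, hb, hb0⟩ := hd ⟨n, by omega⟩ ⟨n + 1, hn⟩ rfl a ha
    obtain ⟨s, hs⟩ := ih (by omega) (comp d ⟨n, by omega⟩ b) (by rwa [h.comp_comp_self])
    have hle : le d (comp d ⟨n, by omega⟩ b) (comp d ⟨n + 1, hn⟩ a) :=
        h.tc.le_trans (h.comp_le _ _) hb
    have hd : diff d (comp d ⟨n + 1, hn⟩ a) (comp d ⟨n, by omega⟩ b) = comp d ⟨n + 1, hn⟩ a :=
      h.diff_eq_of_low (h.comp_comp_self _ _) (h.low_comp ⟨n, by omega⟩ b)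
    have hmem := mem_of_le hle s.head.mem_toSpec
    rw [← hd] at hmem
    obtain ⟨q, hq, hqa, hqb⟩ := h.tc.mem_diff.1 hmem
    let s' : LTSeries (PrimesOver d a) := s.map (fun F => ⟨F.1, F.2.1,
      mem_of_le (p := F.toSpec) (h.comp_le _ _) (mem_of_le hle F.mem_toSpec)⟩) (fun _ _ h => h)
    have hlt : (⟨q.1, q.2, mem_of_le (p := q) (h.comp_le _ _) hqa⟩ : PrimesOver d a) < s'.head := by
      refine lt_of_le_of_ne (show q.1 ⊆ s.head.1 from hq) fun he => hqb ?_
      have : q.1 = s.head.1 := congrArg Subtype.val he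
      change _ ∈ q.1
      rw [this]
      exact s.head.mem_toSpec
    exact ⟨s'.cons _ hlt, by rw [RelSeries.cons_length]; exact congrArg (· + 1) hs⟩

theorem IsSubscaled.scdim_eq_dim_of_descending (hd : Descending d M) (a : M) :
    scdim d a = dim d a := by
  refine eq_of_forall_lt_natCast_iff fun n => ?_
  rw [h.scdim_lt_iff]
  refine ⟨h.dim_lt_of_low, fun hlt => ?_⟩
  by_contra hc
  rw [h.low_iff] at hc
  push Not at hc
  obtain ⟨i, hi, hia⟩ := hc
  have h1 : ((i : ℕ) : WithBot ℕ∞) ≤ dim d a :=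
    Order.le_krullDim_iff.2 (h.exists_ltSeries hd i i.2 a hia)
  have h2 : ((i : ℕ) : WithBot ℕ∞) < (n : WithBot ℕ∞) := h1.trans_lt hlt
  have h3 : (i : ℕ) < n := by exact_mod_cast h2
  omega

omit h in
theorem IsScaled.dim_lt_iff (h : IsScaled d M) {n : ℕ} :
    dim d a < (n : WithBot ℕ∞) ↔ Low d n a := by
  rw [← h.scdim_eq_dim, h.toIsSubscaled.scdim_lt_iff]

-- Scaling gives a chain of length at least `j` over `Cʲ(a)`. Labels start at most at `j` and drop
-- at each step, so the second filter has label exactly `i = j - 1`. An element of sc-dimension `i`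
-- in this filter, cut down by `Cʲ(a)`, has a nonzero component of index `i`, since otherwise the
-- label would be smaller.
omit h in
theorem IsScaled.descending (h : IsScaled d M) : Descending d M := by
  have hs := h.toIsSubscaled
  intro i j hij a ha
  have hlow : ¬ Low d j (comp d j a) := fun hl => ha (by
    rw [← hs.comp_comp_self, hs.low_iff.1 hl j le_rfl])
  obtain ⟨s, hl⟩ := Order.le_krullDim_iff.1 (not_lt.1 (mt h.dim_lt_iff.1 hlow))
  have hl1 : 1 < s.length + 1 := by omega
  have h1 := hs.label_ltSeries s ⟨1, hl1⟩ (Fin.last _) (Fin.le_last _)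
  have h2 := hs.label_ltSeries s 0 ⟨1, hl1⟩ (Fin.zero_le _)
  have h3 := hs.label_lt (PrimesOver.mem_toSpec (s 0)) (hs.low_comp j a)
  simp only [Fin.val_last, Fin.coe_ofNat_eq_mod, Nat.zero_mod] at h1 h2
  obtain ⟨e, he, hel⟩ := hs.exists_low_label (PrimesOver.toSpec (s ⟨1, hl1⟩))
  have hbl : Low d (i + 1) e := hs.low_mono (by omega) hel
  refine ⟨meet d e (comp d j a),
    hs.tc.le_iff_forall_mem.2 fun p hp => (hs.tc.mem_meet.1 hp).2, fun h0 => ?_⟩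
  have hl2 : Low d (i + 1) (meet d e (comp d j a)) :=
    hs.low_of_le (hs.tc.le_iff_forall_mem.2 fun p hp => (hs.tc.mem_meet.1 hp).1) hbl
  have h4 := hs.label_lt (hs.tc.mem_meet.2 ⟨he, PrimesOver.mem_toSpec (s ⟨1, hl1⟩)⟩)
    (hs.low_of_low_succ hl2 h0)
  omega

omit h in
theorem IsScaled.dim_eq_iff (h : IsScaled d M) {n : ℕ} :
    dim d a = (n : WithBot ℕ∞) ↔ Low d (n + 1) a ∧ ¬ Low d n a := by
  rw [← h.scdim_eq_dim, le_antisymm_iff, h.toIsSubscaled.scdim_le_iff, ← not_lt,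
    h.toIsSubscaled.scdim_lt_iff]

-- If a prime containing `a` lies in `Cʲ(a)`, subtract from `a` all its other components. The result
-- is nonzero, has dimension `i` by purity, and contains a prime of label `j` while having
-- sc-dimension at most `j`; so `i = j`. Conversely, a nonzero `a - b` of smaller dimension could be
-- subtracted from `a = Cⁱ(a)` without effect.
omit h in
theorem IsScaled.isPure_iff (h : IsScaled d M) (i : Fin (d + 1)) :
    IsPure d i a ↔ comp d i a = a := by
  have hs := h.toIsSubscaled
  constructor
  · intro hp
    let := hs.gradedSpec
    refine hs.tc.le_antisymm (hs.comp_le i a) (hs.tc.le_iff_forall_mem.2 fun p hpa => ?_)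
    rw [← hs.joinComp_univ a, hs.tc.mem_joinComp] at hpa
    obtain ⟨j, -, hj⟩ := hpa
    obtain ⟨p', hp', hl, hpp'⟩ := hs.mem_comp.1 hj
    suffices i = j by rwa [this]
    have hmem : diff d a (joinComp d (Finset.univ.erase j) a) ∈ p' := by
      refine hs.tc.mem_diff.2 ⟨p', le_rfl, hp'.1, fun h1 => ?_⟩
      obtain ⟨k, hk, hkp⟩ := hs.tc.mem_joinComp.1 h1
      have := hs.label_of_maximal_comp (i := k)
        ⟨hkp, fun q hq hpq => hp'.2 (mem_of_le (hs.comp_le k a) hq) hpq⟩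
      exact (Finset.mem_erase.1 hk).1 (Fin.ext (this.symm.trans hl))
    obtain ⟨h1, h2⟩ := h.dim_eq_iff.1 (hp _ fun h0 => p'.bot_notMem (h0 ▸ hmem))
    have h3 := hs.label_lt hmem h1
    have h4 : Low d (j + 1) (diff d a (joinComp d (Finset.univ.erase j) a)) := by
      refine hs.low_of_le ((hs.tc.diff_le_iff _ _ _).2 ?_) (hs.low_comp j a)
      refine hs.tc.le_iff_forall_mem.2 fun q hq => ?_
      rw [← hs.joinComp_univ a, hs.tc.mem_joinComp] at hq
      obtain ⟨k, -, hk⟩ := hq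
      rw [hs.tc.mem_join, hs.tc.mem_joinComp]
      by_cases hkj : k = j
      · exact Or.inr (hkj ▸ hk)
      · exact Or.inl ⟨k, by simpa using hkj, hk⟩
    refine Fin.ext (le_antisymm ?_ (by omega))
    by_contra hc
    exact h2 (hs.low_mono (by omega) h4)
  · intro ha b hb
    have hle : le d (diff d a b) a := (hs.tc.diff_le_iff _ _ _).2 (hs.tc.le_join_right _ _)
    refine h.dim_eq_iff.2 ⟨hs.low_of_le hle (ha ▸ hs.low_comp i a), fun hl => ?_⟩
    have h1 := hs.diff_eq_of_low ha hl
    obtain ⟨p, hp⟩ := hs.exists_mem_of_ne_bot hb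
    obtain ⟨q, -, hqa, hqb⟩ := hs.tc.mem_diff.1 hp
    rw [← h1] at hqa
    obtain ⟨r, hqr, hra, hrb⟩ := hs.tc.mem_diff.1 hqa
    exact hrb (hs.tc.mem_diff.2 ⟨r, le_rfl, hra, fun h2 => hqb (hqr h2)⟩)

-- Catenarity is stated for all natural numbers; this reduces it to indices of components.
omit h in
theorem IsScaled.le_of_hasPureDim (h : IsScaled d M) {n : ℕ} (ha : HasPureDim d n a) :
    n < d + 1 := by
  have hs := h.toIsSubscaled
  have h1 : diff d a (bot d) = a := hs.tc.eq_iff_forall_mem.2 fun p => hs.tc.mem_diff.trans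
    ⟨fun ⟨q, h1, h2, _⟩ => h1 h2, fun h2 => ⟨p, le_rfl, h2, p.bot_notMem⟩⟩
  have h2 := ha.1 (bot d) (by rw [h1]; exact ha.2)
  by_contra hc
  exact (h.dim_eq_iff.1 h2).2 (hs.low_of_gt (by omega))

omit h

variable (d M) in
/-- Super `d`-scaled lattices, without reference to prime filters. -/
structure IsSuperElementary : Prop extends IsSubscaled d M where
  descending : Descending d M
  catenary : ∀ r q p : Fin (d + 1), r ≤ q → q ≤ p → ∀ c a : M, le d c a →
    comp d p a = a → a ≠ bot d → comp d r c = c → c ≠ bot d →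
    ∃ b : M, comp d q b = b ∧ le d c b ∧ le d b a
  split : ∀ b₁ b₂ a : M, le d (join d b₁ b₂) a → diff d a (join d b₁ b₂) = a → a ≠ bot d →
    ∃ a₁ a₂ : M, a₁ ≠ bot d ∧ a₂ ≠ bot d ∧ le d b₁ a₁ ∧ le d b₂ a₂ ∧
      a₁ = diff d a a₂ ∧ a₂ = diff d a a₁ ∧ meet d a₁ a₂ = meet d b₁ b₂

theorem isSuperScaled_iff : IsSuperScaled d M ↔ IsSuperElementary d M := by
  constructor
  · intro h
    refine ⟨h.toIsSubscaled, h.toIsScaled.descending, ?_, ?_⟩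
    · intro r q p hrq hqp c a hca hpa ha hrc hc
      obtain ⟨b, hb, h1, h2⟩ := h.catenarity r q p hrq hqp c a hca
        ⟨(h.toIsScaled.isPure_iff p).2 hpa, ha⟩ ⟨(h.toIsScaled.isPure_iff r).2 hrc, hc⟩
      exact ⟨b, (h.toIsScaled.isPure_iff q).1 hb, h1, h2⟩
    · intro b₁ b₂ a h1 h2 h3
      exact h.splitting b₁ b₂ a ((h.toIsTCLattice.ll_iff _ _).2 ⟨h1, h2, h3⟩)
  · intro h
    have hs : IsScaled d M := ⟨h.toIsSubscaled, h.scdim_eq_dim_of_descending h.descending⟩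
    refine ⟨hs, ?_, ?_⟩
    · intro r q p hrq hqp c a hca hpa hrc
      have hp := hs.le_of_hasPureDim hpa
      obtain ⟨b, hb, h1, h2⟩ := h.catenary ⟨r, by omega⟩ ⟨q, by omega⟩ ⟨p, hp⟩ hrq hqp c a hca
        ((hs.isPure_iff ⟨p, hp⟩).1 hpa.1) hpa.2 ((hs.isPure_iff ⟨r, by omega⟩).1 hrc.1) hrc.2
      exact ⟨b, (hs.isPure_iff ⟨q, by omega⟩).2 hb, h1, h2⟩
    · intro b₁ b₂ a hll
      obtain ⟨h1, h2, h3⟩ := (h.toIsTCLattice.ll_iff _ _).1 hll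
      exact h.split b₁ b₂ a h1 h2 h3

end Dimension

/-! ### Embeddings of lattices of lower sets built from pure cells. -/

section Lift

variable {d : ℕ} {M : Type u} {N : Type v} {P : Type w} [(lang d).Structure M]
  [(lang d).Structure N] [(lang d).Structure P]

theorem exists_lift_of_range (g : P ↪[lang d] N) (r : M ↪[lang d] N) (hgr : ∀ a, ∃ m, r m = g a) :
    ∃ e : P ↪[lang d] M, ∀ a, r (e a) = g a := by
  choose f hf using hgr
  refine ⟨mkEmbedding f (fun a b hab => g.injective (by rw [← hf, hab, hf]))
    (r.injective ?_) (r.injective ?_) (fun a b => r.injective ?_) (fun a b => r.injective ?_)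
    (fun a b => r.injective ?_) (fun i a => r.injective ?_), hf⟩ <;>
  simp only [hf, map_bot, map_top, map_join, map_meet, map_diff, map_comp]

end Lift

section Cells

variable {d : ℕ} {M : Type u} [(lang d).Structure M] {J : Type v} [PartialOrder J]

theorem IsSubscaled.exists_join (h : IsSubscaled d M) {ι : Type w} (s : Finset ι) (c : ι → M) :
    ∃ a : M, ∀ p : Spec d M, a ∈ p ↔ ∃ i ∈ s, c i ∈ p := by
  classical
  induction s using Finset.induction_on with
  | empty => exact ⟨bot d, fun p => by simpa using p.bot_notMem⟩
  | insert i s hi ih =>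
    obtain ⟨a, ha⟩ := ih
    exact ⟨join d (c i) a, fun p => by simp [h.tc.mem_join, ha]⟩

theorem IsSubscaled.comp_eq_of_forall (h : IsSubscaled d M) {i : Fin (d + 1)} {a : M}
    (hl : Low d (i + 1) a) (ha : ∀ p : Spec d M, a ∈ p → ∃ q, p ≤ q ∧ a ∈ q ∧ q.label = i) :
    comp d i a = a := by
  refine h.tc.le_antisymm (h.comp_le i a) (h.tc.le_iff_forall_mem.2 fun p hp => ?_)
  obtain ⟨q, hpq, hq, hqi⟩ := ha p hp
  refine h.mem_comp.2 ⟨q, ⟨hq, fun r hr hqr => ?_⟩, hqi, hpq⟩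
  by_contra hc
  have h1 := h.label_lt_label (lt_of_le_not_ge hqr hc)
  have h2 := h.label_lt hr hl
  omega

theorem IsSubscaled.exists_label_eq (h : IsSubscaled d M) {i : Fin (d + 1)} {a : M}
    (ha : comp d i a = a) {p : Spec d M} (hp : a ∈ p) : ∃ q, p ≤ q ∧ a ∈ q ∧ q.label = i := by
  rw [← ha] at hp
  obtain ⟨q, hq, hqi, hpq⟩ := h.mem_comp.1 hp
  exact ⟨q, hpq, hq.1, hqi⟩

theorem IsSubscaled.low_of_comp_eq (h : IsSubscaled d M) {i : Fin (d + 1)} {a : M}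
    (ha : comp d i a = a) : Low d (i + 1) a := ha ▸ h.low_comp i a

theorem IsSubscaled.diff_le_self (h : IsSubscaled d M) (a b : M) : le d (diff d a b) a :=
  (h.tc.diff_le_iff _ _ _).2 (h.tc.le_join_right _ _)

theorem IsSubscaled.comp_diff_eq (h : IsSubscaled d M) {i : Fin (d + 1)} {a b : M}
    (ha : comp d i a = a) : comp d i (diff d a b) = diff d a b := by
  refine h.comp_eq_of_forall (h.low_of_le (h.diff_le_self a b) (h.low_of_comp_eq ha))
    fun p hp => ?_
  obtain ⟨q, hpq, hqa, hqb⟩ := h.tc.mem_diff.1 hp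
  obtain ⟨r, hqr, hra, hri⟩ := h.exists_label_eq ha hqa
  exact ⟨r, hpq.trans hqr, h.tc.mem_diff.2 ⟨r, le_rfl, hra, fun hb => hqb (hqr hb)⟩, hri⟩

variable [GradedPoset d J]

/-- The index of a label. -/
def labFin (d : ℕ) [GradedPoset d J] (z : J) : Fin (d + 1) :=
  ⟨lab d z, Nat.lt_succ_of_le (GradedPoset.lab_le z)⟩

/-- A system of pure elements of `M` indexed by a finite graded poset `J`, whose joins are closed
under meets, gives an embedding of the lattice of lower sets of `J`. -/
theorem IsSubscaled.exists_embedding_of_cells (h : IsSubscaled d M) [Finite J] (c : J → M)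
    (hpure : ∀ z, comp d (labFin d z) (c z) = c z) (hbot : ∀ z, c z ≠ bot d)
    (hmono : ∀ z w, z ≤ w → le d (c z) (c w))
    (hmeet : ∀ (p : Spec d M) z w, c z ∈ p → c w ∈ p → ∃ u, u ≤ z ∧ u ≤ w ∧ c u ∈ p)
    (htop : ∀ p : Spec d M, ∃ z, c z ∈ p) :
    ∃ E : LowerSet J ↪[lang d] M, ∀ S (p : Spec d M), E S ∈ p ↔ ∃ z ∈ S, c z ∈ p := by
  classical
  let := h.gradedSpec
  let := Fintype.ofFinite J
  -- By `hmeet`, the cells that contain a given prime have a least index. The map from a prime to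
  -- this index is the p-morphism onto `J` dual to the desired embedding.
  have hmin : ∀ p : Spec d M, ∃ z, c z ∈ p ∧ ∀ w, c w ∈ p → z ≤ w := by
    intro p
    obtain ⟨z, hz⟩ := (Set.toFinite {z | c z ∈ p}).exists_minimal (htop p)
    refine ⟨z, hz.1, fun w hw => ?_⟩
    obtain ⟨u, huz, huw, hu⟩ := hmeet p z w hz.1 hw
    exact (hz.2 hu huz).trans huw
  choose f hf hfle using hmin
  have hlift : ∀ (p : Spec d M) (y : J), c y ∈ p → ∃ q, p ≤ q ∧ f q = y ∧ q.label = lab d y := by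
    intro p y hy
    obtain ⟨q, hpq, hq, hql⟩ := h.exists_label_eq (hpure y) hy
    refine ⟨q, hpq, ?_, hql⟩
    by_contra hne
    -- A cell of index strictly below `y` has sc-dimension less than the label of `q`, so `q` cannot
    -- contain it.
    have h1 := GradedPoset.lab_lt (d := d) ((hfle q y hq).lt_of_ne hne)
    have h2 : q.label < lab d (f q) + 1 := h.label_lt (hf q) (h.low_of_comp_eq (hpure (f q)))
    have h3 : q.label = lab d y := hql
    omega
  have hfp : IsPMorphism d f :=
    ⟨fun p q hpq => hfle p _ (hpq (hf q)),
      fun p y hy => hlift p y (mem_of_le (hmono _ _ hy) (hf p))⟩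
  have hfs : Function.Surjective f := by
    intro y
    obtain ⟨p, hp⟩ := h.exists_mem_of_ne_bot (hbot y)
    obtain ⟨q, -, hq, -⟩ := hlift p y hp
    exact ⟨q, hq⟩
  have key : ∀ (S : LowerSet J) (p : Spec d M), f p ∈ S ↔ ∃ z ∈ S, c z ∈ p := fun S p =>
    ⟨fun h1 => ⟨f p, h1, hf p⟩, fun ⟨z, hz, hzp⟩ => S.lower (hfle p z hzp) hz⟩
  obtain ⟨E, hE⟩ := exists_lift_of_range (hfp.embedding hfs) h.repr fun S => by
    obtain ⟨a, ha⟩ := h.exists_join (Finset.univ.filter (· ∈ S)) c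
    refine ⟨a, ?_⟩
    ext p
    refine (ha p).trans (Iff.trans ?_ (key S p).symm)
    simp
  exact ⟨E, fun S p => Iff.trans (Set.ext_iff.1 (congrArg SetLike.coe (hE S)) p) (key S p)⟩

end Cells

/-! ### Twin points and proper substructures. -/

section Twins

variable {d : ℕ} {J : Type v} [PartialOrder J] [GradedPoset d J]

variable (d) in
/-- Two points of a graded poset which can be identified by a p-morphism. -/
def Twin (x m : J) : Prop :=
  (x < m ∧ ∀ z, x < z → m ≤ z) ∨ (x ≠ m ∧ lab d x = lab d m ∧ ∀ z, x < z ↔ m < z)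

/-- The lower sets which do not separate the points of a twin pair. -/
def Twin.substructure {x m : J} (h : Twin d x m) : (lang d).Substructure (LowerSet J) where
  carrier := {S | x ∈ S ↔ m ∈ S}
  fun_mem := by
    intro n F v hv
    cases F with
    | zero => exact iff_of_false id id
    | one => exact iff_of_true trivial trivial
    | join => exact or_congr (hv 0) (hv 1)
    | meet => exact and_congr (hv 0) (hv 1)
    | diff =>
      change x ∈ diff d (v 0) (v 1) ↔ m ∈ diff d (v 0) (v 1)
      have h0 : x ∈ v 0 ↔ m ∈ v 0 := hv 0
      have h1 : x ∈ v 1 ↔ m ∈ v 1 := hv 1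
      simp only [mem_lowerSet_diff]
      constructor
      · rintro ⟨y, hy, hy1, hxy⟩
        rcases hxy.eq_or_lt with rfl | hlt
        · exact ⟨m, h0.1 hy, mt h1.2 hy1, le_rfl⟩
        · rcases h with ⟨-, h⟩ | ⟨-, -, h⟩
          · exact ⟨y, hy, hy1, h y hlt⟩
          · exact ⟨y, hy, hy1, ((h y).1 hlt).le⟩
      · rintro ⟨y, hy, hy1, hxy⟩
        rcases h with ⟨h, -⟩ | ⟨-, -, h⟩
        · exact ⟨y, hy, hy1, h.le.trans hxy⟩
        · rcases hxy.eq_or_lt with rfl | hlt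
          · exact ⟨x, h0.2 hy, mt h1.1 hy1, le_rfl⟩
          · exact ⟨y, hy, hy1, ((h y).2 hlt).le⟩
    | comp i =>
      change x ∈ comp d i (v 0) ↔ m ∈ comp d i (v 0)
      have h0 : x ∈ v 0 ↔ m ∈ v 0 := hv 0
      simp only [mem_lowerSet_comp]
      constructor
      · rintro ⟨y, hy, hyi, hxy⟩
        rcases hxy.eq_or_lt with rfl | hlt
        · rcases h with ⟨h, -⟩ | ⟨-, hl, h⟩
          · exact absurd (hy.2 (h0.1 hy.1) h.le) h.not_ge
          · refine ⟨m, ⟨h0.1 hy.1, fun z hz hmz => ?_⟩, hl ▸ hyi, le_rfl⟩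
            rcases hmz.eq_or_lt with rfl | hmz
            · rfl
            · exact absurd (hy.2 hz ((h z).2 hmz).le) ((h z).2 hmz).not_ge
        · rcases h with ⟨-, h⟩ | ⟨-, -, h⟩
          · exact ⟨y, hy, hyi, h y hlt⟩
          · exact ⟨y, hy, hyi, ((h y).1 hlt).le⟩
      · rintro ⟨y, hy, hyi, hxy⟩
        rcases h with ⟨h, -⟩ | ⟨-, hl, h⟩
        · exact ⟨y, hy, hyi, h.le.trans hxy⟩
        · rcases hxy.eq_or_lt with rfl | hlt
          · refine ⟨x, ⟨h0.2 hy.1, fun z hz hmz => ?_⟩, hl ▸ hyi, le_rfl⟩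
            rcases hmz.eq_or_lt with rfl | hmz
            · rfl
            · exact absurd (hy.2 hz ((h z).1 hmz).le) ((h z).1 hmz).not_ge
          · exact ⟨y, hy, hyi, ((h y).2 hlt).le⟩

theorem Twin.mem_substructure {x m : J} (h : Twin d x m) {S : LowerSet J} :
    S ∈ h.substructure ↔ (x ∈ S ↔ m ∈ S) := Iff.rfl

theorem Twin.substructure_ne_top {x m : J} (h : Twin d x m) : h.substructure ≠ ⊤ := by
  intro htop
  rcases id h with h' | h'
  · have := (h.mem_substructure (S := LowerSet.Iic x)).1 (htop ▸ Substructure.mem_top _)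
    exact h'.1.not_ge (this.1 le_rfl)
  · have h1 := (h.mem_substructure (S := LowerSet.Iic x)).1 (htop ▸ Substructure.mem_top _)
    have h2 := (h.mem_substructure (S := LowerSet.Iic m)).1 (htop ▸ Substructure.mem_top _)
    exact h'.1 (le_antisymm (h2.2 le_rfl) (h1.1 le_rfl))

theorem diff_mem {M : Type u} [(lang d).Structure M] {A : (lang d).Substructure M} {a b : M}
    (ha : a ∈ A) (hb : b ∈ A) : diff d a b ∈ A :=
  A.fun_mem Fn.diff ![a, b] fun i => by fin_cases i <;> assumption

theorem join_mem {M : Type u} [(lang d).Structure M] {A : (lang d).Substructure M} {a b : M}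
    (ha : a ∈ A) (hb : b ∈ A) : join d a b ∈ A :=
  A.fun_mem Fn.join ![a, b] fun i => by fin_cases i <;> assumption

theorem meet_mem {M : Type u} [(lang d).Structure M] {A : (lang d).Substructure M} {a b : M}
    (ha : a ∈ A) (hb : b ∈ A) : meet d a b ∈ A :=
  A.fun_mem Fn.meet ![a, b] fun i => by fin_cases i <;> assumption

theorem comp_mem {M : Type u} [(lang d).Structure M] {A : (lang d).Substructure M} {a : M}
    (ha : a ∈ A) (i : Fin (d + 1)) : comp d i a ∈ A :=
  A.fun_mem (Fn.comp i) ![a] fun i => by fin_cases i; assumption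

theorem bot_mem {M : Type u} [(lang d).Structure M] {A : (lang d).Substructure M} : bot d ∈ A :=
  A.fun_mem Fn.zero ![] fun i => i.elim0

theorem top_mem {M : Type u} [(lang d).Structure M] {A : (lang d).Substructure M} : top d ∈ A :=
  A.fun_mem Fn.one ![] fun i => i.elim0

/-- Let the hull of `x` be the least member of `A` containing `x`; a member of `A` cannot separate
points with the same hull. Since `A` is proper, two points share a hull. Choose a maximal hull `H`
with this property: points with a larger hull are alone in their class, and therefore lie above
every point of hull `H`. Inside the class of `H`, a maximal point `m` and a point `x` maximal among
the others then form a twin pair. -/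
theorem exists_twin [Finite J] {A : (lang d).Substructure (LowerSet J)} (hA : A ≠ ⊤) :
    ∃ (x m : J) (h : Twin d x m), A ≤ h.substructure := by
  classical
  let := Fintype.ofFinite J
  have hinf : ∀ s : Finset (LowerSet J), (∀ S ∈ s, S ∈ A) → s.inf id ∈ A := fun s hs =>
    Finset.inf_induction (p := (· ∈ A)) top_mem (fun _ h1 _ h2 => meet_mem h1 h2) hs
  have hsup : ∀ s : Finset J, ∀ f : J → LowerSet J, (∀ z ∈ s, f z ∈ A) → s.sup f ∈ A :=
    fun s f hs => Finset.sup_induction (p := (· ∈ A)) bot_mem (fun _ h1 _ h2 => join_mem h1 h2) hs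
  have : Finite (LowerSet J) := Finite.of_injective _ (SetLike.coe_injective (A := LowerSet J))
  let := Fintype.ofFinite (LowerSet J)
  obtain ⟨hull, hhA, hmem, hle⟩ : ∃ hull : J → LowerSet J, (∀ x, hull x ∈ A) ∧
      (∀ x, x ∈ hull x) ∧ ∀ x, ∀ S ∈ A, x ∈ S → hull x ≤ S :=
    ⟨fun x => (Finset.univ.filter fun S => S ∈ A ∧ x ∈ S).inf id,
      fun x => hinf _ fun S hS => (Finset.mem_filter.1 hS).2.1,
      fun x => mem_finset_inf.2 fun S hS => (Finset.mem_filter.1 hS).2.2,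
      fun x S hS hx => Finset.inf_le (f := id) (by simp [hS, hx])⟩
  have hmono : ∀ x y, x ∈ hull y → hull x ≤ hull y := fun x y h => hle x _ (hhA y) h
  -- Subtracting from `hull z` the hulls properly contained in it gives a member of `A` that
  -- contains `z`, hence all of `hull z`.
  have hup : ∀ u z, u ∈ hull z → ∃ z', u ≤ z' ∧ hull z' = hull z := by
    intro u z hu
    have hR := hsup (Finset.univ.filter fun w => w ∈ hull z ∧ hull w ≠ hull z) hull
      fun w _ => hhA w
    have hz : z ∈ diff d (hull z)
        ((Finset.univ.filter fun w => w ∈ hull z ∧ hull w ≠ hull z).sup hull) := by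
      refine mem_lowerSet_diff.2 ⟨z, hmem z, fun h => ?_, le_rfl⟩
      obtain ⟨w, hw, hzw⟩ := mem_finset_sup.1 h
      obtain ⟨-, h1, h2⟩ := Finset.mem_filter.1 hw
      exact h2 (le_antisymm (hmono w z h1) (hmono z w hzw))
    obtain ⟨z', h1, h2, h3⟩ := mem_lowerSet_diff.1 (hle z _ (diff_mem (hhA z) hR) hz hu)
    refine ⟨z', h3, ?_⟩
    by_contra hne
    exact h2 (mem_finset_sup.2 ⟨z', by simp [h1, hne], hmem z'⟩)
  -- If hulls were distinct, each hull would be principal and `A` would contain every lower set.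
  have hninj : ∃ x y, x ≠ y ∧ hull x = hull y := by
    by_contra hc
    push Not at hc
    have hIic : ∀ x, hull x = LowerSet.Iic x := by
      intro x
      refine le_antisymm (fun w hw => ?_) ?_
      · obtain ⟨z, hz, hwz⟩ := exists_maximal_ge d hw
        suffices h : hull z = hull x by
          by_cases hzx : z = x
          · exact hzx ▸ hwz
          · exact absurd h (hc z x hzx)
        by_contra hne
        have hx : x ∈ diff d (hull x) (hull z) := by
          refine mem_lowerSet_diff.2 ⟨x, hmem x, fun h => ?_, le_rfl⟩
          exact hne (le_antisymm (hmono z x hz.1) (hmono x z h))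
        obtain ⟨t, ht, htz, hzt⟩ := mem_lowerSet_diff.1
          (hle x _ (diff_mem (hhA x) (hhA z)) hx hz.1)
        exact htz (le_antisymm hzt (hz.2 ht hzt) ▸ hmem z)
      · exact fun w hw => (hull x).lower hw (hmem x)
    refine hA (eq_top_iff.2 fun S _ => ?_)
    have e : S = (Finset.univ.filter (· ∈ S)).sup hull := by
      ext w
      simp only [SetLike.mem_coe, mem_finset_sup, Finset.mem_filter, Finset.mem_univ, true_and,
        hIic, LowerSet.mem_Iic_iff]
      exact ⟨fun hw => ⟨w, hw, le_rfl⟩, fun ⟨p, hp, hqp⟩ => S.lower hqp hp⟩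
    rw [e]
    exact hsup _ _ fun z _ => hhA z
  obtain ⟨H, ⟨x₀, y₀, hxy, hx₀, hy₀⟩, hHmax⟩ :=
    (Set.toFinite {H | ∃ x y, x ≠ y ∧ hull x = H ∧ hull y = H}).exists_maximal
      (by obtain ⟨x, y, h1, h2⟩ := hninj; exact ⟨_, x, y, h1, h2, rfl⟩)
  have habove : ∀ u z, hull u = H → H < hull z → u < z := by
    intro u z hu hz
    obtain ⟨z', h1, h2⟩ := hup u z (hz.le (hu ▸ hmem u))
    have : z' = z := by
      by_contra hne
      exact hz.not_ge (hHmax ⟨z', z, hne, h2, rfl⟩ hz.le)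
    subst this
    refine h1.lt_of_ne ?_
    rintro rfl
    exact hz.ne' hu
  have hcase : ∀ u v, hull u = H → u < v → hull v = H ∨ H < hull v := by
    intro u v hu huv
    have : H ≤ hull v := hu ▸ hmono u v ((hull v).lower huv.le (hmem v))
    exact this.eq_or_lt.imp Eq.symm id
  -- Some component of `H` contains `x₀`; it belongs to `A`, so it is all of `H`. This yields equal
  -- labels when `x` and `m` are incomparable.
  have hpure : ∃ i : ℕ, ∀ t, Maximal (· ∈ H) t → lab d t = i := by
    have h1 : x₀ ∈ joinComp d Finset.univ H := by
      rw [(isSubscaled_lowerSet d J).joinComp_univ]; exact hx₀ ▸ hmem x₀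
    obtain ⟨i, -, hi⟩ := mem_joinComp.1 h1
    refine ⟨i, fun t ht => ?_⟩
    have h2 : t ∈ comp d i H := hle x₀ _ (comp_mem (hx₀ ▸ hhA x₀) i) hi (hx₀ ▸ ht.1)
    obtain ⟨s, hs, hsi, hts⟩ := mem_lowerSet_comp.1 h2
    rwa [le_antisymm hts (ht.2 hs.1 hts)]
  obtain ⟨m, hm⟩ := (Set.toFinite {u | hull u = H}).exists_maximal ⟨x₀, hx₀⟩
  obtain ⟨x, ⟨hx, hxm⟩, hxmax⟩ := (Set.toFinite {u | hull u = H ∧ u ≠ m}).exists_maximal (by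
    by_cases h : x₀ = m
    · exact ⟨y₀, hy₀, fun h' => hxy (h.trans h'.symm)⟩
    · exact ⟨x₀, hx₀, h⟩)
  have hmH : hull m = H := hm.1
  have hmF : ∀ z, hull z = H → ¬ m < z := fun z hz h1 => h1.not_ge (hm.2 hz h1.le)
  have hxF : ∀ z, hull z = H → x < z → z = m := fun z hz h1 => by
    by_contra hne
    exact h1.not_ge (hxmax ⟨hz, hne⟩ h1.le)
  have htw : Twin d x m := by
    by_cases hlt : x < m
    · refine Or.inl ⟨hlt, fun z hz => ?_⟩
      rcases hcase x z hx hz with h1 | h1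
      · exact (hxF z h1 hz).ge
      · exact (habove m z hmH h1).le
    · refine Or.inr ⟨hxm, ?_, fun z => ⟨fun hz => ?_, fun hz => ?_⟩⟩
      · obtain ⟨i, hi⟩ := hpure
        have hmemF : ∀ u z, hull u = H → u ≤ z → z ∈ H → hull z = H := fun u z hu huz hz =>
          le_antisymm (hle z H (hmH ▸ hhA m) hz)
            (hu ▸ hmono u z ((hull z).lower huz (hmem z)))
        rw [hi x ⟨hx ▸ hmem x, fun z hz hxz => ?_⟩, hi m ⟨hmH ▸ hmem m, fun z hz hmz => ?_⟩]
        · exact hm.2 (hmemF m z hmH hmz hz) hmz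
        · rcases hxz.eq_or_lt with rfl | h1
          · rfl
          · exact absurd (hxF z (hmemF x z hx hxz hz) h1 ▸ h1) hlt
      · rcases hcase x z hx hz with h1 | h1
        · exact absurd (hxF z h1 hz ▸ hz) hlt
        · exact habove m z hmH h1
      · rcases hcase m z hmH hz with h1 | h1
        · exact absurd hz (hmF z h1)
        · exact habove x z hx h1
  refine ⟨x, m, htw, fun S hS => htw.mem_substructure.2 ⟨fun h1 => ?_, fun h1 => ?_⟩⟩
  · exact hle x S hS h1 (hx ▸ hmH ▸ hmem m)
  · exact hle m S hS h1 (hmH ▸ hx ▸ hmem x)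

end Twins

/-! ### Pure elements between given elements. -/

section Pure

variable {d : ℕ} {M : Type u} [(lang d).Structure M]

theorem IsSubscaled.exists_pure_le (h : IsSubscaled d M) (hd : Descending d M) {i k : Fin (d + 1)}
    (hik : i ≤ k) {a : M} (hk : comp d k a = a) (ha : a ≠ bot d) :
    ∃ b, le d b a ∧ comp d i b = b ∧ b ≠ bot d := by
  induction hn : (k : ℕ) - i generalizing i with
  | zero =>
    obtain rfl : i = k := Fin.ext (le_antisymm hik (by omega))
    exact ⟨a, h.tc.le_refl a, hk, ha⟩
  | succ n ih =>
    have hi : (i : ℕ) + 1 < d + 1 := by omega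
    obtain ⟨b, hba, hb, hb0⟩ := ih (i := ⟨i + 1, hi⟩) (Fin.le_def.2 (by simp; omega))
      (by simp; omega)
    obtain ⟨b', hb', h0⟩ := hd i ⟨i + 1, hi⟩ rfl b (by rwa [hb])
    exact ⟨comp d i b', h.tc.le_trans (h.comp_le _ _) (h.tc.le_trans (hb ▸ hb') hba),
      h.comp_comp_self _ _, h0⟩

/-- Catenarity needs a nonzero pure lower bound, so it is applied to each nonzero component of `c`
and the results are joined. For zero components an arbitrary nonzero `q`-pure element `b₀ ≤ a` is
used instead, which keeps the join nonzero even when `c = 0`. -/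
theorem IsSuperElementary.exists_pure_between (h : IsSuperElementary d M) {q k : Fin (d + 1)}
    (hqk : q ≤ k) {a c : M} (hk : comp d k a = a) (ha : a ≠ bot d) (hca : le d c a)
    (hc : Low d q c) : ∃ b, comp d q b = b ∧ b ≠ bot d ∧ le d c b ∧ le d b a := by
  have hs := h.toIsSubscaled
  obtain ⟨b₀, hb₀a, hb₀, hb₀0⟩ := hs.exists_pure_le h.descending hqk hk ha
  have hex : ∀ r : Fin (d + 1), ∃ b, comp d q b = b ∧ b ≠ bot d ∧ le d (comp d r c) b ∧
      le d b a := by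
    intro r
    by_cases hr : comp d r c = bot d
    · exact ⟨b₀, hb₀, hb₀0, hr ▸ hs.bot_le b₀, hb₀a⟩
    · have hrq : r ≤ q := by
        by_contra hc'
        exact hr (hs.low_iff.1 hc r (le_of_lt (not_le.1 hc')))
      obtain ⟨b, hb, h1, h2⟩ := h.catenary r q k hrq hqk (comp d r c) a
        (hs.tc.le_trans (hs.comp_le r c) hca) hk ha (hs.comp_comp_self r c) hr
      exact ⟨b, hb, fun h0 => hr (hs.eq_bot_of_le_bot (h0 ▸ h1)), h1, h2⟩
  choose b hb hb0 hcb hba using hex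
  obtain ⟨x, hx⟩ := hs.exists_join Finset.univ b
  simp only [Finset.mem_univ, true_and] at hx
  have hle : ∀ r, le d (b r) x := fun r => hs.tc.le_iff_forall_mem.2 fun p hp => (hx p).2 ⟨r, hp⟩
  refine ⟨x, hs.comp_eq_of_forall ?_ fun p hp => ?_,
    fun h0 => hb0 q (hs.eq_bot_of_le_bot (h0 ▸ hle q)), ?_, ?_⟩
  · by_contra hlow
    rw [hs.low_iff] at hlow
    push Not at hlow
    obtain ⟨i, hi, hne⟩ := hlow
    obtain ⟨p, hp⟩ := hs.exists_mem_of_ne_bot hne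
    obtain ⟨p', hp', hl, -⟩ := hs.mem_comp.1 hp
    obtain ⟨r, hr⟩ := (hx p').1 hp'.1
    have := hs.label_lt hr (hs.low_of_comp_eq (hb r))
    omega
  · obtain ⟨r, hr⟩ := (hx p).1 hp
    obtain ⟨q', h1, h2, h3⟩ := hs.exists_label_eq (hb r) hr
    exact ⟨q', h1, mem_of_le (hle r) h2, h3⟩
  · refine hs.tc.le_iff_forall_mem.2 fun p hp => ?_
    rw [← hs.joinComp_univ c, hs.tc.mem_joinComp] at hp
    obtain ⟨r, -, hr⟩ := hp
    exact mem_of_le (hs.tc.le_trans (hcb r) (hle r)) hr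
  · refine hs.tc.le_iff_forall_mem.2 fun p hp => ?_
    obtain ⟨r, hr⟩ := (hx p).1 hp
    exact mem_of_le (hba r) hr

end Pure

/-! ### Cells over an embedded substructure of lower sets. -/

section Trace

variable {d : ℕ} {M : Type u} [(lang d).Structure M] {J : Type v} [PartialOrder J]
  [GradedPoset d J] {A : (lang d).Substructure (LowerSet J)} (e : A ↪[lang d] M) {p : Spec d M}

theorem coe_diff (S T : A) : (diff d S T : A).1 = diff d S.1 T.1 := map_diff A.subtype S T

theorem coe_meet (S T : A) : (meet d S T : A).1 = meet d S.1 T.1 := map_meet A.subtype S T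

theorem coe_join (S T : A) : (join d S T : A).1 = join d S.1 T.1 := map_join A.subtype S T

theorem coe_comp (i : Fin (d + 1)) (S : A) : (comp d i S : A).1 = comp d i S.1 :=
  map_comp A.subtype i S

theorem le_of_coe_le {S T : A} (hST : S.1 ≤ T.1) : le d (e S) (e T) :=
  (map_le e S T).2 ((map_le A.subtype S T).1 (lowerSet_le_iff.2 hST))

theorem mem_of_coe_le {S T : A} (hST : S.1 ≤ T.1) (hS : e S ∈ p) : e T ∈ p :=
  mem_of_le (le_of_coe_le e hST) hS

variable (h : IsTCLattice d M)
include h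

theorem IsTCLattice.mem_of_coe_inf_le {S T R : A} (hST : S.1 ⊓ T.1 ≤ R.1) (hS : e S ∈ p)
    (hT : e T ∈ p) : e R ∈ p := by
  refine mem_of_coe_le e (S := meet d S T) ?_ (map_meet e S T ▸ h.mem_meet.2 ⟨hS, hT⟩)
  rw [coe_meet]; exact hST

theorem IsTCLattice.mem_or_of_coe_le_sup {S T R : A} (hST : S.1 ≤ T.1 ⊔ R.1) (hS : e S ∈ p) :
    e T ∈ p ∨ e R ∈ p := by
  rw [← h.mem_join, ← map_join]
  exact mem_of_coe_le e (by rw [coe_join]; exact hST) hS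

/-- The `T i` are removed one at a time: `S ≤ T i ∨ (S - T i)`, and the remaining sets cover `S - T
i`. -/
theorem IsTCLattice.exists_mem_of_cover {ι : Type*} [Finite ι] (T : ι → A) {S : A}
    (hS : ∀ y ∈ S.1, ∃ i, y ∈ (T i).1) (hp : e S ∈ p) : ∃ i, e (T i) ∈ p := by
  classical
  let := Fintype.ofFinite ι
  suffices key : ∀ (s : Finset ι) (S : A), (∀ y ∈ S.1, ∃ i ∈ s, y ∈ (T i).1) → e S ∈ p →
      ∃ i ∈ s, e (T i) ∈ p by
    obtain ⟨i, -, hi⟩ := key Finset.univ S (by simpa using hS) hp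
    exact ⟨i, hi⟩
  intro s
  induction s using Finset.induction_on with
  | empty =>
    intro S hS hp
    have : S = bot d := Subtype.ext (by
      rw [show (bot d : A).1 = bot d from map_bot A.subtype]
      ext y
      exact iff_of_false (fun hy => by simpa using hS y hy) notMem_lowerSet_bot)
    rw [this, map_bot] at hp
    exact absurd hp p.bot_notMem
  | insert i s hi ih =>
    intro S hS hp
    rcases h.mem_or_of_coe_le_sup e (T := T i) (R := diff d S (T i)) (fun y hy => by
      by_cases hyi : y ∈ (T i).1
      · exact Or.inl hyi
      · exact Or.inr (by
          rw [coe_diff]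
          exact (mem_lowerSet_diff (d := d)).2 ⟨y, hy, hyi, le_rfl⟩)) hp with h1 | h1
    · exact ⟨i, Finset.mem_insert_self i s, h1⟩
    · obtain ⟨j, hj, hjp⟩ := ih _ (fun y hy => by
        rw [coe_diff] at hy
        obtain ⟨z, hz, hzi, hyz⟩ := mem_lowerSet_diff.1 hy
        obtain ⟨j, hj, hzj⟩ := hS z hz
        rcases Finset.mem_insert.1 hj with rfl | hj
        · exact absurd hzj hzi
        · exact ⟨j, hj, (T j).1.lower hyz hzj⟩) h1
      exact ⟨j, Finset.mem_insert_of_mem hj, hjp⟩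

/-- By `hT` and `hTle`, `T y` is the least member of `A` containing `y`. Compatibility of the cells
with `e` thus needs checking on these sets only. -/
theorem IsTCLattice.mem_iff_exists_cell [Finite J] (T : J → A) (c : J → M)
    (hT : ∀ y, y ∈ (T y).1) (hTle : ∀ y (S : A), y ∈ S.1 → (T y).1 ≤ S.1)
    (hTc : ∀ (p : Spec d M) y, e (T y) ∈ p → ∃ u ∈ (T y).1, c u ∈ p)
    (hcT : ∀ y, le d (c y) (e (T y))) (S : A) : e S ∈ p ↔ ∃ z ∈ S.1, c z ∈ p := by
  constructor
  · intro hp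
    obtain ⟨⟨y, hy⟩, hyp⟩ := h.exists_mem_of_cover e (ι := S.1) (fun y => T y)
      (fun y hy => ⟨⟨y, hy⟩, hT y⟩) hp
    obtain ⟨u, hu, hup⟩ := hTc p y hyp
    exact ⟨u, hTle y S hy hu, hup⟩
  · rintro ⟨z, hz, hzp⟩
    exact mem_of_coe_le e (hTle z S hz) (mem_of_le (hcT z) hzp)

omit h in
theorem IsSubscaled.exists_extension_of_cells [Finite J] (h : IsSubscaled d M) (c : J → M)
    (hkey : ∀ (S : A) (p : Spec d M), e S ∈ p ↔ ∃ z ∈ S.1, c z ∈ p)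
    (hpure : ∀ z, comp d (labFin d z) (c z) = c z) (hbot : ∀ z, c z ≠ bot d)
    (hmono : ∀ z w, z ≤ w → le d (c z) (c w))
    (hmeet : ∀ (p : Spec d M) z w, c z ∈ p → c w ∈ p → ∃ u, u ≤ z ∧ u ≤ w ∧ c u ∈ p) :
    ∃ E : LowerSet J ↪[lang d] M, ∀ S : A, E S.1 = e S := by
  obtain ⟨E, hE⟩ := h.exists_embedding_of_cells c hpure hbot hmono hmeet fun p => by
    obtain ⟨z, -, hz⟩ := (hkey (top d) p).1 (map_top e ▸ p.top_mem)
    exact ⟨z, hz⟩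
  exact ⟨E, fun S => h.tc.eq_iff_forall_mem.2 fun p => (hE S.1 p).trans (hkey S p).symm⟩

end Trace

section LowerSetFacts

variable {d : ℕ} {J : Type v} [PartialOrder J] [GradedPoset d J]

theorem comp_eq_self_of_forall {i : Fin (d + 1)} {S : LowerSet J}
    (hS : ∀ y ∈ S, ∃ z, y ≤ z ∧ Maximal (· ∈ S) z ∧ lab d z = i) : comp d i S = S :=
  le_antisymm comp_le_self fun y hy => by
    obtain ⟨z, hyz, hz, hi⟩ := hS y hy
    exact mem_lowerSet_comp.2 ⟨z, hz, hi, hyz⟩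

theorem comp_Iic (z : J) : comp d (labFin d z) (LowerSet.Iic z) = LowerSet.Iic z :=
  comp_eq_self_of_forall fun _ hy => ⟨z, hy, ⟨le_rfl, fun _ h _ => h⟩, rfl⟩

end LowerSetFacts

/-! ### Extension of an embedding across one twin pair. -/

section OneStep

variable {d : ℕ} {M : Type u} [(lang d).Structure M] {J : Type v} [PartialOrder J]
  [GradedPoset d J] [Finite J] {x m : J}

omit [Finite J] in
theorem map_coe_comp_eq {A : (lang d).Substructure (LowerSet J)} (e : A ↪[lang d] M)
    {i : Fin (d + 1)} {S : A} (hS : comp d i S.1 = S.1) : comp d i (e S) = e S := by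
  rw [← map_comp]
  exact congrArg e (Subtype.ext ((coe_comp i S).trans hS))

omit [Finite J] in
theorem map_coe_ne_bot {A : (lang d).Substructure (LowerSet J)} (e : A ↪[lang d] M) {S : A} {y : J}
    (hy : y ∈ S.1) : e S ≠ bot d := by
  rw [← map_bot e]
  intro h
  have h1 := congrArg Subtype.val (e.injective h)
  rw [show (bot d : A).1 = bot d from map_bot A.subtype] at h1
  exact notMem_lowerSet_bot (h1 ▸ hy)

omit [Finite J] in
theorem IsSuperElementary.exists_split {A : (lang d).Substructure (LowerSet J)}
    (h : IsSuperElementary d M) (e : A ↪[lang d] M) (S T₁ T₂ : A) {y : J} (hy : y ∈ S.1)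
    (h1 : T₁.1 ≤ S.1) (h2 : T₂.1 ≤ S.1) (hd : ∀ y ∈ S.1, ∃ z ∈ S.1, y ≤ z ∧ z ∉ T₁.1 ∧ z ∉ T₂.1) :
    ∃ a₁ a₂ : M, a₁ ≠ bot d ∧ a₂ ≠ bot d ∧ le d (e T₁) a₁ ∧ le d (e T₂) a₂ ∧
      a₁ = diff d (e S) a₂ ∧ a₂ = diff d (e S) a₁ ∧ meet d a₁ a₂ = meet d (e T₁) (e T₂) := by
  refine h.split (e T₁) (e T₂) (e S)
    (h.tc.join_le (le_of_coe_le e h1) (le_of_coe_le e h2)) ?_ (map_coe_ne_bot e hy)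
  rw [← map_join, ← map_diff]
  refine congrArg e (Subtype.ext ?_)
  rw [coe_diff, coe_join]
  refine le_antisymm (fun y hy => ?_) (fun y hy => ?_)
  · obtain ⟨z, hz, -, hyz⟩ := mem_lowerSet_diff.1 hy
    exact S.1.lower hyz hz
  · obtain ⟨z, hz, hyz, h3, h4⟩ := hd y hy
    exact (mem_lowerSet_diff (d := d)).2 ⟨z, hz, fun h5 => h5.elim h3 h4, hyz⟩

/-- Only `Iic x` lacks a cell. Let `B` be the set of points strictly below `m` other than `x`, and
`H = Iio x ⊆ B`. Splitting `e (Iic m)` along `B` and `H` gives `a₁ ≥ e B` and `a₂ ≥ e H` whose meet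
is `e B ∧ e H = e H`. Inside `a₂`, Catenarity provides a cell `X ≥ e H` of dimension `lab x`; it
meets the cells of points not above `x` only within `e H`, as required. -/
theorem IsSuperElementary.extend_below (h : IsSuperElementary d M) (tw : Twin d x m)
    (hxm : x < m) (hup : ∀ z, x < z → m ≤ z) (e : tw.substructure ↪[lang d] M) :
    ∃ E : LowerSet J ↪[lang d] M, ∀ S : tw.substructure, E S.1 = e S := by
  classical
  have hs := h.toIsSubscaled
  have hge : ∀ z, z ≠ x → (x ≤ z ↔ m ≤ z) := fun z hz =>
    ⟨fun h1 => hup z (h1.lt_of_ne hz.symm), hxm.le.trans⟩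
  let I : ∀ z, z ≠ x → tw.substructure := fun z hz => ⟨LowerSet.Iic z, hge z hz⟩
  have hmx : m ≠ x := hxm.ne'
  let B : tw.substructure := ⟨⟨{z | z < m ∧ z ≠ x}, fun z w hwz hz => ⟨hwz.trans_lt hz.1, by
    rintro rfl
    exact hz.1.not_ge (hup z (hwz.lt_of_ne hz.2.symm))⟩⟩,
    iff_of_false (fun h1 => h1.2 rfl) (fun h1 => lt_irrefl _ h1.1)⟩
  let H : tw.substructure := ⟨LowerSet.Iio x,
    iff_of_false (fun h1 => lt_irrefl x h1) (fun h1 => lt_asymm hxm h1)⟩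
  have hHB : H.1 ≤ B.1 := fun z (hz : z < x) => ⟨hz.trans hxm, hz.ne⟩
  have hBm : B.1 ≤ (I m hmx).1 := fun z hz => hz.1.le
  obtain ⟨a₁, a₂, -, ha₂, hb₁, hb₂, -, hd₂, hmeet⟩ := h.exists_split e (I m hmx) B H (y := m)
    le_rfl hBm (hHB.trans hBm) fun y hy => ⟨m, le_rfl, hy, fun h1 => lt_irrefl m h1.1,
      fun h1 => lt_asymm hxm h1⟩
  have hm : comp d (labFin d m) (e (I m hmx)) = e (I m hmx) := map_coe_comp_eq e (comp_Iic m)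
  have hHlow : Low d (labFin d x : Fin (d + 1)) (e H) := by
    rw [← hs.scdim_lt_iff, scdim_map, ← scdim_map tw.substructure.subtype]
    exact scdim_lowerSet_lt_iff.2 fun z hz => GradedPoset.lab_lt hz
  obtain ⟨X, hX, hX0, hHX, hXa⟩ := h.exists_pure_between (q := labFin d x) (k := labFin d m)
    (GradedPoset.lab_lt hxm).le (a := a₂) (by rw [hd₂]; exact hs.comp_diff_eq hm) ha₂ hb₂ hHlow
  have hXm : le d X (e (I m hmx)) := hs.tc.le_trans hXa (by
    conv_rhs => rw [← show join d (diff d (e (I m hmx)) a₁) (e (I m hmx)) = _ from hs.diff_le_self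
        _ _]
    exact hd₂ ▸ hs.tc.le_join_left _ _)
  let c : J → M := fun z => if hz : z = x then X else e (I z hz)
  have hcx : c x = X := dif_pos rfl
  have hc : ∀ z (hz : z ≠ x), c z = e (I z hz) := fun z hz => dif_neg hz
  let T : J → tw.substructure := fun z => if hz : z = x then I m hmx else I z hz
  have hTx : T x = I m hmx := dif_pos rfl
  have hTz : ∀ z (hz : z ≠ x), T z = I z hz := fun z hz => dif_neg hz
  have hkey : ∀ (S : tw.substructure) (p : Spec d M), e S ∈ p ↔ ∃ z ∈ S.1, c z ∈ p := by
    intro S p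
    refine hs.tc.mem_iff_exists_cell e T c (fun y => ?_) (fun y S hy => ?_) (fun p y hp => ?_)
      (fun y => ?_) S
    · by_cases hy : y = x
      · subst hy; rw [hTx]; exact hxm.le
      · rw [hTz y hy]; exact le_refl y
    · by_cases hyx : y = x
      · subst hyx
        rw [hTx]
        exact LowerSet.Iic_le.2 (S.2.1 hy)
      · rw [hTz y hyx]; exact LowerSet.Iic_le.2 hy
    · by_cases hyx : y = x
      · subst hyx
        rw [hTx] at hp ⊢
        exact ⟨m, le_refl m, by rwa [hc m hmx]⟩
      · rw [hTz y hyx] at hp ⊢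
        exact ⟨y, le_refl y, by rwa [hc y hyx]⟩
    · by_cases hyx : y = x
      · subst hyx; rw [hTx, hcx]; exact hXm
      · rw [hTz y hyx, hc y hyx]; exact hs.tc.le_refl _
  -- If `w` is not above `x`, a prime of `X` and `c w` contains `e B`, since `Iic m ∩ Iic w ⊆ B`. It
  -- therefore contains `a₁ ∧ a₂`, hence `e H`.
  have hcross : ∀ (p : Spec d M) w, c x ∈ p → c w ∈ p → ∃ u, u ≤ x ∧ u ≤ w ∧ c u ∈ p := by
    intro p w hxp hwp
    by_cases hxw : x ≤ w
    · exact ⟨x, le_rfl, hxw, hxp⟩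
    · have hwx : w ≠ x := fun h1 => hxw h1.ge
      rw [hcx] at hxp
      rw [hc w hwx] at hwp
      have h1 : e B ∈ p := hs.tc.mem_of_coe_inf_le e (S := I m hmx) (T := I w hwx) (R := B)
        (fun y ⟨(hy1 : y ≤ m), (hy2 : y ≤ w)⟩ => ⟨hy1.lt_of_ne fun h1 =>
          hxw (hxm.le.trans (h1 ▸ hy2)), fun h1 => hxw (h1 ▸ hy2)⟩) (mem_of_le hXm hxp) hwp
      have h2 : e H ∈ p := by
        have : meet d a₁ a₂ ∈ p := hs.tc.mem_meet.2 ⟨mem_of_le hb₁ h1, mem_of_le hXa hxp⟩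
        rw [hmeet] at this
        exact (hs.tc.mem_meet.1 this).2
      have h3 : e (meet d H (I w hwx)) ∈ p := by
        rw [map_meet]; exact hs.tc.mem_meet.2 ⟨h2, hwp⟩
      obtain ⟨u, hu, hup⟩ := (hkey _ p).1 h3
      rw [coe_meet] at hu
      exact ⟨u, le_of_lt hu.1, hu.2, hup⟩
  refine hs.exists_extension_of_cells e c hkey (fun z => ?_) (fun z => ?_) (fun z w hzw => ?_)
    fun p z w hz hw => ?_
  · by_cases hz : z = x
    · subst hz; rwa [hcx]
    · rw [hc z hz]; exact map_coe_comp_eq e (comp_Iic z)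
  · by_cases hz : z = x
    · subst hz; rwa [hcx]
    · rw [hc z hz]; exact map_coe_ne_bot e (y := z) le_rfl
  · by_cases hz : z = x
    · subst hz
      by_cases hw : w = z
      · rw [hw]; exact hs.tc.le_refl _
      · rw [hcx, hc w hw]
        exact hs.tc.le_trans hXm (le_of_coe_le e (LowerSet.Iic_le.2 ((hge w hw).1 hzw)))
    · by_cases hw : w = x
      · subst hw
        rw [hcx, hc z hz]
        exact hs.tc.le_trans (le_of_coe_le e (T := H) (fun y (hy : y ≤ z) =>
          hy.trans_lt (hzw.lt_of_ne hz))) hHX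
      · rw [hc z hz, hc w hw]
        exact le_of_coe_le e (LowerSet.Iic_le.2 hzw)
  · by_cases hzx : z = x
    · subst hzx; exact hcross p w hz hw
    · by_cases hwx : w = x
      · subst hwx
        obtain ⟨u, h1, h2, h3⟩ := hcross p z hw hz
        exact ⟨u, h2, h1, h3⟩
      · rw [hc z hzx] at hz
        rw [hc w hwx] at hw
        have h3 : e (meet d (I z hzx) (I w hwx)) ∈ p := by
          rw [map_meet]; exact hs.tc.mem_meet.2 ⟨hz, hw⟩
        obtain ⟨u, hu, hup⟩ := (hkey _ p).1 h3
        rw [coe_meet] at hu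
        exact ⟨u, hu.1, hu.2, hup⟩

/-- The substructure knows only the union `D` of `Iic x` and `Iic m`, which is pure because the
labels agree. Splitting `e D` along `Iio x` and `Iio m` gives pure cells `a₁` and `a₂` for the two
points, meeting exactly in `e (Iio x) ∧ e (Iio m)`. -/
theorem IsSuperElementary.extend_beside (h : IsSuperElementary d M) (tw : Twin d x m)
    (hne : x ≠ m) (hlab : lab d x = lab d m) (hup : ∀ z, x < z ↔ m < z)
    (e : tw.substructure ↪[lang d] M) :
    ∃ E : LowerSet J ↪[lang d] M, ∀ S : tw.substructure, E S.1 = e S := by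
  classical
  have hs := h.toIsSubscaled
  have hxm : ¬ x ≤ m := fun h1 => lt_irrefl m ((hup m).1 (h1.lt_of_ne hne))
  have hmx : ¬ m ≤ x := fun h1 => lt_irrefl x ((hup x).2 (h1.lt_of_ne hne.symm))
  have hge : ∀ z, z ≠ x ∧ z ≠ m → (x ≤ z ↔ m ≤ z) := fun z hz =>
    ⟨fun h1 => ((hup z).1 (h1.lt_of_ne hz.1.symm)).le,
      fun h1 => ((hup z).2 (h1.lt_of_ne hz.2.symm)).le⟩
  let I : ∀ z, z ≠ x ∧ z ≠ m → tw.substructure := fun z hz => ⟨LowerSet.Iic z, hge z hz⟩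
  let D : tw.substructure := ⟨LowerSet.Iic x ⊔ LowerSet.Iic m,
    iff_of_true (Or.inl le_rfl) (Or.inr le_rfl)⟩
  let B₁ : tw.substructure := ⟨LowerSet.Iio x,
    iff_of_false (fun h1 => lt_irrefl x h1) (fun h1 => hmx (le_of_lt h1))⟩
  let B₂ : tw.substructure := ⟨LowerSet.Iio m,
    iff_of_false (fun h1 => hxm (le_of_lt h1)) (fun h1 => lt_irrefl m h1)⟩
  obtain ⟨a₁, a₂, ha₁, ha₂, hb₁, hb₂, hd₁, hd₂, hmeet⟩ := h.exists_split e D B₁ B₂ (y := x)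
    (Or.inl le_rfl) (fun y hy => Or.inl (le_of_lt hy)) (fun y hy => Or.inr (le_of_lt hy)) (by
      rintro y (hy | hy)
      · exact ⟨x, Or.inl le_rfl, hy, fun h1 => lt_irrefl x h1, fun h1 => hxm (le_of_lt h1)⟩
      · exact ⟨m, Or.inr le_rfl, hy, fun h1 => hmx (le_of_lt h1), fun h1 => lt_irrefl m h1⟩)
  have hD : comp d (labFin d x) (e D) = e D := by
    refine map_coe_comp_eq e (comp_eq_self_of_forall ?_)
    rintro y (hy | hy)
    · refine ⟨x, hy, ⟨Or.inl le_rfl, ?_⟩, rfl⟩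
      rintro z (hz | hz) hxz
      exacts [hz, absurd (hxz.trans hz) hxm]
    · refine ⟨m, hy, ⟨Or.inr le_rfl, ?_⟩, hlab.symm⟩
      rintro z (hz | hz) hxz
      exacts [absurd (hxz.trans hz) hmx, hz]
  have hlabFin : labFin d m = labFin d x := Fin.ext hlab.symm
  have hp₁ : comp d (labFin d x) a₁ = a₁ := by rw [hd₁]; exact hs.comp_diff_eq hD
  have hp₂ : comp d (labFin d m) a₂ = a₂ := by rw [hd₂, hlabFin]; exact hs.comp_diff_eq hD
  have hle₁ : le d a₁ (e D) := by rw [hd₁]; exact hs.diff_le_self _ _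
  have hle₂ : le d a₂ (e D) := by rw [hd₂]; exact hs.diff_le_self _ _
  have hcov : ∀ p : Spec d M, e D ∈ p → a₁ ∈ p ∨ a₂ ∈ p := fun p hp => by
    rw [hd₂]
    exact hs.tc.mem_join.1 (mem_of_le (hs.le_join_diff _ _) hp)
  let c : J → M := fun z => if hz : z ≠ x ∧ z ≠ m then e (I z hz) else if z = x then a₁ else a₂
  have hcx : c x = a₁ := by simp [c]
  have hcm : c m = a₂ := by simp [c, hne.symm]
  have hc : ∀ z (hz : z ≠ x ∧ z ≠ m), c z = e (I z hz) := fun z hz => dif_pos hz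
  let T : J → tw.substructure := fun z => if hz : z ≠ x ∧ z ≠ m then I z hz else D
  have hTx : T x = D := by simp [T]
  have hTm : T m = D := by simp [T]
  have hTz : ∀ z (hz : z ≠ x ∧ z ≠ m), T z = I z hz := fun z hz => dif_pos hz
  have hcase : ∀ z, z = x ∨ z = m ∨ (z ≠ x ∧ z ≠ m) := fun z => by tauto
  have hkey : ∀ (S : tw.substructure) (p : Spec d M), e S ∈ p ↔ ∃ z ∈ S.1, c z ∈ p := by
    intro S p
    have hDc : ∀ p : Spec d M, e D ∈ p → ∃ u ∈ D.1, c u ∈ p := fun p hp =>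
      (hcov p hp).elim (fun h1 => ⟨x, Or.inl le_rfl, by rwa [hcx]⟩)
        (fun h1 => ⟨m, Or.inr le_rfl, by rwa [hcm]⟩)
    refine hs.tc.mem_iff_exists_cell e T c (fun y => ?_) (fun y S hy => ?_) (fun p y hp => ?_)
      (fun y => ?_) S
    · rcases hcase y with rfl | rfl | hy
      · rw [hTx]; exact Or.inl le_rfl
      · rw [hTm]; exact Or.inr le_rfl
      · rw [hTz y hy]; exact le_refl y
    · rcases hcase y with rfl | rfl | hyx
      · rw [hTx]; exact sup_le (LowerSet.Iic_le.2 hy) (LowerSet.Iic_le.2 (S.2.1 hy))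
      · rw [hTm]; exact sup_le (LowerSet.Iic_le.2 (S.2.2 hy)) (LowerSet.Iic_le.2 hy)
      · rw [hTz y hyx]; exact LowerSet.Iic_le.2 hy
    · rcases hcase y with rfl | rfl | hyx
      · rw [hTx] at hp ⊢; exact hDc p hp
      · rw [hTm] at hp ⊢; exact hDc p hp
      · rw [hTz y hyx] at hp ⊢
        exact ⟨y, le_refl y, by rwa [hc y hyx]⟩
    · rcases hcase y with rfl | rfl | hyx
      · rw [hTx, hcx]; exact hle₁
      · rw [hTm, hcm]; exact hle₂
      · rw [hTz y hyx, hc y hyx]; exact hs.tc.le_refl _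
  have hmeetkey : ∀ (p : Spec d M) (S S' : tw.substructure), e S ∈ p → e S' ∈ p →
      ∃ u ∈ S.1, u ∈ S'.1 ∧ c u ∈ p := by
    intro p S S' h1 h2
    have h3 : e (meet d S S') ∈ p := by
      rw [map_meet]; exact hs.tc.mem_meet.2 ⟨h1, h2⟩
    obtain ⟨u, hu, hup⟩ := (hkey _ p).1 h3
    rw [coe_meet] at hu
    exact ⟨u, hu.1, hu.2, hup⟩
  have hboth : ∀ p : Spec d M, a₁ ∈ p → a₂ ∈ p → e B₁ ∈ p ∧ e B₂ ∈ p := fun p h1 h2 => by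
    have : meet d a₁ a₂ ∈ p := hs.tc.mem_meet.2 ⟨h1, h2⟩
    rw [hmeet] at this
    exact hs.tc.mem_meet.1 this
  have hB : ∀ (p : Spec d M) w (hw : w ≠ x ∧ w ≠ m), ¬ x ≤ w → e D ∈ p → e (I w hw) ∈ p →
      e B₁ ∈ p ∨ e B₂ ∈ p := by
    intro p w hw hxw h1 h2
    have h3 : e (meet d D (I w hw)) ∈ p := by
      rw [map_meet]; exact hs.tc.mem_meet.2 ⟨h1, h2⟩
    refine hs.tc.mem_or_of_coe_le_sup e ?_ h3
    rw [coe_meet]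
    rintro y ⟨hy | hy, hyw⟩
    · exact Or.inl (lt_of_le_of_ne hy fun h4 => hxw (h4 ▸ hyw))
    · exact Or.inr (lt_of_le_of_ne hy fun h4 => hxw ((hge w hw).2 (h4 ▸ hyw)))
  -- If `w` is not above `x`, such a prime contains `e B₁` or `e B₂`. In the second case it contains
  -- `a₂` as well as `a₁`, hence again `e B₁`.
  have hcross₁ : ∀ (p : Spec d M) w (_ : w ≠ x ∧ w ≠ m), c x ∈ p → c w ∈ p →
      ∃ u, u ≤ x ∧ u ≤ w ∧ c u ∈ p := by
    intro p w hw hxp hwp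
    by_cases hxw : x ≤ w
    · exact ⟨x, le_rfl, hxw, hxp⟩
    · rw [hcx] at hxp
      rw [hc w hw] at hwp
      have h2 : e B₁ ∈ p := (hB p w hw hxw (mem_of_le hle₁ hxp) hwp).elim id
        fun h1 => (hboth p hxp (mem_of_le hb₂ h1)).1
      obtain ⟨u, hu, huw, hup⟩ := hmeetkey p _ _ h2 hwp
      exact ⟨u, le_of_lt hu, huw, hup⟩
  have hcross₂ : ∀ (p : Spec d M) w (_ : w ≠ x ∧ w ≠ m), c m ∈ p → c w ∈ p →
      ∃ u, u ≤ m ∧ u ≤ w ∧ c u ∈ p := by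
    intro p w hw hxp hwp
    by_cases hxw : m ≤ w
    · exact ⟨m, le_rfl, hxw, hxp⟩
    · rw [hcm] at hxp
      rw [hc w hw] at hwp
      have h2 : e B₂ ∈ p := (hB p w hw (mt (hge w hw).1 hxw) (mem_of_le hle₂ hxp) hwp).elim
        (fun h1 => (hboth p (mem_of_le hb₁ h1) hxp).2) id
      obtain ⟨u, hu, huw, hup⟩ := hmeetkey p _ _ h2 hwp
      exact ⟨u, le_of_lt hu, huw, hup⟩
  have hcross₃ : ∀ p : Spec d M, c x ∈ p → c m ∈ p → ∃ u, u ≤ x ∧ u ≤ m ∧ c u ∈ p := by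
    intro p h1 h2
    rw [hcx] at h1
    rw [hcm] at h2
    obtain ⟨h3, h4⟩ := hboth p h1 h2
    obtain ⟨u, hu, huw, hup⟩ := hmeetkey p _ _ h3 h4
    exact ⟨u, le_of_lt hu, le_of_lt huw, hup⟩
  refine hs.exists_extension_of_cells e c hkey (fun z => ?_) (fun z => ?_) (fun z w hzw => ?_)
    fun p z w hz hw => ?_
  · rcases hcase z with rfl | rfl | hz
    · rwa [hcx]
    · rwa [hcm]
    · rw [hc z hz]; exact map_coe_comp_eq e (comp_Iic z)
  · rcases hcase z with rfl | rfl | hz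
    · rwa [hcx]
    · rwa [hcm]
    · rw [hc z hz]; exact map_coe_ne_bot e (y := z) le_rfl
  · rcases hzw.eq_or_lt with rfl | hlt
    · exact hs.tc.le_refl _
    · rcases hcase z with rfl | rfl | hz <;> rcases hcase w with rfl | rfl | hw
      · exact absurd hlt (lt_irrefl _)
      · exact absurd hzw hxm
      · rw [hcx, hc w hw]
        exact hs.tc.le_trans hle₁ (le_of_coe_le e (sup_le (LowerSet.Iic_le.2 hzw)
          (LowerSet.Iic_le.2 ((hge w hw).1 hzw))))
      · exact absurd hzw hmx
      · exact absurd hlt (lt_irrefl _)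
      · rw [hcm, hc w hw]
        exact hs.tc.le_trans hle₂ (le_of_coe_le e (sup_le (LowerSet.Iic_le.2 ((hge w hw).2 hzw))
          (LowerSet.Iic_le.2 hzw)))
      · rw [hcx, hc z hz]
        exact hs.tc.le_trans (le_of_coe_le e (T := B₁) fun y hy => lt_of_le_of_lt hy hlt) hb₁
      · rw [hcm, hc z hz]
        exact hs.tc.le_trans (le_of_coe_le e (T := B₂) fun y hy => lt_of_le_of_lt hy hlt) hb₂
      · rw [hc z hz, hc w hw]
        exact le_of_coe_le e (LowerSet.Iic_le.2 hzw)
  · have hswap : ∀ {z w : J}, (∃ u, u ≤ w ∧ u ≤ z ∧ c u ∈ p) → ∃ u, u ≤ z ∧ u ≤ w ∧ c u ∈ p :=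
      fun ⟨u, h1, h2, h3⟩ => ⟨u, h2, h1, h3⟩
    rcases hcase z with rfl | rfl | hz' <;> rcases hcase w with rfl | rfl | hw'
    · exact ⟨_, le_rfl, le_rfl, hz⟩
    · exact hcross₃ p hz hw
    · exact hcross₁ p w hw' hz hw
    · exact hswap (hcross₃ p hw hz)
    · exact ⟨_, le_rfl, le_rfl, hz⟩
    · exact hcross₂ p w hw' hz hw
    · exact hswap (hcross₁ p z hz' hw hz)
    · exact hswap (hcross₂ p z hz' hw hz)
    · rw [hc z hz'] at hz
      rw [hc w hw'] at hw
      obtain ⟨u, h1, h2, h3⟩ := hmeetkey p _ _ hz hw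
      exact ⟨u, h1, h2, h3⟩

theorem IsSuperElementary.extend_twin (h : IsSuperElementary d M) (tw : Twin d x m)
    (e : tw.substructure ↪[lang d] M) :
    ∃ E : LowerSet J ↪[lang d] M, ∀ S : tw.substructure, E S.1 = e S :=
  (id tw).elim (fun h1 => h.extend_below tw h1.1 h1.2 e)
    (fun h1 => h.extend_beside tw h1.1 h1.2.1 h1.2.2 e)

end OneStep

/-! ### Extension of embeddings from substructures of finite lattices. -/

section Extension

variable {d : ℕ} {M : Type u} [(lang d).Structure M]

/-- Embeddings in a super `d`-scaled lattice extend from a substructure of a finite `d`-subscaled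
lattice to the whole of it. -/
theorem IsSuperElementary.exists_extension (h : IsSuperElementary d M) {P : Type v}
    [(lang d).Structure P] [Finite P] (hP : IsSubscaled d P) (A : (lang d).Substructure P)
    (e : A ↪[lang d] M) : ∃ E : P ↪[lang d] M, ∀ a : A, E a = e a := by
  -- A proper `A` lies in the proper substructure `B` of elements that do not separate some twin
  -- pair. The embedding extends from `A` to `B` by induction, then from `B` to `P` by separating
  -- the pair.
  induction hn : Nat.card P using Nat.strong_induction_on generalizing P with
  | _ n ih =>
  by_cases hA : A = ⊤
  · obtain ⟨s, hs⟩ := exists_lift_of_range (Embedding.refl (lang d) P) A.subtype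
      fun a => ⟨⟨a, hA ▸ Substructure.mem_top a⟩, rfl⟩
    exact ⟨e.comp s, fun a => congrArg e (Subtype.ext (hs a))⟩
  · let := hP.gradedSpec
    have : Finite (Spec d P) := inferInstanceAs (Finite {F : Set P // IsPrimeFilter d F})
    have hsurj := hP.repr_surjective
    obtain ⟨x, m, tw, htw⟩ := exists_twin (A := A.map hP.repr.toHom) (by
      intro htop
      refine hA (eq_top_iff.2 fun a _ => ?_)
      obtain ⟨b, hb, hba⟩ := (htop ▸ Substructure.mem_top (hP.repr a) :
        hP.repr a ∈ A.map hP.repr.toHom)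
      exact hP.repr.injective hba ▸ hb)
    let B : (lang d).Substructure P := tw.substructure.comap hP.repr.toHom
    have hAB : A ≤ B := fun a ha => htw ⟨a, ha, rfl⟩
    have hB : Nat.card B < n := by
      rw [← hn]
      have hex : ∃ a, a ∉ B := by
        by_contra hc
        push Not at hc
        refine tw.substructure_ne_top (eq_top_iff.2 fun S _ => ?_)
        obtain ⟨a, rfl⟩ := hsurj S
        exact hc a
      exact Finite.card_subtype_lt hex.choose_spec
    obtain ⟨t, ht⟩ := exists_lift_of_range
      (B.subtype.comp (A.comap B.subtype.toHom).subtype) A.subtype fun a => ⟨⟨a.1.1, a.2⟩, rfl⟩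
    obtain ⟨eB, heB⟩ := ih _ hB (P := B) (hP.substructure B) (A.comap B.subtype.toHom)
      (e.comp t) rfl
    obtain ⟨s, hs⟩ := exists_lift_of_range tw.substructure.subtype (hP.repr.comp B.subtype)
      fun S => by
        obtain ⟨a, ha⟩ := hsurj S.1
        exact ⟨⟨a, show hP.repr a ∈ tw.substructure from ha ▸ S.2⟩, ha⟩
    obtain ⟨E, hE⟩ := h.extend_twin tw (eB.comp s)
    refine ⟨E.comp hP.repr, fun a => ?_⟩
    have h1 := hE ⟨hP.repr a, htw ⟨a, a.2, rfl⟩⟩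
    have h2 : s ⟨hP.repr a, htw ⟨a, a.2, rfl⟩⟩ = ⟨a, hAB a.2⟩ :=
      Subtype.ext (hP.repr.injective (hs _))
    refine h1.trans ?_
    rw [Embedding.comp_apply, h2]
    refine (heB ⟨⟨a, hAB a.2⟩, a.2⟩).trans (congrArg e (Subtype.ext ?_))
    exact ht ⟨⟨a, hAB a.2⟩, a.2⟩

end Extension

/-! ### Adjoining points to a graded poset. -/

section Adjoin

variable {d : ℕ} {J : Type u} [PartialOrder J] [GradedPoset d J] {ι : Type u}

variable (d J ι) in
/-- Data for adjoining to `J` new points of label `label` indexed by `ι`: the points below and the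
least old point above each of them. -/
structure AdjoinData where
  lo : ι → LowerSet J
  hi : ι → J
  label : ℕ
  lo_le : ∀ i, ∀ y ∈ lo i, y ≤ hi i
  hi_notMem : ∀ i j, hi i ∉ lo j
  lab_lo : ∀ i, ∀ y ∈ lo i, lab d y < label
  lab_hi : ∀ i, label < lab d (hi i)

/-- The poset obtained by adjoining new points. -/
structure Adjoin (D : AdjoinData d J ι) : Type u where
  val : J ⊕ ι

variable {D : AdjoinData d J ι}

/-- The order after adjoining new points. -/
def AdjoinData.le (D : AdjoinData d J ι) : J ⊕ ι → J ⊕ ι → Prop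
  | .inl y, .inl z => y ≤ z
  | .inl y, .inr i => y ∈ D.lo i
  | .inr i, .inl z => D.hi i ≤ z
  | .inr i, .inr j => i = j

instance : PartialOrder (Adjoin D) where
  le s t := D.le s.val t.val
  le_refl := by
    rintro ⟨y | i⟩
    exacts [le_refl y, rfl]
  le_trans := by
    rintro ⟨x | i⟩ ⟨y | j⟩ ⟨z | k⟩ h1 h2
    · exact le_trans (α := J) h1 h2
    · exact (D.lo k).lower h1 h2
    · exact (D.lo_le j _ h1).trans h2
    · cases (show j = k from h2); exact h1
    · exact le_trans (α := J) h1 h2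
    · exact absurd ((D.lo k).lower h1 h2) (D.hi_notMem i k)
    · cases (show i = j from h1); exact h2
    · exact Eq.trans (α := ι) h1 h2
  le_antisymm := by
    rintro ⟨x | i⟩ ⟨y | j⟩ h1 h2
    · exact congrArg (fun z => (⟨.inl z⟩ : Adjoin D)) (le_antisymm (α := J) h1 h2)
    · exact absurd ((D.lo j).lower h2 h1) (D.hi_notMem j j)
    · exact absurd ((D.lo i).lower h1 h2) (D.hi_notMem i i)
    · exact congrArg (fun z => (⟨.inr z⟩ : Adjoin D)) (show i = j from h1)

/-- The labels after adjoining new points. -/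
def Adjoin.lab (s : Adjoin D) : ℕ := s.val.elim (GradedPoset.lab d) fun _ => D.label

instance : GradedPoset d (Adjoin D) where
  lab := Adjoin.lab
  lab_lt := by
    rintro ⟨x | i⟩ ⟨y | j⟩ h
    · exact GradedPoset.lab_lt (lt_of_le_not_ge (α := J) h.le h.not_ge)
    · exact D.lab_lo j x h.le
    · exact (D.lab_hi i).trans_le (GradedPoset.lab_mono d h.le)
    · exact absurd (congrArg (fun z => (⟨.inr z⟩ : Adjoin D)) (show i = j from h.le)) h.ne
  lab_le := by
    rintro ⟨x | i⟩
    · exact GradedPoset.lab_le x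
    · exact (D.lab_hi i).le.trans (GradedPoset.lab_le _)

instance [Finite J] [Finite ι] : Finite (Adjoin D) :=
  Finite.of_injective Adjoin.val fun ⟨_⟩ ⟨_⟩ h => congrArg Adjoin.mk h

/-- The map which sends each new point to the least old point above it. -/
def Adjoin.proj (s : Adjoin D) : J := s.val.elim id D.hi

theorem Adjoin.isPMorphism : IsPMorphism d (Adjoin.proj (D := D)) where
  mono := by
    rintro ⟨x | i⟩ ⟨y | j⟩ h
    · exact h
    · exact D.lo_le j x h
    · exact h
    · cases (show i = j from h); exact le_rfl
  lift := by
    rintro ⟨x | i⟩ z h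
    · exact ⟨⟨.inl z⟩, h, rfl, rfl⟩
    · exact ⟨⟨.inl z⟩, h, rfl, rfl⟩

theorem Adjoin.surjective : Function.Surjective (Adjoin.proj (D := D)) := fun z => ⟨⟨.inl z⟩, rfl⟩

end Adjoin

/-! ### Separating a lower set into two sheets. -/

section Double

variable {d : ℕ} {J : Type u} [PartialOrder J] [GradedPoset d J]

/-- The tags allowed at `x` when the points of `a` are separated into two sheets which meet in
`b₁ ∩ b₂`. -/
def IsTag (a b₁ b₂ : LowerSet J) (x : J) (t : Fin 3) : Prop :=
  (t = 0 ∧ (x ∉ a ∨ (x ∈ b₁ ∧ x ∈ b₂))) ∨ (t = 1 ∧ x ∈ a ∧ x ∉ b₂) ∨ (t = 2 ∧ x ∈ a ∧ x ∉ b₁)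

/-- The poset obtained by separating the points of `a` into two sheets. -/
structure Double (a b₁ b₂ : LowerSet J) : Type u where
  pt : J
  tag : Fin 3
  isTag : IsTag a b₁ b₂ pt tag

variable {a b₁ b₂ : LowerSet J}

theorem Double.tag_eq_of_pt_eq {s t : Double a b₁ b₂} (hst : s.pt = t.pt)
    (h : s.tag = 0 ∨ t.tag = 0 ∨ s.tag = t.tag) : s = t := by
  obtain ⟨x, i, hi⟩ := s
  obtain ⟨y, j, hj⟩ := t
  dsimp only at hst h
  subst hst
  congr 1
  rcases hi with ⟨rfl, hi⟩ | ⟨rfl, hi⟩ | ⟨rfl, hi⟩ <;>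
  rcases hj with ⟨rfl, hj⟩ | ⟨rfl, hj⟩ | ⟨rfl,
      hj⟩ <;> first | rfl | (exfalso; revert h; simp <;> tauto)

/-- Tag `0` marks the points common to both sheets or outside `a`; points with tags `1` and `2` are
incomparable. -/
instance : PartialOrder (Double a b₁ b₂) where
  le s t := s.pt ≤ t.pt ∧ (s.tag = 0 ∨ t.tag = 0 ∨ s.tag = t.tag)
  le_refl s := ⟨le_rfl, Or.inr (Or.inr rfl)⟩
  le_trans := by
    rintro ⟨x, i, hi⟩ ⟨y, j, hj⟩ ⟨z, k, hk⟩ ⟨h1, h2⟩ ⟨h3, h4⟩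
    refine ⟨le_trans h1 h3, ?_⟩
    dsimp only at *
    -- A middle point with tag `0` is either outside `a`, and then so is the upper point, or in `b₁
    -- ∩ b₂`, and then so is the lower point; one of the two outer tags is thus `0`.
    by_cases hj0 : j = 0
    · subst hj0
      rcases hj with ⟨-, hj | hj⟩ | ⟨h, -⟩ | ⟨h, -⟩
      · refine Or.inr (Or.inl ?_)
        have : z ∉ a := fun h => hj (a.lower h3 h)
        rcases hk with ⟨h, -⟩ | ⟨-, h, -⟩ | ⟨-, h, -⟩
        exacts [h, absurd h this, absurd h this]
      · refine Or.inl ?_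
        rcases hi with ⟨h, -⟩ | ⟨-, -, h⟩ | ⟨-, -, h⟩
        exacts [h, absurd (b₂.lower h1 hj.2) h, absurd (b₁.lower h1 hj.1) h]
      · exact absurd h (by decide)
      · exact absurd h (by decide)
    · rcases h2 with h2 | h2 | rfl
      · exact Or.inl h2
      · exact absurd h2 hj0
      · exact h4
  le_antisymm s t h1 h2 := Double.tag_eq_of_pt_eq (le_antisymm h1.1 h2.1) h1.2

instance : GradedPoset d (Double a b₁ b₂) where
  lab s := lab d s.pt
  lab_lt h := GradedPoset.lab_lt (h.le.1.lt_of_ne fun he =>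
    h.ne (Double.tag_eq_of_pt_eq he h.le.2))
  lab_le s := GradedPoset.lab_le s.pt

instance [Finite J] : Finite (Double a b₁ b₂) :=
  Finite.of_injective (fun s => (s.pt, s.tag)) fun ⟨_, _, _⟩ ⟨_, _, _⟩ h => by
    obtain ⟨h1, h2⟩ := Prod.mk.inj h
    cases h1; cases h2; rfl

theorem exists_isTag (x : J) : ∃ t, IsTag a b₁ b₂ x t := by
  by_cases h1 : x ∈ a <;> by_cases h2 : x ∈ b₁ <;> by_cases h3 : x ∈ b₂
  all_goals
    first
    | exact ⟨0, Or.inl ⟨rfl, Or.inl h1⟩⟩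
    | exact ⟨0, Or.inl ⟨rfl, Or.inr ⟨h2, h3⟩⟩⟩
    | exact ⟨1, Or.inr (Or.inl ⟨rfl, h1, h3⟩)⟩
    | exact ⟨2, Or.inr (Or.inr ⟨rfl, h1, h2⟩)⟩

theorem Double.surjective : Function.Surjective (Double.pt (a := a) (b₁ := b₁) (b₂ := b₂)) :=
  fun x => (exists_isTag x).elim fun t ht => ⟨⟨x, t, ht⟩, rfl⟩

theorem Double.isPMorphism : IsPMorphism d (Double.pt (a := a) (b₁ := b₁) (b₂ := b₂)) where
  mono _ _ h := h.1
  lift := by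
    rintro ⟨x, i, hi⟩ y (hxy : x ≤ y)
    suffices h : ∃ j, IsTag a b₁ b₂ y j ∧ (i = 0 ∨ j = 0 ∨ i = j) by
      obtain ⟨j, hj, hij⟩ := h
      exact ⟨⟨y, j, hj⟩, ⟨hxy, hij⟩, rfl, rfl⟩
    by_cases hya : y ∈ a
    · rcases hi with ⟨rfl, hi⟩ | ⟨rfl, -, hi⟩ | ⟨rfl, -, hi⟩
      · obtain ⟨j, hj⟩ := exists_isTag (a := a) (b₁ := b₁) (b₂ := b₂) y
        exact ⟨j, hj, Or.inl rfl⟩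
      · exact ⟨1, Or.inr (Or.inl ⟨rfl, hya, fun h => hi (b₂.lower hxy h)⟩), Or.inr (Or.inr rfl)⟩
      · exact ⟨2, Or.inr (Or.inr ⟨rfl, hya, fun h => hi (b₁.lower hxy h)⟩), Or.inr (Or.inr rfl)⟩
    · exact ⟨0, Or.inl ⟨rfl, Or.inl hya⟩, Or.inr (Or.inl rfl)⟩

end Double

/-! ### Solving instances of the existential axioms. -/

section Problems

variable (d : ℕ) (M : Type u)

/-- The instances in `M` of the existential axioms of super `d`-scaled lattices. -/
abbrev Problem : Type u :=
  (Fin (d + 1) × Fin (d + 1) × M) ⊕ (Fin (d + 1) × Fin (d + 1) × Fin (d + 1) × M × M) ⊕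
    (M × M × M)

variable {d M} {N : Type v}

/-- The image of an instance. -/
def Problem.map (g : M → N) : Problem d M → Problem d N
  | .inl (i, j, a) => .inl (i, j, g a)
  | .inr (.inl (r, q, p, c, a)) => .inr (.inl (r, q, p, g c, g a))
  | .inr (.inr (b₁, b₂, a)) => .inr (.inr (g b₁, g b₂, g a))

variable [(lang d).Structure M] [(lang d).Structure N]

/-- The instance has a solution. -/
def Problem.Solved : Problem d M → Prop
  | .inl (i, j, a) => (j : ℕ) = i + 1 → comp d j a ≠ bot d →
      ∃ b : M, le d b (comp d j a) ∧ comp d i b ≠ bot d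
  | .inr (.inl (r, q, p, c, a)) => r ≤ q → q ≤ p → le d c a →
      comp d p a = a → a ≠ bot d → comp d r c = c → c ≠ bot d →
      ∃ b : M, comp d q b = b ∧ le d c b ∧ le d b a
  | .inr (.inr (b₁, b₂, a)) => le d (join d b₁ b₂) a → diff d a (join d b₁ b₂) = a → a ≠ bot d →
      ∃ a₁ a₂ : M, a₁ ≠ bot d ∧ a₂ ≠ bot d ∧ le d b₁ a₁ ∧ le d b₂ a₂ ∧
        a₁ = diff d a a₂ ∧ a₂ = diff d a a₁ ∧ meet d a₁ a₂ = meet d b₁ b₂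

theorem isSuperElementary_of_solved (h : IsSubscaled d M)
    (hs : ∀ x : Problem d M, x.Solved) : IsSuperElementary d M :=
  ⟨h, fun i j hij a => hs (.inl (i, j, a)) hij,
    fun r q p h1 h2 c a => hs (.inr (.inl (r, q, p, c, a))) h1 h2,
    fun b₁ b₂ a => hs (.inr (.inr (b₁, b₂, a)))⟩

/-- The hypotheses of an instance are quantifier-free, so embeddings reflect them, and they preserve
witnesses. Instances once solved stay solved along a chain. -/
theorem Problem.Solved.map {x : Problem d M} (hx : x.Solved) (g : M ↪[lang d] N) :
    (x.map g).Solved := by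
  rcases x with ⟨i, j, a⟩ | ⟨r, q, p, c, a⟩ | ⟨b₁, b₂, a⟩
  · intro h1 h2
    rw [← map_comp, ← map_bot g, g.injective.ne_iff] at h2
    obtain ⟨b, hb, h3⟩ := hx h1 h2
    refine ⟨g b, ?_, ?_⟩
    · rwa [← map_comp, map_le]
    · rwa [← map_comp, ← map_bot g, g.injective.ne_iff]
  · intro h1 h2 h3 h4 h5 h6 h7
    simp only [← map_comp, ← map_bot g, g.injective.ne_iff, g.injective.eq_iff, map_le] at *
    obtain ⟨b, hb, h8, h9⟩ := hx h1 h2 h3 h4 h5 h6 h7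
    exact ⟨g b, by rw [← map_comp, hb], (map_le g _ _).2 h8, (map_le g _ _).2 h9⟩
  · intro h1 h2 h3
    simp only [← map_join, ← map_diff, ← map_bot g, g.injective.ne_iff, g.injective.eq_iff,
      map_le] at h1 h2 h3
    obtain ⟨a₁, a₂, h4, h5, h6, h7, h8, h9, h10⟩ := hx h1 h2 h3
    refine ⟨g a₁, g a₂, ?_, ?_, (map_le g _ _).2 h6, (map_le g _ _).2 h7, ?_, ?_, ?_⟩
    · rwa [← map_bot g, g.injective.ne_iff]
    · rwa [← map_bot g, g.injective.ne_iff]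
    · rw [← map_diff, ← h8]
    · rw [← map_diff, ← h9]
    · rw [← map_meet, ← map_meet, h10]

end Problems

section Solve

variable {d : ℕ} {J : Type u} [PartialOrder J] [GradedPoset d J]

theorem Adjoin.comp_iSup_Iic {ι : Type u} {D : AdjoinData d J ι} {q : Fin (d + 1)}
    (hq : D.label = q) :
    comp d q (⨆ i, LowerSet.Iic (⟨.inr i⟩ : Adjoin D)) = ⨆ i, LowerSet.Iic (⟨.inr i⟩ : Adjoin D) :=
  comp_eq_self_of_forall fun y hy => by
    obtain ⟨i, hi⟩ := LowerSet.mem_iSup_iff.1 hy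
    refine ⟨⟨.inr i⟩, hi, ⟨LowerSet.mem_iSup_iff.2 ⟨i, LowerSet.mem_Iic_iff.2 le_rfl⟩,
        fun t ht hit => ?_⟩, hq⟩
    obtain ⟨j, hj⟩ := LowerSet.mem_iSup_iff.1 ht
    cases (show i = j from le_trans hit hj)
    exact hj

/-- For `Descending`, a point of label `i` is adjoined below a maximal point of `a` of label `j`.
For Catenarity, above each point of `c` a point of label `q` is adjoined, under a maximal point of
`a` of label `p`. For Splitting, `a` is separated into two sheets that meet in `b₁ ∩ b₂`. -/
theorem exists_solution_lowerSet [Finite J] (x : Problem d (LowerSet J)) :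
    ∃ (K : Type u) (_ : PartialOrder K) (_ : GradedPoset d K) (_ : Finite K)
      (g : LowerSet J ↪[lang d] LowerSet K), (x.map g).Solved := by
  by_cases hx : x.Solved
  · exact ⟨J, _, _, ‹_›, Embedding.refl _ _, hx.map _⟩
  rcases x with ⟨i, j, a⟩ | ⟨r, q, p, c, a⟩ | ⟨b₁, b₂, a⟩
  · simp only [Problem.Solved, Classical.not_imp] at hx
    obtain ⟨hij, ha, -⟩ := hx
    obtain ⟨m, hm⟩ : ∃ m, Maximal (· ∈ a) m ∧ lab d m = j := by
      by_contra hc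
      push Not at hc
      refine ha (le_antisymm (fun y hy => ?_) _root_.bot_le)
      obtain ⟨z, hz, hzj, -⟩ := mem_lowerSet_comp.1 hy
      exact absurd hzj (hc z hz)
    let D : AdjoinData d J PUnit.{u + 1} :=
      ⟨fun _ => ⊥, fun _ => m, i, fun _ _ h => h.elim, fun _ _ h => h.elim, fun _ _ h => h.elim,
        fun _ => by omega⟩
    refine ⟨Adjoin D, _, _, inferInstance, Adjoin.isPMorphism.embedding Adjoin.surjective, ?_⟩
    intro _ _
    refine ⟨⨆ i, LowerSet.Iic (⟨.inr i⟩ : Adjoin D), ?_, ?_⟩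
    · rw [← map_comp]
      refine lowerSet_le_iff.2 (iSup_le fun i => LowerSet.Iic_le.2 ?_)
      exact mem_lowerSet_comp.2 ⟨m, hm.1, hm.2, le_rfl⟩
    · rw [Adjoin.comp_iSup_Iic rfl]
      intro h0
      have h1 : (⟨.inr PUnit.unit⟩ : Adjoin D) ∈ ⨆ i, LowerSet.Iic (⟨.inr i⟩ : Adjoin D) :=
        LowerSet.mem_iSup_iff.2 ⟨PUnit.unit, LowerSet.mem_Iic_iff.2 le_rfl⟩
      exact notMem_lowerSet_bot (h0 ▸ h1)
  · have hx' := hx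
    simp only [Problem.Solved, Classical.not_imp] at hx
    obtain ⟨hrq, hqp, hca, hpa, ha, hrc, hc, hno⟩ := hx
    -- An unsolved instance has `r < q < p`, since otherwise `c` or `a` itself is a solution.
    have hrq' : r < q := lt_of_le_of_ne hrq fun h => hno
      ⟨c, h ▸ hrc, le_refl c |> lowerSet_le_iff.2, hca⟩
    have hqp' : q < p := lt_of_le_of_ne hqp fun h => hno
      ⟨a, h ▸ hpa, hca, le_refl a |> lowerSet_le_iff.2⟩
    have hlow : ∀ y ∈ c, lab d y ≤ r := fun y hy => by
      rw [← hrc] at hy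
      obtain ⟨z, -, hz, hyz⟩ := mem_lowerSet_comp.1 hy
      exact hz ▸ GradedPoset.lab_mono d hyz
    have hmu : ∀ y : c, ∃ m, Maximal (· ∈ a) m ∧ lab d m = p ∧ y.1 ≤ m := fun y => by
      have := lowerSet_le_iff.1 hca y.2
      rw [← hpa] at this
      exact mem_lowerSet_comp.1 this
    choose mu hmu hmup hmule using hmu
    let D : AdjoinData d J c :=
      ⟨fun x => LowerSet.Iic x.1, mu, q, fun x y hy => le_trans hy (hmule x),
        fun x y h => by
          have h1 := GradedPoset.lab_mono d (show mu x ≤ y.1 from h)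
          have h2 := hlow _ y.2
          rw [hmup] at h1
          have := Fin.lt_def.1 (hrq'.trans hqp')
          omega,
        fun x y hy => ((GradedPoset.lab_mono d (show y ≤ x.1 from hy)).trans
          (hlow _ x.2)).trans_lt (Fin.lt_def.1 hrq'),
        fun x => by rw [hmup]; exact Fin.lt_def.1 hqp'⟩
    refine ⟨Adjoin D, _, _, inferInstance, Adjoin.isPMorphism.embedding Adjoin.surjective, ?_⟩
    intro _ _ _ _ _ _ _
    refine ⟨⨆ i, LowerSet.Iic (⟨.inr i⟩ : Adjoin D), Adjoin.comp_iSup_Iic rfl, ?_, ?_⟩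
    · refine lowerSet_le_iff.2 fun s hs => LowerSet.mem_iSup_iff.2 ?_
      obtain ⟨y | x⟩ := s
      · exact ⟨⟨y, hs⟩, le_refl y⟩
      · have h1 := hlow _ (show mu x ∈ c from hs)
        rw [hmup] at h1
        have := Fin.lt_def.1 (hrq'.trans hqp')
        omega
    · exact lowerSet_le_iff.2 (iSup_le fun x => LowerSet.Iic_le.2 (hmu x).1)
  · simp only [Problem.Solved, Classical.not_imp] at hx
    obtain ⟨hle, hd, ha, -⟩ := hx
    rw [lowerSet_le_iff] at hle
    have hb₁ : b₁ ≤ a := le_sup_left.trans hle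
    have hb₂ : b₂ ≤ a := le_sup_right.trans hle
    have hgen : ∀ y ∈ a, ∃ z ∈ a, z ∉ b₁ ∧ z ∉ b₂ ∧ y ≤ z := fun y hy => by
      rw [← hd] at hy
      obtain ⟨z, hz, h1, h2⟩ := mem_lowerSet_diff.1 hy
      exact ⟨z, hz, fun h => h1 (Or.inl h), fun h => h1 (Or.inr h), h2⟩
    obtain ⟨y₀, hy₀⟩ : ∃ y, y ∈ a := by
      by_contra hc
      exact ha (le_antisymm (fun y hy => absurd ⟨y, hy⟩ hc) _root_.bot_le)
    obtain ⟨z₀, hz₀, hz₁, hz₂, -⟩ := hgen y₀ hy₀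
    refine ⟨Double a b₁ b₂, _, _, inferInstance,
      Double.isPMorphism.embedding Double.surjective, ?_⟩
    intro _ _ _
    -- The sheet obtained from `a` by removing the points of tag `k`. The solution is `a₁ = s 2` and
    -- `a₂ = s 1`.
    let s : ∀ k : Fin 3, k ≠ 0 → LowerSet (Double a b₁ b₂) := fun k hk =>
      ⟨{x | x.pt ∈ a ∧ x.tag ≠ k}, by
        rintro ⟨x, i, hi⟩ ⟨y, j, hj⟩ ⟨h1, h2⟩ ⟨h3, h4⟩
        refine ⟨a.lower h1 h3, ?_⟩
        rintro (rfl : j = k)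
        dsimp only at *
        rcases h2 with h2 | h2 | h2
        · exact hk h2
        · subst h2
          rcases hi with ⟨-, hi | hi⟩ | ⟨h, -⟩ | ⟨h, -⟩
          · exact hi h3
          · rcases hj with ⟨h, -⟩ | ⟨-, -, h⟩ | ⟨-, -, h⟩
            exacts [hk h, h (b₂.lower h1 hi.2), h (b₁.lower h1 hi.1)]
          · exact absurd h (by decide)
          · exact absurd h (by decide)
        · exact h4 h2.symm⟩
    have hdiff : ∀ k l (hk : k ≠ 0) (hl : l ≠ 0), k ≠ l →
        (∀ x ∈ a, x ∉ b₁ → x ∉ b₂ → IsTag a b₁ b₂ x l) →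
        s k hk = diff d ((Double.isPMorphism (d := d)).embedding Double.surjective a) (s l hl) := by
      intro k l hk hl hkl htag
      ext ⟨x, i, hi⟩
      refine Iff.trans ?_ (mem_lowerSet_diff (d := d)).symm
      constructor
      · rintro ⟨h1, h2⟩
        dsimp only at h1 h2
        by_cases hil : i = l
        · exact ⟨⟨x, i, hi⟩, h1, fun h => h.2 hil, le_rfl⟩
        · have hi0 : i = 0 := by
            rcases hi with ⟨h, -⟩ | ⟨h, -⟩ | ⟨h, -⟩
            · exact h
            · omega
            · omega
          -- A point of `a` with tag `0` lies below a point of `a` outside `b₁ ∪ b₂`; such a point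
          -- occurs in both sheets, in particular with tag `l`.
          obtain ⟨z, hz, hzb₁, hzb₂, hxz⟩ := hgen x h1
          exact ⟨⟨z, l, htag z hz hzb₁ hzb₂⟩, hz, fun h => h.2 rfl, hxz, Or.inl hi0⟩
      · rintro ⟨⟨z, j, hj⟩, hz, hnot, hle⟩
        have hjl : j = l := by
          by_contra hne
          exact hnot ⟨hz, hne⟩
        have : (⟨z, j, hj⟩ : Double a b₁ b₂) ∈ s k hk := ⟨hz, fun h => hkl (h.symm.trans hjl)⟩
        exact (s k hk).lower hle this
    refine ⟨s 2 (by decide), s 1 (by decide), ?_, ?_, ?_, ?_, ?_, ?_, ?_⟩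
    · intro h0
      have : (⟨z₀, 1, Or.inr (Or.inl ⟨rfl, hz₀, hz₂⟩)⟩ : Double a b₁ b₂) ∈ s 2 (by decide) :=
        ⟨hz₀, by simp⟩
      exact notMem_lowerSet_bot (h0 ▸ this)
    · intro h0
      have : (⟨z₀, 2, Or.inr (Or.inr ⟨rfl, hz₀, hz₁⟩)⟩ : Double a b₁ b₂) ∈ s 1 (by decide) :=
        ⟨hz₀, by simp⟩
      exact notMem_lowerSet_bot (h0 ▸ this)
    · refine lowerSet_le_iff.2 ?_
      rintro ⟨x, i, hi⟩ (hxb : x ∈ b₁)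
      refine ⟨hb₁ hxb, ?_⟩
      rintro (rfl : i = 2)
      rcases hi with ⟨h, -⟩ | ⟨h, -⟩ | ⟨-, -, h⟩
      exacts [absurd h (by decide), absurd h (by decide), h hxb]
    · refine lowerSet_le_iff.2 ?_
      rintro ⟨x, i, hi⟩ (hxb : x ∈ b₂)
      refine ⟨hb₂ hxb, ?_⟩
      rintro (rfl : i = 1)
      rcases hi with ⟨h, -⟩ | ⟨-, -, h⟩ | ⟨h, -⟩
      exacts [absurd h (by decide), h hxb, absurd h (by decide)]
    · exact hdiff 2 1 (by decide) (by decide) (by decide) fun x h1 _ h3 =>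
          Or.inr (Or.inl ⟨rfl, h1, h3⟩)
    · exact hdiff 1 2 (by decide) (by decide) (by decide) fun x h1 h2 _ =>
          Or.inr (Or.inr ⟨rfl, h1, h2⟩)
    · ext ⟨x, i, hi⟩
      change (x ∈ a ∧ i ≠ 2) ∧ (x ∈ a ∧ i ≠ 1) ↔ x ∈ b₁ ∧ x ∈ b₂
      rcases hi with ⟨rfl, hi⟩ | ⟨rfl, -, hi⟩ | ⟨rfl, -, hi⟩
      · constructor
        · rintro ⟨⟨h, -⟩, -⟩
          exact hi.resolve_left (not_not.2 h)
        · exact fun h => ⟨⟨hb₁ h.1, by decide⟩, hb₁ h.1, by decide⟩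
      · exact iff_of_false (fun h => h.2.2 rfl) (fun h => hi h.2)
      · exact iff_of_false (fun h => h.1.2 rfl) (fun h => hi h.1)

end Solve

/-! ### Super scaled lattices as direct limits of finite lattices. -/

section Existence

theorem Problem.map_map {d : ℕ} {M N P : Type*} (g : M → N) (f : N → P) (x : Problem d M) :
    (x.map g).map f = x.map (f ∘ g) := by
  rcases x with ⟨i, j, a⟩ | ⟨r, q, p, c, a⟩ | ⟨b₁, b₂, a⟩ <;> rfl

/-- Finite `d`-subscaled lattices. -/
structure FiniteSubscaled (d : ℕ) where
  carrier : Type u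
  [str : (lang d).Structure carrier]
  [fin : Finite carrier]
  isSubscaled : IsSubscaled d carrier

attribute [instance] FiniteSubscaled.str FiniteSubscaled.fin

variable {d : ℕ}

theorem FiniteSubscaled.exists_solution (M : FiniteSubscaled.{u} d) (x : Problem d M.carrier) :
    ∃ (N : FiniteSubscaled.{u} d) (g : M.carrier ↪[lang d] N.carrier), (x.map g).Solved := by
  let := M.isSubscaled.gradedSpec
  have : Finite (Spec d M.carrier) :=
    inferInstanceAs (Finite {F : Set M.carrier // IsPrimeFilter d F})
  obtain ⟨K, _, _, _, g, hg⟩ := exists_solution_lowerSet (x.map M.isSubscaled.repr)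
  have : Finite (LowerSet K) := Finite.of_injective _ (SetLike.coe_injective (A := LowerSet K))
  refine ⟨⟨LowerSet K, isSubscaled_lowerSet d K⟩, g.comp M.isSubscaled.repr, ?_⟩
  rwa [Problem.map_map] at hg

theorem FiniteSubscaled.exists_solutions (M : FiniteSubscaled.{u} d) :
    ∃ (N : FiniteSubscaled.{u} d) (g : M.carrier ↪[lang d] N.carrier),
      ∀ x : Problem d M.carrier, (x.map g).Solved := by
  classical
  have := Fintype.ofFinite (Problem d M.carrier)
  suffices h : ∀ s : Finset (Problem d M.carrier), ∃ (N : FiniteSubscaled.{u} d)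
      (g : M.carrier ↪[lang d] N.carrier), ∀ x ∈ s, (x.map g).Solved by
    obtain ⟨N, g, hg⟩ := h Finset.univ
    exact ⟨N, g, fun x => hg x (Finset.mem_univ x)⟩
  intro s
  induction s using Finset.induction_on with
  | empty => exact ⟨M, Embedding.refl _ _, by simp⟩
  | insert x s hx ih =>
    obtain ⟨N, g, hg⟩ := ih
    obtain ⟨N', g', hg'⟩ := N.exists_solution (x.map g)
    refine ⟨N', g'.comp g, fun y hy => ?_⟩
    rcases Finset.mem_insert.1 hy with rfl | hy
    · rwa [Problem.map_map] at hg'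
    · have := (hg y hy).map g'
      rwa [Problem.map_map] at this

/-- A chain of finite `d`-subscaled lattices, each of which solves the problems of the previous
one. -/
noncomputable def chain (M : FiniteSubscaled.{u} d) : ℕ → FiniteSubscaled.{u} d
  | 0 => M
  | n + 1 => (chain M n).exists_solutions.choose

/-- The embeddings of the chain. -/
noncomputable def chainMap (M : FiniteSubscaled.{u} d) (n : ℕ) :
    (chain M n).carrier ↪[lang d] (chain M (n + 1)).carrier :=
  (chain M n).exists_solutions.choose_spec.choose

theorem chainMap_solved (M : FiniteSubscaled.{u} d) (n : ℕ) (x : Problem d (chain M n).carrier) :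
    (x.map (chainMap M n)).Solved :=
  (chain M n).exists_solutions.choose_spec.choose_spec x

/-- Every finite `d`-subscaled lattice embeds in a super `d`-scaled lattice. -/
theorem FiniteSubscaled.exists_super (M : FiniteSubscaled.{u} d) :
    ∃ (N : Type u) (_ : (lang d).Structure N), IsSuperElementary d N ∧
      Nonempty (M.carrier ↪[lang d] N) := by
  let G : ℕ → Type u := fun n => (chain M n).carrier
  let f := DirectedSystem.natLERec (G' := G) (L := lang d) (chainMap M)
  let N := Language.DirectLimit G f
  let of : ∀ n, G n ↪[lang d] N := fun n => Language.DirectLimit.of (lang d) ℕ G f n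
  have hof : ∀ {m n : ℕ} (h : m ≤ n) (a : G m), of n (f m n h a) = of m a := fun h a =>
    Language.DirectLimit.of_f
  have hex : ∀ a : N, ∃ n, ∀ m, n ≤ m → ∃ b : G m, of m b = a := fun a => by
    obtain ⟨n, b, hb⟩ := Language.DirectLimit.exists_of a
    exact ⟨n, fun m hm => ⟨f n m hm b, (hof hm b).trans hb⟩⟩
  -- The axioms are universal in three variables, and any three elements come from a common stage.
  have hsub : IsSubscaled d N := isSubscaled_iff.2 fun a b c => by
    obtain ⟨i, hi⟩ := hex a
    obtain ⟨j, hj⟩ := hex b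
    obtain ⟨k, hk⟩ := hex c
    let n := max i (max j k)
    obtain ⟨a, rfl⟩ := hi n (by omega)
    obtain ⟨b, rfl⟩ := hj n (by omega)
    obtain ⟨c, rfl⟩ := hk n (by omega)
    exact (axiomsAt_map (of n) a b c).2 (isSubscaled_iff.1 (chain M n).isSubscaled a b c)
  -- An instance over stage `n` is solved at stage `n + 1`, and so in the limit.
  have hmap : ∀ n (x : Problem d (G n)), (x.map (of n)).Solved := fun n x => by
    have h1 := (chainMap_solved M n x).map (of (n + 1))
    rw [Problem.map_map] at h1
    have h2 : of (n + 1) ∘ chainMap M n = of n := by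
      funext a
      have h3 := hof (Nat.le_succ n) a
      have h4 : f n (n + 1) (Nat.le_succ n) a = chainMap M n a := by
        have := congrFun (DirectedSystem.coe_natLERec (chainMap M) n (n + 1) (Nat.le_succ n)) a
        rw [Nat.leRecOn_succ'] at this
        exact this
      exact (congrArg _ h4.symm).trans h3
    rwa [h2] at h1
  refine ⟨N, inferInstance, isSuperElementary_of_solved hsub fun x => ?_, ⟨of 0⟩⟩
  suffices h : ∃ n, ∃ y : Problem d (G n), y.map (of n) = x by
    obtain ⟨n, y, rfl⟩ := h
    exact hmap n y
  rcases x with ⟨i, j, a⟩ | ⟨r, q, p, c, a⟩ | ⟨b₁, b₂, a⟩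
  · obtain ⟨n, hn⟩ := hex a
    obtain ⟨a, rfl⟩ := hn n le_rfl
    exact ⟨n, .inl (i, j, a), rfl⟩
  · obtain ⟨i, hi⟩ := hex c
    obtain ⟨j, hj⟩ := hex a
    obtain ⟨c, rfl⟩ := hi (max i j) (by omega)
    obtain ⟨a, rfl⟩ := hj (max i j) (by omega)
    exact ⟨_, .inr (.inl (r, q, p, c, a)), rfl⟩
  · obtain ⟨i, hi⟩ := hex b₁
    obtain ⟨j, hj⟩ := hex b₂
    obtain ⟨k, hk⟩ := hex a
    obtain ⟨b₁, rfl⟩ := hi (max i (max j k)) (by omega)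
    obtain ⟨b₂, rfl⟩ := hj (max i (max j k)) (by omega)
    obtain ⟨a, rfl⟩ := hk (max i (max j k)) (by omega)
    exact ⟨_, .inr (.inr (b₁, b₂, a)), rfl⟩

end Existence

/-! ### First-order definability of the classes involved. -/

section Definability

variable {d : ℕ}

/-- Properties of `n`-tuples in `lang d`-structures. -/
abbrev TupleProp (d n : ℕ) : Type (v + 1) :=
  ∀ (M : Type v) [(lang d).Structure M], (Fin n → M) → Prop

/-- Operations on `n`-tuples in `lang d`-structures. -/
abbrev TupleOp (d n : ℕ) : Type (v + 1) :=
  ∀ (M : Type v) [(lang d).Structure M], (Fin n → M) → M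

/-- A property of tuples which is uniformly defined by a first-order formula. -/
def IsDef (d : ℕ) {n : ℕ} (P : TupleProp.{v} d n) : Prop :=
  ∃ φ : (lang d).BoundedFormula Empty n, ∀ (M : Type v) [(lang d).Structure M] (xs : Fin n → M),
    φ.Realize default xs ↔ P M xs

/-- An operation on tuples which is uniformly given by a term. -/
def IsTerm (d : ℕ) {n : ℕ} (t : TupleOp.{v} d n) : Prop :=
  ∃ s : (lang d).Term (Empty ⊕ Fin n), ∀ (M : Type v) [(lang d).Structure M] (xs : Fin n → M),
    s.realize (Sum.elim default xs) = t M xs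

variable {n : ℕ} {P Q : TupleProp.{v} d n} {s t : TupleOp.{v} d n}

theorem IsTerm.var (i : Fin n) : IsTerm d (n := n) fun _ _ xs => xs i :=
  ⟨.var (.inr i), fun _ _ _ => rfl⟩

theorem IsTerm.bot : IsTerm d (n := n) fun M _ _ => bot d (M := M) :=
  ⟨.func Fn.zero ![], fun M _ _ =>
    congrArg (Structure.funMap (L := lang d) (M := M) Fn.zero) (Subsingleton.elim _ _)⟩

theorem IsTerm.top : IsTerm d (n := n) fun M _ _ => top d (M := M) :=
  ⟨.func Fn.one ![], fun M _ _ =>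
    congrArg (Structure.funMap (L := lang d) (M := M) Fn.one) (Subsingleton.elim _ _)⟩

theorem IsTerm.comp (i : Fin (d + 1)) (ht : IsTerm d t) :
    IsTerm d fun M _ xs => comp d i (t M xs) := by
  obtain ⟨t', ht⟩ := ht
  refine ⟨.func (Fn.comp i) ![t'], fun M _ xs =>
    congrArg (Structure.funMap (L := lang d) (Fn.comp i)) (funext fun j => ?_)⟩
  fin_cases j
  exact ht M xs

theorem IsTerm.binary (f : Fn d 2) (hs : IsTerm d s) (ht : IsTerm d t) :
    IsTerm d fun M _ xs => Structure.funMap (L := lang d) f ![s M xs, t M xs] := by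
  obtain ⟨s', hs⟩ := hs
  obtain ⟨t', ht⟩ := ht
  refine ⟨.func f ![s', t'], fun M _ xs =>
    congrArg (Structure.funMap (L := lang d) f) (funext fun j => ?_)⟩
  fin_cases j
  exacts [hs M xs, ht M xs]

theorem IsTerm.join (hs : IsTerm d s) (ht : IsTerm d t) :
    IsTerm d fun M _ xs => join d (s M xs) (t M xs) := hs.binary Fn.join ht

theorem IsTerm.meet (hs : IsTerm d s) (ht : IsTerm d t) :
    IsTerm d fun M _ xs => meet d (s M xs) (t M xs) := hs.binary Fn.meet ht

theorem IsTerm.diff (hs : IsTerm d s) (ht : IsTerm d t) :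
    IsTerm d fun M _ xs => diff d (s M xs) (t M xs) := hs.binary Fn.diff ht

theorem IsTerm.joinComp (I : Finset (Fin (d + 1))) (ht : IsTerm d t) :
    IsTerm d fun M _ xs => joinComp d I (t M xs) := by
  unfold ScaledLattice.joinComp
  induction (List.finRange (d + 1)).filter (fun i => decide (i ∈ I)) with
  | nil => exact IsTerm.bot
  | cons i l ih => exact (ht.comp i).join ih

theorem IsDef.eq (hs : IsTerm d s) (ht : IsTerm d t) : IsDef d fun M _ xs => s M xs = t M xs := by
  obtain ⟨s', hs⟩ := hs
  obtain ⟨t', ht⟩ := ht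
  exact ⟨s'.bdEqual t', fun M _ xs => by rw [BoundedFormula.realize_bdEqual, hs, ht]⟩

theorem IsDef.const (p : Prop) : IsDef d (n := n) fun _ _ _ => p := by
  by_cases h : p
  · exact ⟨⊤, fun M _ xs => by simp [h]⟩
  · exact ⟨⊥, fun M _ xs => by simp [h]⟩

theorem IsDef.imp (hP : IsDef d P) (hQ : IsDef d Q) : IsDef d fun M _ xs => P M xs → Q M xs := by
  obtain ⟨φ, hP⟩ := hP
  obtain ⟨ψ, hQ⟩ := hQ
  exact ⟨φ.imp ψ, fun M _ xs => by rw [BoundedFormula.realize_imp, hP, hQ]⟩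

theorem IsDef.and (hP : IsDef d P) (hQ : IsDef d Q) : IsDef d fun M _ xs => P M xs ∧ Q M xs := by
  obtain ⟨φ, hP⟩ := hP
  obtain ⟨ψ, hQ⟩ := hQ
  exact ⟨φ ⊓ ψ, fun M _ xs => by rw [BoundedFormula.realize_inf, hP, hQ]⟩

theorem IsDef.not (hP : IsDef d P) : IsDef d fun M _ xs => ¬ P M xs :=
  hP.imp (IsDef.const False)

theorem IsDef.ne (hs : IsTerm d s) (ht : IsTerm d t) : IsDef d fun M _ xs => s M xs ≠ t M xs :=
  (IsDef.eq hs ht).not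

theorem IsDef.le (hs : IsTerm d s) (ht : IsTerm d t) : IsDef d fun M _ xs =>
    le d (s M xs) (t M xs) :=
  IsDef.eq (hs.join ht) ht

theorem IsDef.forall_finite {ι : Type*} [Finite ι] {R : ι → TupleProp.{v} d n}
    (hR : ∀ i, IsDef d (R i)) : IsDef d fun M _ xs => ∀ i, R i M xs := by
  choose φ hφ using hR
  exact ⟨BoundedFormula.iInf φ, fun M _ xs => by simp only [BoundedFormula.realize_iInf, hφ]⟩

theorem IsDef.exists_finite {ι : Type*} [Finite ι] {R : ι → TupleProp.{v} d n}
    (hR : ∀ i, IsDef d (R i)) : IsDef d fun M _ xs => ∃ i, R i M xs := by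
  choose φ hφ using hR
  exact ⟨BoundedFormula.iSup φ, fun M _ xs => by simp only [BoundedFormula.realize_iSup, hφ]⟩

theorem IsDef.all {R : ∀ (M : Type v) [(lang d).Structure M], (Fin n → M) → M → Prop}
    (hR : IsDef d (n := n + 1) fun M _ xs => R M (Fin.init xs) (xs (Fin.last n))) :
    IsDef d fun M _ xs => ∀ a, R M xs a := by
  obtain ⟨φ, hφ⟩ := hR
  refine ⟨φ.all, fun M _ xs => ?_⟩
  simp only [BoundedFormula.realize_all, hφ, Fin.init_snoc, Fin.snoc_last]

theorem IsDef.ex {R : ∀ (M : Type v) [(lang d).Structure M], (Fin n → M) → M → Prop}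
    (hR : IsDef d (n := n + 1) fun M _ xs => R M (Fin.init xs) (xs (Fin.last n))) :
    IsDef d fun M _ xs => ∃ a, R M xs a := by
  obtain ⟨φ, hφ⟩ := hR
  refine ⟨φ.ex, fun M _ xs => ?_⟩
  simp only [BoundedFormula.realize_ex, hφ, Fin.init_snoc, Fin.snoc_last]

theorem IsDef.of_iff (hP : IsDef d P) (h : ∀ (M : Type v) [(lang d).Structure M] xs,
    Q M xs ↔ P M xs) : IsDef d Q := by
  obtain ⟨φ, hφ⟩ := hP
  exact ⟨φ, fun M _ xs => (hφ M xs).trans (h M xs).symm⟩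

theorem IsDef.low (m : ℕ) (ht : IsTerm d t) : IsDef d fun M _ xs => Low d m (t M xs) :=
  IsDef.eq (ht.joinComp _) ht

theorem IsDef.scdim_lt (m : ℕ) (ht : IsTerm d t) :
    IsDef d fun M _ xs => scdim d (t M xs) < (m : WithBot ℕ∞) := by
  refine (IsDef.exists_finite (ι := Fin (d + 2)) fun i =>
    (IsDef.const ((i : ℕ) ≤ m)).and (IsDef.low i ht)).of_iff fun M _ xs => ?_
  rw [scdim_lt_iff_exists]
  exact ⟨fun ⟨i, h1, h2, h3⟩ => ⟨⟨i, by omega⟩, h1, h3⟩, fun ⟨i, h1, h3⟩ => ⟨i, h1, by omega, h3⟩⟩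

theorem IsDef.scdim_le (m : ℕ) (ht : IsTerm d t) :
    IsDef d fun M _ xs => scdim d (t M xs) ≤ (m : WithBot ℕ∞) :=
  (IsDef.scdim_lt (m + 1) ht).of_iff fun _ _ _ => scdim_le_iff_lt _ _

/-- Values other than `∞` are at most `d`, so a threshold `m ≤ d + 1` always separates; comparing
sc-dimensions is thus a finite disjunction. -/
theorem scdim_lt_scdim_iff {M : Type u} [(lang d).Structure M] {a b : M} :
    scdim d b < scdim d a ↔ ∃ m : Fin (d + 2), scdim d b < ((m : ℕ) : WithBot ℕ∞) ∧
      ¬ scdim d a < ((m : ℕ) : WithBot ℕ∞) := by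
  refine ⟨fun h => ?_, fun ⟨m, h1, h2⟩ => h1.trans_le (not_lt.1 h2)⟩
  have h1 : ∃ m, scdim d b < ((m : ℕ) : WithBot ℕ∞) := by
    cases h2 : scdim d b with
    | bot => exact ⟨0, by exact_mod_cast WithBot.bot_lt_coe (0 : ℕ∞)⟩
    | coe l =>
      rw [h2] at h
      have h3 : l ≠ ⊤ := by
        rintro rfl
        exact not_top_lt h
      obtain ⟨k, rfl⟩ := ENat.ne_top_iff_exists.1 h3
      exact ⟨k + 1, by exact_mod_cast Nat.lt_succ_self k⟩
  classical
  obtain ⟨k, hk1, hk2, hk3⟩ := (scdim_lt_iff_exists _ _).1 (Nat.find_spec h1)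
  have hk4 : scdim d b < (k : WithBot ℕ∞) := (scdim_lt_iff_exists _ _).2 ⟨k, le_rfl, hk2, hk3⟩
  refine ⟨⟨k, by omega⟩, hk4, fun h2 => ?_⟩
  obtain ⟨m, hm1, hm2, hm3⟩ := (scdim_lt_iff_exists _ _).1 h2
  have hm4 : scdim d a < (m : WithBot ℕ∞) := (scdim_lt_iff_exists _ _).2 ⟨m, le_rfl, hm2, hm3⟩
  cases m with
  | zero =>
    have : scdim d b < (0 : ℕ) := h.trans hm4
    have h5 := Nat.find_min' h1 this
    have h6 : scdim d a = ⊥ := by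
      cases h7 : scdim d a with
      | bot => rfl
      | coe l =>
        rw [h7] at hm4
        have : l < (0 : ℕ) := by exact_mod_cast hm4
        simp at this
    rw [h6] at h
    exact not_lt_bot h
  | succ m =>
    have := Nat.find_min' h1 (h.trans_le ((scdim_le_iff_lt m a).2 hm4))
    change m + 1 ≤ k at hm1
    omega

theorem IsDef.scdim_lt_scdim (hs : IsTerm d s) (ht : IsTerm d t) :
    IsDef d fun M _ xs => scdim d (s M xs) < scdim d (t M xs) :=
  (IsDef.exists_finite (ι := Fin (d + 2)) fun i =>
    (IsDef.scdim_lt i hs).and (IsDef.scdim_lt i ht).not).of_iff fun _ _ _ => scdim_lt_scdim_iff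

theorem IsDef.alls {P : TupleProp.{v} d n} (hP : IsDef d P) :
    IsDef d (n := 0) fun M _ _ => ∀ xs, P M xs := by
  obtain ⟨φ, hφ⟩ := hP
  refine ⟨φ.alls, fun M _ xs => ?_⟩
  obtain rfl : xs = default := Subsingleton.elim _ _
  exact BoundedFormula.realize_alls.trans (forall_congr' fun xs => hφ M xs)

theorem IsDef.exs {P : TupleProp.{v} d n} (hP : IsDef d P) :
    IsDef d (n := 0) fun M _ _ => ∃ xs, P M xs := by
  obtain ⟨φ, hφ⟩ := hP
  refine ⟨φ.exs, fun M _ xs => ?_⟩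
  obtain rfl : xs = default := Subsingleton.elim _ _
  exact BoundedFormula.realize_exs.trans (exists_congr fun xs => hφ M xs)

theorem IsDef.axiomsAt {r s t : TupleOp.{v} d n} (ha : IsTerm d r) (hb : IsTerm d s)
    (hc : IsTerm d t) : IsDef d fun M _ xs => AxiomsAt d (r M xs) (s M xs) (t M xs) := by
  refine ((IsDef.eq (ha.join hb) (hb.join ha)).and <|
    (IsDef.eq (ha.meet hb) (hb.meet ha)).and <|
    (IsDef.eq ((ha.join hb).join hc) (ha.join (hb.join hc))).and <|
    (IsDef.eq ((ha.meet hb).meet hc) (ha.meet (hb.meet hc))).and <|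
    (IsDef.eq (ha.join (ha.meet hb)) ha).and <| (IsDef.eq (ha.meet (ha.join hb)) ha).and <|
    (IsDef.le .bot ha).and <| (IsDef.le ha .top).and <|
    (IsDef.le ha (hb.join (ha.diff hb))).and <|
    ((IsDef.le ha (hb.join hc)).imp (IsDef.le (ha.diff hb) hc)).and <|
    (IsDef.eq (ha.joinComp Finset.univ) ha).and <|
    (IsDef.forall_finite fun I : Finset (Fin (d + 1)) => IsDef.forall_finite
      fun k : Fin (d + 1) =>
      ((IsDef.const (k ∉ I)).imp (IsDef.eq ((ha.joinComp I).comp k) .bot)).and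
        ((IsDef.const (k ∈ I)).imp (IsDef.eq ((ha.joinComp I).comp k) (ha.comp k)))).and <|
    (IsDef.forall_finite fun k : Fin (d + 1) =>
      ((IsDef.scdim_le k ha).and (IsDef.scdim_le k hb)).imp
        (IsDef.eq ((ha.join hb).comp k) ((ha.comp k).join (hb.comp k)))).and <|
    (IsDef.forall_finite fun i : Fin (d + 1) => IsDef.forall_finite fun j : Fin (d + 1) =>
      (IsDef.const (i ≠ j)).imp (IsDef.scdim_lt (min i j : ℕ) ((ha.comp i).meet (ha.comp j)))).and
      <|
    (IsDef.forall_finite fun k : Fin (d + 1) => (IsDef.scdim_le k hb).imp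
      (IsDef.eq ((ha.comp k).diff hb) ((ha.comp k).diff (hb.comp k)))).and
    ((IsDef.le hb ha).imp <| (IsDef.eq (ha.diff hb) ha).imp <| (IsDef.ne ha .bot).imp <|
      IsDef.scdim_lt_scdim hb ha)).of_iff fun M _ xs => ⟨?_, ?_⟩
  · rintro ⟨h1, h2, h3, h4, h5, h6, h7, h8, h9, h10, h11, h12, h13, h14, h15, h16⟩
    exact ⟨h1, h2, h3, h4, h5, h6, h7, h8, h9, h10, h11, h12,
      fun k hk => h13 k (max_le hk.1 hk.2), h14, h15, h16⟩
  · rintro ⟨h1, h2, h3, h4, h5, h6, h7, h8, h9, h10, h11, h12, h13, h14, h15, h16⟩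
    exact ⟨h1, h2, h3, h4, h5, h6, h7, h8, h9, h10, h11, h12,
      fun k hk => h13 k (max_le_iff.1 hk), h14, h15, h16⟩

variable (d)

theorem IsDef.isSubscaled : IsDef.{v} d (n := 0) fun M _ _ => IsSubscaled d M :=
  (IsDef.axiomsAt (.var (0 : Fin 3)) (.var 1) (.var 2)).alls.of_iff fun _ _ _ =>
    isSubscaled_iff.trans ⟨fun h _ => h _ _ _, fun h a b c => h ![a, b, c]⟩

theorem IsDef.descending : IsDef.{v} d (n := 0) fun M _ _ => Descending d M := by
  refine (IsDef.forall_finite fun i : Fin (d + 1) => IsDef.forall_finite fun j : Fin (d + 1) =>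
    (IsDef.const ((j : ℕ) = i + 1)).imp <| IsDef.all <| ?_)
  exact (IsDef.ne (IsTerm.comp j (.var 0)) .bot).imp <| IsDef.ex <|
    (IsDef.le (.var 1) (IsTerm.comp j (.var 0))).and (IsDef.ne (IsTerm.comp i (.var 1)) .bot)

theorem IsDef.catenary : IsDef.{v} d (n := 0) fun M _ _ =>
    ∀ r q p : Fin (d + 1), r ≤ q → q ≤ p → ∀ c a : M, ScaledLattice.le d c a →
    comp d p a = a → a ≠ ScaledLattice.bot d → comp d r c = c → c ≠ ScaledLattice.bot d →
    ∃ b : M, comp d q b = b ∧ ScaledLattice.le d c b ∧ ScaledLattice.le d b a :=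
  IsDef.forall_finite fun r => IsDef.forall_finite fun q => IsDef.forall_finite fun p =>
    (IsDef.const _).imp <| (IsDef.const _).imp <| IsDef.all <| IsDef.all <|
    (IsDef.le (.var 0) (.var 1)).imp <| (IsDef.eq (IsTerm.comp p (.var 1)) (.var 1)).imp <|
    (IsDef.ne (.var 1) .bot).imp <| (IsDef.eq (IsTerm.comp r (.var 0)) (.var 0)).imp <|
    (IsDef.ne (.var 0) .bot).imp <| IsDef.ex <|
    (IsDef.eq (IsTerm.comp q (.var 2)) (.var 2)).and <| (IsDef.le (.var 0) (.var 2)).and <|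
    IsDef.le (.var 2) (.var 1)

theorem IsDef.split : IsDef.{v} d (n := 0) fun M _ _ =>
    ∀ b₁ b₂ a : M, ScaledLattice.le d (ScaledLattice.join d b₁ b₂) a →
    ScaledLattice.diff d a (ScaledLattice.join d b₁ b₂) = a → a ≠ ScaledLattice.bot d →
    ∃ a₁ a₂ : M, a₁ ≠ ScaledLattice.bot d ∧ a₂ ≠ ScaledLattice.bot d ∧ ScaledLattice.le d b₁ a₁ ∧
        ScaledLattice.le d b₂ a₂ ∧
      a₁ = ScaledLattice.diff d a a₂ ∧ a₂ = ScaledLattice.diff d a a₁ ∧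
      ScaledLattice.meet d a₁ a₂ = ScaledLattice.meet d b₁ b₂ :=
  IsDef.all <| IsDef.all <| IsDef.all <|
    (IsDef.le (IsTerm.join (.var 0) (.var 1)) (.var 2)).imp <|
    (IsDef.eq (IsTerm.diff (.var 2) (IsTerm.join (.var 0) (.var 1))) (.var 2)).imp <|
    (IsDef.ne (.var 2) .bot).imp <| IsDef.ex <| IsDef.ex <|
    (IsDef.ne (.var 3) .bot).and <| (IsDef.ne (.var 4) .bot).and <|
    (IsDef.le (.var 0) (.var 3)).and <| (IsDef.le (.var 1) (.var 4)).and <|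
    (IsDef.eq (.var 3) (IsTerm.diff (.var 2) (.var 4))).and <|
    (IsDef.eq (.var 4) (IsTerm.diff (.var 2) (.var 3))).and <|
    IsDef.eq (IsTerm.meet (.var 3) (.var 4)) (IsTerm.meet (.var 0) (.var 1))

theorem IsDef.isSuperScaled : IsDef.{v} d (n := 0) fun M _ _ => IsSuperScaled d M :=
  ((IsDef.isSubscaled d).and <| (IsDef.descending d).and <| (IsDef.catenary d).and
    (IsDef.split d)).of_iff fun _ _ _ => isSuperScaled_iff.trans
    ⟨fun h => ⟨h.1, h.2, h.3, h.4⟩, fun h => ⟨h.1, h.2.1, h.2.2.1, h.2.2.2⟩⟩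

variable {d}

/-- The formula is the diagram of `L₀`, with one variable for each element, quantified
existentially. -/
theorem IsDef.nonempty_embedding (L₀ : Type u) [(lang d).Structure L₀] [Finite L₀] :
    IsDef.{v} d (n := 0) fun M _ _ => Nonempty (L₀ ↪[lang d] M) := by
  obtain ⟨k, ⟨e⟩⟩ := Finite.exists_equiv_fin L₀
  have hv : ∀ a : L₀, IsTerm.{v} d fun M _ xs => xs (e a) := fun a => .var _
  refine ((IsDef.forall_finite fun i => IsDef.forall_finite fun j =>
      (IsDef.eq (hv i) (hv j)).imp (IsDef.const (i = j))).and <|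
    (IsDef.eq (hv (ScaledLattice.bot d)) .bot).and <|
    (IsDef.eq (hv (ScaledLattice.top d)) .top).and <|
    (IsDef.forall_finite fun i => IsDef.forall_finite fun j =>
      IsDef.eq (hv (ScaledLattice.join d i j)) ((hv i).join (hv j))).and <|
    (IsDef.forall_finite fun i => IsDef.forall_finite fun j =>
      IsDef.eq (hv (ScaledLattice.meet d i j)) ((hv i).meet (hv j))).and <|
    (IsDef.forall_finite fun i => IsDef.forall_finite fun j =>
      IsDef.eq (hv (ScaledLattice.diff d i j)) ((hv i).diff (hv j))).and <|
    IsDef.forall_finite fun l => IsDef.forall_finite fun i =>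
      IsDef.eq (hv (ScaledLattice.comp d l i)) ((hv i).comp l)).exs.of_iff fun M _ _ => ⟨?_, ?_⟩
  · rintro ⟨g⟩
    refine ⟨g ∘ e.symm, ?_⟩
    simp only [Function.comp, Equiv.symm_apply_apply]
    exact ⟨fun i j h => g.injective h, map_bot g, map_top g, map_join g, map_meet g, map_diff g,
      map_comp g⟩
  · rintro ⟨xs, h1, h2, h3, h4, h5, h6, h7⟩
    exact ⟨mkEmbedding (xs ∘ e) (fun i j => h1 i j) h2 h3 h4 h5 h6 h7⟩

theorem IsDef.exists_sentence {P : TupleProp.{v} d 0} (hP : IsDef d P) :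
    ∃ φ : (lang d).Sentence, ∀ (M : Type v) [(lang d).Structure M], M ⊨ φ ↔ P M default := by
  obtain ⟨φ, hφ⟩ := hP
  exact ⟨φ, fun M _ => hφ M default⟩

end Definability

/-! ### Recursive enumerability of propositional unsatisfiability. -/

section Clauses

variable {α β : Type} [Primcodable α] [Primcodable β]

/-- Families of properties of propositional valuations which are given by primitive recursive
enumerations of clauses. -/
def IsClausal (P : α → (ℕ → Bool) → Prop) : Prop :=
  ∃ cl : α → ℕ → List (ℕ × Bool), Primrec₂ cl ∧ ∀ a v, P a v ↔ ∀ t, ∃ l ∈ cl a t, v l.1 = l.2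

variable {P Q : α → (ℕ → Bool) → Prop}

theorem IsClausal.of_iff (hP : IsClausal P) (h : ∀ a v, Q a v ↔ P a v) : IsClausal Q := by
  obtain ⟨cl, h1, h2⟩ := hP
  exact ⟨cl, h1, fun a v => (h a v).trans (h2 a v)⟩

theorem IsClausal.clause {f : α → List (ℕ × Bool)} (hf : Primrec f) :
    IsClausal fun a v => ∃ l ∈ f a, v l.1 = l.2 :=
  ⟨fun a _ => f a, hf.comp Primrec.fst, fun _ _ => ⟨fun h _ => h, fun h => h 0⟩⟩

theorem IsClausal.clause₁ {f : α → ℕ} {s : Bool} (hf : Primrec f) :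
    IsClausal fun a v => v (f a) = s :=
  (IsClausal.clause (f := fun a => [(f a, s)]) (Primrec.list_cons.comp
    (hf.pair (.const s)) (.const []))).of_iff fun _ _ => by simp

theorem IsClausal.clause₂ {f g : α → ℕ} {s t : Bool} (hf : Primrec f) (hg : Primrec g) :
    IsClausal fun a v => v (f a) = s ∨ v (g a) = t :=
  (IsClausal.clause (f := fun a => [(f a, s), (g a, t)]) (Primrec.list_cons.comp
    (hf.pair (.const s)) (Primrec.list_cons.comp (hg.pair (.const t)) (.const [])))).of_iff
    fun _ _ => by simp

theorem IsClausal.clause₃ {f g h : α → ℕ} {s t r : Bool} (hf : Primrec f) (hg : Primrec g)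
    (hh : Primrec h) : IsClausal fun a v => v (f a) = s ∨ v (g a) = t ∨ v (h a) = r :=
  (IsClausal.clause (f := fun a => [(f a, s), (g a, t), (h a, r)]) (Primrec.list_cons.comp
    (hf.pair (.const s)) (Primrec.list_cons.comp (hg.pair (.const t))
    (Primrec.list_cons.comp (hh.pair (.const r)) (.const []))))).of_iff
    fun _ _ => by simp

theorem IsClausal.and (hP : IsClausal P) (hQ : IsClausal Q) :
    IsClausal fun a v => P a v ∧ Q a v := by
  obtain ⟨cl, h1, h2⟩ := hP
  obtain ⟨cl', h3, h4⟩ := hQ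
  -- The two enumerations are interleaved according to the parity of `t`.
  refine ⟨fun a t => bif t.bodd then cl a t.div2 else cl' a t.div2,
    Primrec.cond (Primrec.nat_bodd.comp Primrec.snd)
      (h1.comp Primrec.fst (Primrec.nat_div2.comp Primrec.snd))
      (h3.comp Primrec.fst (Primrec.nat_div2.comp Primrec.snd)), fun a v => ?_⟩
  simp only [h2, h4]
  constructor
  · rintro ⟨h5, h6⟩ t
    cases h : t.bodd
    · exact h6 _
    · exact h5 _
  · intro h
    refine ⟨fun t => ?_, fun t => ?_⟩
    · simpa using h (Nat.bit true t)
    · simpa using h (Nat.bit false t)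

theorem IsClausal.all {γ : Type} [Denumerable γ] {P : α → γ → (ℕ → Bool) → Prop}
    (hP : IsClausal fun (p : α × γ) v => P p.1 p.2 v) : IsClausal fun a v => ∀ c, P a c v := by
  obtain ⟨cl, h1, h2⟩ := hP
  refine ⟨fun a t => cl (a, Denumerable.ofNat γ t.unpair.1) t.unpair.2,
    h1.comp (Primrec.fst.pair ((Primrec.ofNat γ).comp
      (Primrec.fst.comp (Primrec.unpair.comp Primrec.snd))))
      (Primrec.snd.comp (Primrec.unpair.comp Primrec.snd)), fun a v => ?_⟩
  constructor
  · intro h t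
    exact (h2 (a, _) v).1 (h _) _
  · intro h c
    refine (h2 (a, c) v).2 fun t => ?_
    simpa using h (Nat.pair (Encodable.encode c) t)

theorem IsClausal.const {p : α → Prop} (hp : PrimrecPred p) : IsClausal fun a _ => p a := by
  classical
  -- A tautological clause stands for truth, the empty clause for falsity.
  refine (IsClausal.clause (f := fun a => if p a then [(0, true), (0, false)] else [])
    (Primrec.ite hp (.const _) (.const _))).of_iff fun a v => ?_
  by_cases h : p a <;> simp [h]

theorem IsClausal.imp {p : α → Prop} (hp : PrimrecPred p) (hP : IsClausal P) :
    IsClausal fun a v => p a → P a v := by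
  classical
  obtain ⟨cl, h1, h2⟩ := hP
  refine ⟨fun a t => if p a then cl a t else [(0, true), (0, false)],
    Primrec.ite (hp.comp Primrec.fst) h1 (.const _), fun a v => ?_⟩
  by_cases h : p a <;> simp [h, h2]

/-- A set of clauses is unsatisfiable as soon as every assignment to some first atoms falsifies
one of its first clauses. -/
theorem not_exists_valuation_iff (cl : ℕ → List (ℕ × Bool)) :
    (¬ ∃ v : ℕ → Bool, ∀ t, ∃ l ∈ cl t, v l.1 = l.2) ↔
      ∃ N, ∀ x < 2 ^ N, ∃ t < N, ∀ l ∈ cl t, l.1 < N ∧ x.testBit l.1 ≠ l.2 := by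
  constructor
  · intro h
    by_contra! hc
    choose x hx h1 using hc
    -- Propositional compactness: finite assignments `x N` that falsify none of the first `N`
    -- clauses within the first `N` atoms converge along a nonprincipal ultrafilter to a valuation
    -- satisfying every clause.
    let U : Ultrafilter ℕ := Filter.hyperfilter ℕ
    classical
    let v : ℕ → Bool := fun i => decide (∀ᶠ N in U, (x N).testBit i = true)
    have hv : ∀ i b, v i ≠ b → ∀ᶠ N in U, (x N).testBit i ≠ b := by
      intro i b hb
      cases b with
      | true =>
        have h2 : ¬ ∀ᶠ N in U, (x N).testBit i = true := fun h2 => hb (decide_eq_true h2)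
        exact Ultrafilter.eventually_not.2 h2
      | false =>
        have h2 : ∀ᶠ N in U, (x N).testBit i = true := by
          simpa [v] using hb
        exact h2.mono fun N hN => by simp [hN]
    refine h ⟨v, fun t => ?_⟩
    by_contra! hc
    have h2 : ∀ᶠ N in (U : Filter ℕ), ∀ l ∈ (cl t).toFinset, (x N).testBit l.1 ≠ l.2 :=
      (Filter.eventually_all_finset _).2 fun l hl => hv _ _ (hc l (List.mem_toFinset.1 hl))
    have h3 : ∀ᶠ N in (U : Filter ℕ), ∀ l ∈ (cl t).toFinset, l.1 < N :=
      (Filter.eventually_all_finset _).2 fun l _ =>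
        Nat.hyperfilter_le_atTop (Filter.eventually_gt_atTop l.1)
    have h4 : ∀ᶠ N in (U : Filter ℕ), t < N :=
      Nat.hyperfilter_le_atTop (Filter.eventually_gt_atTop t)
    obtain ⟨N, h2, h3, h4⟩ := (h2.and (h3.and h4)).exists
    obtain ⟨l, hl, h5⟩ := h1 N t h4
    exact h2 l (List.mem_toFinset.2 hl) (h5 (h3 l (List.mem_toFinset.2 hl)))
  · rintro ⟨N, h⟩ ⟨v, hv⟩
    obtain ⟨x, hx, h1⟩ : ∃ x < 2 ^ N, ∀ i < N, x.testBit i = v i := by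
      refine ⟨(BitVec.ofFnLE fun i : Fin N => v i).toNat, BitVec.isLt _, fun i hi => ?_⟩
      simp [hi]
    obtain ⟨t, -, h2⟩ := h x hx
    obtain ⟨l, hl, h3⟩ := hv t
    exact (h2 l hl).2 ((h1 _ (h2 l hl).1).trans h3)

theorem primrec_testBit : Primrec₂ Nat.testBit := by
  have hpow : Primrec₂ ((· ^ ·) : ℕ → ℕ → ℕ) := Primrec₂.unpaired'.1 Nat.Primrec.pow
  have h := Primrec.beq.comp₂ (Primrec.nat_mod.comp₂ (Primrec.nat_div.comp₂ Primrec₂.left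
    (hpow.comp₂ (Primrec₂.const 2) Primrec₂.right)) (Primrec₂.const 2)) (Primrec₂.const 1)
  refine h.of_eq fun x i => ?_
  rw [Nat.testBit_eq_decide_div_mod_eq]
  rfl

/-- Unsatisfiability of a system of clauses is recursively enumerable. -/
theorem IsClausal.rePred (hP : IsClausal P) : REPred fun a => ¬ ∃ v, P a v := by
  obtain ⟨cl, h1, h2⟩ := hP
  have key : ∀ a, (¬ ∃ v, P a v) ↔
      ∃ N, ∀ x < 2 ^ N, ∃ t < N, ∀ l ∈ cl a t, l.1 < N ∧ x.testBit l.1 ≠ l.2 := fun a => by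
    simp only [h2]
    exact not_exists_valuation_iff _
  have hpow : Primrec₂ ((· ^ ·) : ℕ → ℕ → ℕ) := Primrec₂.unpaired'.1 Nat.Primrec.pow
  have p1 : PrimrecRel fun (l : ℕ × Bool) (q : ℕ × ℕ) => l.1 < q.1 ∧ q.2.testBit l.1 ≠ l.2 :=
    (Primrec.nat_lt.comp (Primrec.fst.comp Primrec.fst) (Primrec.fst.comp Primrec.snd)).and
      (Primrec.eq.comp (primrec_testBit.comp (Primrec.snd.comp Primrec.snd)
        (Primrec.fst.comp Primrec.fst)) (Primrec.snd.comp Primrec.fst)).not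
  have p2 : PrimrecRel fun (t : ℕ) (q : (α × ℕ) × ℕ) =>
      ∀ l ∈ cl q.1.1 t, l.1 < q.1.2 ∧ q.2.testBit l.1 ≠ l.2 :=
    p1.forall_mem_list.comp (h1.comp (Primrec.fst.comp (Primrec.fst.comp Primrec.snd)) Primrec.fst)
      ((Primrec.snd.comp (Primrec.fst.comp Primrec.snd)).pair (Primrec.snd.comp Primrec.snd))
  have p3 : PrimrecRel fun (x : ℕ) (q : α × ℕ) =>
      ∃ t < q.2, ∀ l ∈ cl q.1 t, l.1 < q.2 ∧ x.testBit l.1 ≠ l.2 :=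
    (p2.exists_mem_list.comp (f := fun p : ℕ × (α × ℕ) => List.range p.2.2)
      (g := fun p : ℕ × (α × ℕ) => (p.2, p.1)) (Primrec.list_range.comp
      (Primrec.snd.comp Primrec.snd)) (Primrec.snd.pair Primrec.fst)).of_eq fun p => by simp
  have p4 : PrimrecPred fun q : α × ℕ =>
      ∀ x < 2 ^ q.2, ∃ t < q.2, ∀ l ∈ cl q.1 t, l.1 < q.2 ∧ x.testBit l.1 ≠ l.2 :=
    (p3.forall_mem_list.comp (f := fun q : α × ℕ => List.range (2 ^ q.2)) (Primrec.list_range.comp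
      (hpow.comp (.const 2) Primrec.snd)) Primrec.id).of_eq fun p => by simp
  obtain ⟨_, p5⟩ := p4
  have p6 : Partrec₂ fun (a : α) (N : ℕ) => (Part.some (decide (∀ x < 2 ^ N, ∃ t < N,
      ∀ l ∈ cl a t, l.1 < N ∧ x.testBit l.1 ≠ l.2)) : Part Bool) :=
    p5.to_comp.partrec.of_eq fun q => by simp
  refine (Partrec.dom_re (Partrec.rfind p6)).of_eq fun a => ?_
  rw [key]
  refine Nat.rfind_dom.trans ⟨fun ⟨N, h, _⟩ => ⟨N, ?_⟩, fun ⟨N, h⟩ => ⟨N, ?_, fun _ => trivial⟩⟩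
  · simpa using h
  · simpa using h

end Clauses

/-! ### Primitive recursion along codes. -/

section Recursion

/-- Strong recursion on natural numbers, with a default value for calls which do not decrease. -/
def natFix {β : Type*} [Inhabited β] (F : ℕ → (ℕ → β) → β) (n : ℕ) : β :=
  F n fun m => if _ : m < n then natFix F m else default
termination_by n

theorem natFix_eq {β : Type*} [Inhabited β] (F : ℕ → (ℕ → β) → β) (n : ℕ) :
    natFix F n = F n fun m => if m < n then natFix F m else default := by
  rw [natFix]
  simp only [dite_eq_ite]

theorem lt_pair_of_pos_of_le {k m n : ℕ} (hk : 0 < k) (h : m ≤ n) : m < Nat.pair k n := by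
  have := Nat.add_le_pair k n
  omega

/-- Strong recursion along the components of a coded pair or triple. -/
def codeFix (H : ℕ → ℕ → ℕ → ℕ → ℕ) : ℕ → ℕ :=
  natFix fun n ih => H n (ih n.unpair.2) (ih n.unpair.2.unpair.1) (ih n.unpair.2.unpair.2)

/-- A positive tag makes a code larger than its arguments. This fails for tag `0`, where `Nat.pair 0
r` can equal `r`; that tag is used only for variables and falsity, which need no recursive call. -/
theorem codeFix_pair (H : ℕ → ℕ → ℕ → ℕ → ℕ) {k : ℕ} (hk : 0 < k) (r : ℕ) :
    codeFix H (Nat.pair k r) =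
      H (Nat.pair k r) (codeFix H r) (codeFix H r.unpair.1) (codeFix H r.unpair.2) := by
  rw [codeFix, natFix_eq]
  simp only [Nat.unpair_pair, lt_pair_of_pos_of_le hk le_rfl,
    lt_pair_of_pos_of_le hk (Nat.unpair_left_le r), lt_pair_of_pos_of_le hk (Nat.unpair_right_le r),
    if_true]

theorem primrec_codeFix {H : ℕ → ℕ → ℕ → ℕ → ℕ}
    (hH : Primrec fun p : ℕ × ℕ × ℕ × ℕ => H p.1 p.2.1 p.2.2.1 p.2.2.2) : Primrec (codeFix H) := by
  have hr : Primrec fun p : Unit × List ℕ => p.2.length.unpair.2 :=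
    Primrec.snd.comp (Primrec.unpair.comp (Primrec.list_length.comp Primrec.snd))
  have hget : ∀ {f : Unit × List ℕ → ℕ}, Primrec f → Primrec fun p : Unit × List ℕ =>
      p.2.getD (f p) 0 :=
    fun hf => (Primrec.list_getD 0).comp Primrec.snd hf
  have h : Primrec₂ fun (_ : Unit) (l : List ℕ) => some (H l.length (l.getD l.length.unpair.2 0)
      (l.getD l.length.unpair.2.unpair.1 0) (l.getD l.length.unpair.2.unpair.2 0)) :=
    Primrec.option_some.comp (hH.comp ((Primrec.list_length.comp Primrec.snd).pair
      ((hget hr).pair ((hget (Primrec.fst.comp (Primrec.unpair.comp hr))).pair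
        (hget (Primrec.snd.comp (Primrec.unpair.comp hr)))))))
  refine (Primrec.nat_strong_rec (fun _ : Unit => codeFix H) h fun _ n => ?_).comp
    (Primrec.const ()) Primrec.id
  -- Reading past the list of earlier values returns `0`, which is the default value of `natFix` on
  -- calls that do not decrease.
  have hl : ∀ m, ((List.range n).map (codeFix H)).getD m 0 =
      if m < n then codeFix H m else default := fun m => by
    by_cases hm : m < n
    · simp [List.getD, hm]
    · simp [List.getD, hm, Nat.default_eq_zero]
  simp only [List.length_map, List.length_range, hl]
  conv_rhs => rw [codeFix, natFix_eq]
  rfl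

end Recursion

/-! ### Recognition of the codes of terms and formulas. -/

section CodeArity

/-- The larger of two positive numbers, `0` if one of them is `0`. -/
def posMax (a b : ℕ) : ℕ := if a = 0 ∨ b = 0 then 0 else max a b

theorem posMax_iff {a b m : ℕ} :
    (0 < posMax a b ∧ posMax a b ≤ m) ↔ (0 < a ∧ a ≤ m) ∧ 0 < b ∧ b ≤ m := by
  unfold posMax
  split_ifs <;> omega

theorem primrec_posMax {α : Type*} [Primcodable α] {f g : α → ℕ} (hf : Primrec f)
    (hg : Primrec g) : Primrec fun a => posMax (f a) (g a) :=
  Primrec.ite ((Primrec.eq.comp hf (.const 0)).or (Primrec.eq.comp hg (.const 0))) (.const 0)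
    (Primrec.nat_max.comp hf hg)

/-- One step in the computation of `termArity`. -/
def termArityStep (d n _a b c : ℕ) : ℕ :=
  -- The variable `x_j` needs `j + 1` variables, and the result is shifted by one so that `0` can
  -- signal failure.
  if n.unpair.1 = 0 then n.unpair.2 + 2
  else if n.unpair.1 = 1 ∨ n.unpair.1 = 2 then (if n.unpair.2 = 0 then 1 else 0)
  else if n.unpair.1 = 3 then (if n.unpair.2.unpair.1 ≤ d then c else 0)
  else if n.unpair.1 ≤ 6 then posMax b c else 0

/-- `k + 1` if `n` is the code of a term and `k` is the least number of variables it needs, and `0`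
if `n` is not the code of a term. -/
def termArity (d : ℕ) : ℕ → ℕ := codeFix (termArityStep d)

theorem primrec_termArity (d : ℕ) : Primrec (termArity d) := by
  have h0 : Primrec fun p : ℕ × ℕ × ℕ × ℕ => p.1.unpair.1 :=
    Primrec.fst.comp (Primrec.unpair.comp Primrec.fst)
  have h1 : Primrec fun p : ℕ × ℕ × ℕ × ℕ => p.1.unpair.2 :=
    Primrec.snd.comp (Primrec.unpair.comp Primrec.fst)
  have h2 : Primrec fun p : ℕ × ℕ × ℕ × ℕ => p.1.unpair.2.unpair.1 :=
    Primrec.fst.comp (Primrec.unpair.comp h1)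
  have hb : Primrec fun p : ℕ × ℕ × ℕ × ℕ => p.2.2.1 :=
    Primrec.fst.comp (Primrec.snd.comp Primrec.snd)
  have hc : Primrec fun p : ℕ × ℕ × ℕ × ℕ => p.2.2.2 :=
    Primrec.snd.comp (Primrec.snd.comp Primrec.snd)
  exact primrec_codeFix <| Primrec.ite (Primrec.eq.comp h0 (.const 0))
    (Primrec.nat_add.comp h1 (.const 2)) <| Primrec.ite
    ((Primrec.eq.comp h0 (.const 1)).or (Primrec.eq.comp h0 (.const 2)))
    (Primrec.ite (Primrec.eq.comp h1 (.const 0)) (.const 1) (.const 0)) <|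
    Primrec.ite (Primrec.eq.comp h0 (.const 3))
    (Primrec.ite (Primrec.nat_le.comp h2 (.const d)) hc (.const 0)) <|
    Primrec.ite (Primrec.nat_le.comp h0 (.const 6)) (primrec_posMax hb hc) (.const 0)

theorem termArity_iff {d n s : ℕ} : (0 < termArity d s ∧ termArity d s ≤ n + 1) ↔
    ∃ t : (lang d).Term (Empty ⊕ Fin n), termCode t = s := by
  constructor
  · intro h
    induction s using Nat.strong_induction_on with
    | _ s ih =>
    obtain ⟨k, r, rfl⟩ : ∃ k r, s = Nat.pair k r := ⟨_, _, (Nat.pair_unpair s).symm⟩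
    obtain ⟨i, j, rfl⟩ : ∃ i j, r = Nat.pair i j := ⟨_, _, (Nat.pair_unpair r).symm⟩
    rcases Nat.eq_zero_or_pos k with rfl | hk
    · rw [termArity, codeFix, natFix_eq] at h
      simp only [termArityStep, Nat.unpair_pair, if_true] at h
      exact ⟨.var (.inr ⟨Nat.pair i j, by omega⟩), rfl⟩
    · rw [termArity, codeFix_pair _ hk] at h
      simp only [termArityStep, Nat.unpair_pair, hk.ne', if_false] at h
      have hi : i < Nat.pair k (Nat.pair i j) := lt_pair_of_pos_of_le hk (Nat.left_le_pair _ _)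
      have hj : j < Nat.pair k (Nat.pair i j) := lt_pair_of_pos_of_le hk (Nat.right_le_pair _ _)
      split_ifs at h with h1 h2 h3 h4 h5
      · rw [h2]
        rcases h1 with rfl | rfl
        · exact ⟨.func Fn.zero ![], rfl⟩
        · exact ⟨.func Fn.one ![], rfl⟩
      · omega
      · obtain ⟨t, ht⟩ := ih j hj h
        subst h3
        refine ⟨.func (Fn.comp ⟨i, by omega⟩) ![t], ?_⟩
        simp only [termCode, Matrix.cons_val_zero, ht]
      · omega
      · obtain ⟨h6, h7⟩ := posMax_iff.1 h
        obtain ⟨t, ht⟩ := ih i hi h6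
        obtain ⟨t', ht'⟩ := ih j hj h7
        obtain rfl | rfl | rfl : k = 4 ∨ k = 5 ∨ k = 6 := by omega
        · refine ⟨.func Fn.join ![t, t'], ?_⟩
          simp [termCode, ht, ht']
        · refine ⟨.func Fn.meet ![t, t'], ?_⟩
          simp [termCode, ht, ht']
        · refine ⟨.func Fn.diff ![t, t'], ?_⟩
          simp [termCode, ht, ht']
      · omega
  · rintro ⟨t, rfl⟩
    induction t with
    | var x =>
      rcases x with e | i
      · exact e.elim
      · rw [termCode, termArity, codeFix, natFix_eq]
        simp only [termArityStep, Nat.unpair_pair, if_true]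
        omega
    | func f ts ih =>
      cases f <;> rw [termCode, termArity, codeFix_pair _ (by decide)] <;>
        simp only [termArityStep, Nat.unpair_pair] <;> norm_num
      · rw [if_pos (by omega)]
        exact ih 0
      all_goals exact posMax_iff.2 ⟨ih 0, ih 1⟩

/-- One step in the computation of `formulaArity`. -/
def formulaArityStep (d n a b c : ℕ) : ℕ :=
  if n.unpair.1 = 0 then (if n.unpair.2 = 0 then 1 else 0)
  else if n.unpair.1 = 1 then
    posMax (termArity d n.unpair.2.unpair.1) (termArity d n.unpair.2.unpair.2)
  else if n.unpair.1 = 2 then posMax b c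
  -- The quantifier binds one variable, but a shifted arity is at least `1`.
  else if n.unpair.1 = 3 then (if a = 0 then 0 else max 1 (a - 1)) else 0

/-- `k + 1` if `n` is the code of a formula and `k` is the least number of free variables it needs,
and `0` if `n` is not the code of a formula. -/
def formulaArity (d : ℕ) : ℕ → ℕ := codeFix (formulaArityStep d)

theorem primrec_formulaArity (d : ℕ) : Primrec (formulaArity d) := by
  have h0 : Primrec fun p : ℕ × ℕ × ℕ × ℕ => p.1.unpair.1 :=
    Primrec.fst.comp (Primrec.unpair.comp Primrec.fst)
  have h1 : Primrec fun p : ℕ × ℕ × ℕ × ℕ => p.1.unpair.2 :=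
    Primrec.snd.comp (Primrec.unpair.comp Primrec.fst)
  have h2 : Primrec fun p : ℕ × ℕ × ℕ × ℕ => p.1.unpair.2.unpair.1 :=
    Primrec.fst.comp (Primrec.unpair.comp h1)
  have h3 : Primrec fun p : ℕ × ℕ × ℕ × ℕ => p.1.unpair.2.unpair.2 :=
    Primrec.snd.comp (Primrec.unpair.comp h1)
  have ha : Primrec fun p : ℕ × ℕ × ℕ × ℕ => p.2.1 := Primrec.fst.comp Primrec.snd
  have hb : Primrec fun p : ℕ × ℕ × ℕ × ℕ => p.2.2.1 :=
    Primrec.fst.comp (Primrec.snd.comp Primrec.snd)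
  have hc : Primrec fun p : ℕ × ℕ × ℕ × ℕ => p.2.2.2 :=
    Primrec.snd.comp (Primrec.snd.comp Primrec.snd)
  exact primrec_codeFix <| Primrec.ite (Primrec.eq.comp h0 (.const 0))
    (Primrec.ite (Primrec.eq.comp h1 (.const 0)) (.const 1) (.const 0)) <|
    Primrec.ite (Primrec.eq.comp h0 (.const 1))
    (primrec_posMax ((primrec_termArity d).comp h2) ((primrec_termArity d).comp h3)) <|
    Primrec.ite (Primrec.eq.comp h0 (.const 2)) (primrec_posMax hb hc) <|
    Primrec.ite (Primrec.eq.comp h0 (.const 3)) (Primrec.ite (Primrec.eq.comp ha (.const 0))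
      (.const 0) (Primrec.nat_max.comp (.const 1) (Primrec.nat_sub.comp ha (.const 1)))) (.const 0)

theorem formulaArity_iff {d n s : ℕ} : (0 < formulaArity d s ∧ formulaArity d s ≤ n + 1) ↔
    ∃ φ : (lang d).BoundedFormula Empty n, formulaCode φ = s := by
  constructor
  · intro h
    induction s using Nat.strong_induction_on generalizing n with
    | _ s ih =>
    obtain ⟨k, r, rfl⟩ : ∃ k r, s = Nat.pair k r := ⟨_, _, (Nat.pair_unpair s).symm⟩
    rcases Nat.eq_zero_or_pos k with rfl | hk
    · rw [formulaArity, codeFix, natFix_eq] at h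
      simp only [formulaArityStep, Nat.unpair_pair, if_true] at h
      split_ifs at h with h1
      · rw [h1]
        exact ⟨.falsum, rfl⟩
      · omega
    · rw [formulaArity, codeFix_pair _ hk] at h
      simp only [formulaArityStep, Nat.unpair_pair, hk.ne', if_false] at h
      split_ifs at h with h1 h2 h3 h4
      · obtain ⟨h6, h7⟩ := posMax_iff.1 h
        obtain ⟨t, ht⟩ := termArity_iff.1 h6
        obtain ⟨t', ht'⟩ := termArity_iff.1 h7
        refine ⟨.equal t t', ?_⟩
        rw [formulaCode, ht, ht', Nat.pair_unpair, h1]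
      · obtain ⟨h6, h7⟩ := posMax_iff.1 h
        obtain ⟨t, ht⟩ := ih _ (lt_pair_of_pos_of_le hk (Nat.unpair_left_le r)) h6
        obtain ⟨t', ht'⟩ := ih _ (lt_pair_of_pos_of_le hk (Nat.unpair_right_le r)) h7
        refine ⟨.imp t t', ?_⟩
        rw [formulaCode, ht, ht', Nat.pair_unpair, h2]
      · omega
      · obtain ⟨t, ht⟩ := ih r (lt_pair_of_pos_of_le hk le_rfl) (n := n + 1)
          ⟨Nat.pos_of_ne_zero h4, by
            have : formulaArity d r = codeFix (formulaArityStep d) r := rfl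
            omega⟩
        refine ⟨.all t, ?_⟩
        rw [formulaCode, ht, h3]
      · omega
  · rintro ⟨φ, rfl⟩
    induction φ with
    | falsum =>
      rw [formulaCode, formulaArity, codeFix, natFix_eq]
      simp [formulaArityStep]
    | equal t t' =>
      rw [formulaCode, formulaArity, codeFix_pair _ (by decide)]
      simp only [formulaArityStep, Nat.unpair_pair]
      exact posMax_iff.2 ⟨termArity_iff.2 ⟨t, rfl⟩, termArity_iff.2 ⟨t', rfl⟩⟩
    | rel R => exact Empty.elim R
    | imp φ ψ ih₁ ih₂ =>
      rw [formulaCode, formulaArity, codeFix_pair _ (by decide)]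
      simp only [formulaArityStep, Nat.unpair_pair]
      exact posMax_iff.2 ⟨ih₁, ih₂⟩
    | all φ ih =>
      rw [formulaCode, formulaArity, codeFix_pair _ (by decide)]
      simp only [formulaArityStep, Nat.unpair_pair]
      rw [formulaArity] at ih
      norm_num
      rw [if_neg (by omega)]
      omega

end CodeArity

/-! ### Diagrams of structures as systems of clauses. -/

section Atoms

/-- The code of the element `0`. -/
def codeBot : ℕ := Nat.pair 1 0

/-- The code of the element `1`. -/
def codeTop : ℕ := Nat.pair 2 0

/-- The code of the image of `x` under the unary operation of index `i`. -/
def codeComp (i x : ℕ) : ℕ := Nat.pair 3 (Nat.pair i x)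

/-- The code of the image of `x, y` under the binary operation of index `k`. -/
def codeOp (k x y : ℕ) : ℕ := Nat.pair 4 (Nat.pair k (Nat.pair x y))

/-- The code of the value of the term with code `s` at the elements with codes in `e`. -/
def codeValue (s : ℕ) (e : List ℕ) : ℕ := Nat.pair 5 (Nat.pair s (Encodable.encode e))

/-- The code of a counterexample to the formula with code `c` over the elements with codes
in `e`. -/
def codeWitness (c : ℕ) (e : List ℕ) : ℕ := Nat.pair 6 (Nat.pair c (Encodable.encode e))

/-- The index of the atom which says that the formula with code `c` holds at `e`. -/
def truthAtom (c : ℕ) (e : List ℕ) : ℕ := Nat.pair 0 (Nat.pair c (Encodable.encode e))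

/-- The index of the atom which says that `x` and `y` are codes of the same element. -/
def eqAtom (x y : ℕ) : ℕ := Nat.pair 1 (Nat.pair x y)

/-- The properties of the valuation of the atoms which come from a structure. -/
structure IsDiagram (v : ℕ → Bool) : Prop where
  refl : ∀ x, v (eqAtom x x) = true
  eucl : ∀ x y z, v (eqAtom x y) = false ∨ v (eqAtom x z) = false ∨ v (eqAtom y z) = true
  comp : ∀ i x y, v (eqAtom x y) = false ∨ v (eqAtom (codeComp i x) (codeComp i y)) = true
  op : ∀ k x x' y y', v (eqAtom x x') = false ∨ v (eqAtom y y') = false ∨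
    v (eqAtom (codeOp k x y) (codeOp k x' y')) = true
  value_var : ∀ j e, v (eqAtom (codeValue (Nat.pair 0 j) e) (e.getD j 0)) = true
  value_bot : ∀ j e, v (eqAtom (codeValue (Nat.pair 1 j) e) codeBot) = true
  value_top : ∀ j e, v (eqAtom (codeValue (Nat.pair 2 j) e) codeTop) = true
  value_comp : ∀ i s e, v (eqAtom (codeValue (Nat.pair 3 (Nat.pair i s)) e)
    (codeComp i (codeValue s e))) = true
  value_op : ∀ k s t e, v (eqAtom (codeValue (Nat.pair (k + 4) (Nat.pair s t)) e)
    (codeOp k (codeValue s e) (codeValue t e))) = true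
  falsum : ∀ j e, v (truthAtom (Nat.pair 0 j) e) = false
  of_equal : ∀ s t e, v (truthAtom (Nat.pair 1 (Nat.pair s t)) e) = false ∨
    v (eqAtom (codeValue s e) (codeValue t e)) = true
  equal : ∀ s t e, v (truthAtom (Nat.pair 1 (Nat.pair s t)) e) = true ∨
    v (eqAtom (codeValue s e) (codeValue t e)) = false
  of_imp : ∀ b c e, v (truthAtom (Nat.pair 2 (Nat.pair b c)) e) = false ∨
    v (truthAtom b e) = false ∨ v (truthAtom c e) = true
  imp_left : ∀ b c e, v (truthAtom (Nat.pair 2 (Nat.pair b c)) e) = true ∨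
    v (truthAtom b e) = true
  imp_right : ∀ b c e, v (truthAtom (Nat.pair 2 (Nat.pair b c)) e) = true ∨
    v (truthAtom c e) = false
  of_all : ∀ c e x, v (truthAtom (Nat.pair 3 c) e) = false ∨ v (truthAtom c (e ++ [x])) = true
  -- The Henkin condition: when a universal formula fails, its coded witness is a counterexample.
  all : ∀ c e, v (truthAtom (Nat.pair 3 c) e) = true ∨
    v (truthAtom c (e ++ [codeWitness c e])) = false

variable {α : Type} [Primcodable α]

theorem primrec_codeComp {f g : α → ℕ} (hf : Primrec f) (hg : Primrec g) :
    Primrec fun a => codeComp (f a) (g a) :=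
  Primrec₂.natPair.comp (.const 3) (Primrec₂.natPair.comp hf hg)

theorem primrec_codeOp {f g h : α → ℕ} (hf : Primrec f) (hg : Primrec g) (hh : Primrec h) :
    Primrec fun a => codeOp (f a) (g a) (h a) :=
  Primrec₂.natPair.comp (.const 4) (Primrec₂.natPair.comp hf (Primrec₂.natPair.comp hg hh))

theorem primrec_codeValue {f : α → ℕ} {g : α → List ℕ} (hf : Primrec f) (hg : Primrec g) :
    Primrec fun a => codeValue (f a) (g a) :=
  Primrec₂.natPair.comp (.const 5) (Primrec₂.natPair.comp hf (Primrec.encode.comp hg))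

theorem primrec_codeWitness {f : α → ℕ} {g : α → List ℕ} (hf : Primrec f) (hg : Primrec g) :
    Primrec fun a => codeWitness (f a) (g a) :=
  Primrec₂.natPair.comp (.const 6) (Primrec₂.natPair.comp hf (Primrec.encode.comp hg))

theorem primrec_truthAtom {f : α → ℕ} {g : α → List ℕ} (hf : Primrec f) (hg : Primrec g) :
    Primrec fun a => truthAtom (f a) (g a) :=
  Primrec₂.natPair.comp (.const 0) (Primrec₂.natPair.comp hf (Primrec.encode.comp hg))

theorem primrec_eqAtom {f g : α → ℕ} (hf : Primrec f) (hg : Primrec g) :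
    Primrec fun a => eqAtom (f a) (g a) :=
  Primrec₂.natPair.comp (.const 1) (Primrec₂.natPair.comp hf hg)

theorem isClausal_isDiagram : IsClausal fun (_ : α) v => IsDiagram v := by
  have pair : ∀ {β : Type} [Primcodable β] {f g : β → ℕ}, Primrec f → Primrec g →
    Primrec fun b => Nat.pair (f b) (g b) := fun hf hg => Primrec₂.natPair.comp hf hg
  have c : ∀ {β : Type} [Primcodable β] (n : ℕ), Primrec fun _ : β => n := fun n => .const n
  -- `v1` reads the variable quantified last, `v2` the one before it, and so on.
  have v1 : ∀ {β γ : Type} [Primcodable β] [Primcodable γ], Primrec fun p : β × γ => p.2 :=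
    Primrec.snd
  have v2 : ∀ {β γ δ : Type} [Primcodable β] [Primcodable γ] [Primcodable δ],
    Primrec fun p : (β × γ) × δ => p.1.2 := Primrec.snd.comp Primrec.fst
  have v3 : ∀ {β γ δ ε : Type} [Primcodable β] [Primcodable γ] [Primcodable δ] [Primcodable ε],
    Primrec fun p : ((β × γ) × δ) × ε => p.1.1.2 := v2.comp Primrec.fst
  have v4 : ∀ {β γ δ ε ζ : Type} [Primcodable β] [Primcodable γ] [Primcodable δ] [Primcodable ε]
    [Primcodable ζ], Primrec fun p : (((β × γ) × δ) × ε) × ζ => p.1.1.1.2 := v3.comp Primrec.fst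
  have v5 : ∀ {β γ δ ε ζ η : Type} [Primcodable β] [Primcodable γ] [Primcodable δ] [Primcodable ε]
    [Primcodable ζ] [Primcodable η], Primrec fun p : ((((β × γ) × δ) × ε) × ζ) × η =>
      p.1.1.1.1.2 := v4.comp Primrec.fst
  have h_refl : IsClausal fun (_ : α) v => ∀ (x : ℕ), v (eqAtom x x) = true := IsClausal.all <|
      IsClausal.clause₁ (primrec_eqAtom v1 v1)
  have h_eucl : IsClausal fun (_ : α) v => ∀ (x : ℕ) (y : ℕ) (z : ℕ), v (eqAtom x y) = false ∨ v
      (eqAtom x z) = false ∨ v (eqAtom y z) = true := IsClausal.all <| IsClausal.all <|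
      IsClausal.all <| IsClausal.clause₃ (primrec_eqAtom v3 v2) (primrec_eqAtom v3 v1)
      (primrec_eqAtom v2 v1)
  have h_comp : IsClausal fun (_ : α) v => ∀ (i : ℕ) (x : ℕ) (y : ℕ), v (eqAtom x y) = false ∨ v
      (eqAtom (codeComp i x) (codeComp i y)) = true := IsClausal.all <| IsClausal.all <|
      IsClausal.all <| IsClausal.clause₂ (primrec_eqAtom v2 v1) (primrec_eqAtom (primrec_codeComp
      v3 v2) (primrec_codeComp v3 v1))
  have h_op : IsClausal fun (_ : α) v => ∀ (k : ℕ) (x : ℕ) (x' : ℕ) (y : ℕ) (y' : ℕ), v (eqAtom x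
      x') = false ∨ v (eqAtom y y') = false ∨ v (eqAtom (codeOp k x y) (codeOp k x' y')) = true :=
      IsClausal.all <| IsClausal.all <| IsClausal.all <| IsClausal.all <| IsClausal.all <|
      IsClausal.clause₃ (primrec_eqAtom v4 v3) (primrec_eqAtom v2 v1) (primrec_eqAtom
      (primrec_codeOp v5 v4 v2) (primrec_codeOp v5 v3 v1))
  have h_value_var : IsClausal fun (_ : α) v => ∀ (j : ℕ) (e : List ℕ), v (eqAtom (codeValue
      (Nat.pair 0 j) e) (e.getD j 0)) = true := IsClausal.all <| IsClausal.all <|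
      IsClausal.clause₁ (primrec_eqAtom (primrec_codeValue (pair (c 0) v2) v1) ((Primrec.list_getD
      0).comp v1 v2))
  have h_value_bot : IsClausal fun (_ : α) v => ∀ (j : ℕ) (e : List ℕ), v (eqAtom (codeValue
      (Nat.pair 1 j) e) codeBot) = true := IsClausal.all <| IsClausal.all <| IsClausal.clause₁
      (primrec_eqAtom (primrec_codeValue (pair (c 1) v2) v1) (c codeBot))
  have h_value_top : IsClausal fun (_ : α) v => ∀ (j : ℕ) (e : List ℕ), v (eqAtom (codeValue
      (Nat.pair 2 j) e) codeTop) = true := IsClausal.all <| IsClausal.all <| IsClausal.clause₁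
      (primrec_eqAtom (primrec_codeValue (pair (c 2) v2) v1) (c codeTop))
  have h_value_comp : IsClausal fun (_ : α) v => ∀ (i : ℕ) (s : ℕ) (e : List ℕ), v (eqAtom
      (codeValue (Nat.pair 3 (Nat.pair i s)) e) (codeComp i (codeValue s e))) = true :=
      IsClausal.all <| IsClausal.all <| IsClausal.all <| IsClausal.clause₁ (primrec_eqAtom
      (primrec_codeValue (pair (c 3) (pair v3 v2)) v1) (primrec_codeComp v3 (primrec_codeValue v2
      v1)))
  have h_value_op : IsClausal fun (_ : α) v => ∀ (k : ℕ) (s : ℕ) (t : ℕ) (e : List ℕ), v (eqAtom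
      (codeValue (Nat.pair (k + 4) (Nat.pair s t)) e) (codeOp k (codeValue s e) (codeValue t e)))
      = true := IsClausal.all <| IsClausal.all <| IsClausal.all <| IsClausal.all <|
      IsClausal.clause₁ (primrec_eqAtom (primrec_codeValue (pair (Primrec.nat_add.comp v4 (c 4))
      (pair v3 v2)) v1) (primrec_codeOp v4 (primrec_codeValue v3 v1) (primrec_codeValue v2 v1)))
  have h_falsum : IsClausal fun (_ : α) v => ∀ (j : ℕ) (e : List ℕ), v (truthAtom (Nat.pair 0 j)
      e) = false := IsClausal.all <| IsClausal.all <| IsClausal.clause₁ (primrec_truthAtom (pair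
      (c 0) v2) v1)
  have h_of_equal : IsClausal fun (_ : α) v => ∀ (s : ℕ) (t : ℕ) (e : List ℕ), v (truthAtom
      (Nat.pair 1 (Nat.pair s t)) e) = false ∨ v (eqAtom (codeValue s e) (codeValue t e)) = true
      := IsClausal.all <| IsClausal.all <| IsClausal.all <| IsClausal.clause₂ (primrec_truthAtom
      (pair (c 1) (pair v3 v2)) v1) (primrec_eqAtom (primrec_codeValue v3 v1) (primrec_codeValue
      v2 v1))
  have h_equal : IsClausal fun (_ : α) v => ∀ (s : ℕ) (t : ℕ) (e : List ℕ), v (truthAtom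
      (Nat.pair 1 (Nat.pair s t)) e) = true ∨ v (eqAtom (codeValue s e) (codeValue t e)) = false
      := IsClausal.all <| IsClausal.all <| IsClausal.all <| IsClausal.clause₂ (primrec_truthAtom
      (pair (c 1) (pair v3 v2)) v1) (primrec_eqAtom (primrec_codeValue v3 v1) (primrec_codeValue
      v2 v1))
  have h_of_imp : IsClausal fun (_ : α) v => ∀ (b : ℕ) (c : ℕ) (e : List ℕ), v (truthAtom
      (Nat.pair 2 (Nat.pair b c)) e) = false ∨ v (truthAtom b e) = false ∨ v (truthAtom c e) =
      true := IsClausal.all <| IsClausal.all <| IsClausal.all <| IsClausal.clause₃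
      (primrec_truthAtom (pair (c 2) (pair v3 v2)) v1) (primrec_truthAtom v3 v1)
      (primrec_truthAtom v2 v1)
  have h_imp_left : IsClausal fun (_ : α) v => ∀ (b : ℕ) (c : ℕ) (e : List ℕ), v (truthAtom
      (Nat.pair 2 (Nat.pair b c)) e) = true ∨ v (truthAtom b e) = true := IsClausal.all <|
      IsClausal.all <| IsClausal.all <| IsClausal.clause₂ (primrec_truthAtom (pair (c 2) (pair v3
      v2)) v1) (primrec_truthAtom v3 v1)
  have h_imp_right : IsClausal fun (_ : α) v => ∀ (b : ℕ) (c : ℕ) (e : List ℕ), v (truthAtom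
      (Nat.pair 2 (Nat.pair b c)) e) = true ∨ v (truthAtom c e) = false := IsClausal.all <|
      IsClausal.all <| IsClausal.all <| IsClausal.clause₂ (primrec_truthAtom (pair (c 2) (pair v3
      v2)) v1) (primrec_truthAtom v2 v1)
  have h_of_all : IsClausal fun (_ : α) v => ∀ (c : ℕ) (e : List ℕ) (x : ℕ), v (truthAtom
      (Nat.pair 3 c) e) = false ∨ v (truthAtom c (e ++ [x])) = true := IsClausal.all <|
      IsClausal.all <| IsClausal.all <| IsClausal.clause₂ (primrec_truthAtom (pair (c 3) v3) v2)
      (primrec_truthAtom v3 (Primrec.list_concat.comp v2 v1))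
  have h_all : IsClausal fun (_ : α) v => ∀ (c : ℕ) (e : List ℕ), v (truthAtom (Nat.pair 3 c) e)
      = true ∨ v (truthAtom c (e ++ [codeWitness c e])) = false := IsClausal.all <| IsClausal.all
      <| IsClausal.clause₂ (primrec_truthAtom (pair (c 3) v2) v1) (primrec_truthAtom v2
      (Primrec.list_concat.comp v1 (primrec_codeWitness v2 v1)))
  refine (h_refl.and <| h_eucl.and <| h_comp.and <| h_op.and <| h_value_var.and <|
    h_value_bot.and <| h_value_top.and <| h_value_comp.and <| h_value_op.and <| h_falsum.and <|
    h_of_equal.and <| h_equal.and <| h_of_imp.and <| h_imp_left.and <| h_imp_right.and <|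
    h_of_all.and h_all).of_iff
    fun _ v => ⟨?_, ?_⟩
  · rintro ⟨h1, h2, h3, h4, h5, h6, h7, h8, h9, h10, h11, h12, h13, h14, h15, h16, h17⟩
    exact ⟨h1, h2, h3, h4, h5, h6, h7, h8, h9, h10, h11, h12, h13, h14, h15, h16, h17⟩
  · rintro ⟨h1, h2, h3, h4, h5, h6, h7, h8, h9, h10, h11, h12, h13, h14, h15, h16, h17⟩
    exact ⟨h1, h2, h3, h4, h5, h6, h7, h8, h9, h10, h11, h12, h13, h14, h15, h16, h17⟩

end Atoms

/-! ### The diagram of a given structure. -/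

section Evaluation

variable (d : ℕ) {M : Type w} [(lang d).Structure M]

/-- The binary operation of index `k`. -/
def interpOp : ℕ → M → M → M
  | 0, x, y => join d x y
  | 1, x, y => meet d x y
  | _, x, y => diff d x y

variable [Inhabited M]

/-- The value at `e` of the term with a given code. -/
def interpTerm : ℕ → List M → M :=
  natFix fun s ih e => match s.unpair.1 with
    | 0 => e.getD s.unpair.2 default
    | 1 => bot d
    | 2 => top d
    -- Indices beyond `d` are reduced modulo `d + 1`; this never affects codes of actual terms.
    | 3 => comp d (Fin.ofNat (d + 1) s.unpair.2.unpair.1) (ih s.unpair.2.unpair.2 e)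
    | k + 4 => interpOp d k (ih s.unpair.2.unpair.1 e) (ih s.unpair.2.unpair.2 e)

/-- The truth value at `e` of the formula with a given code. -/
def interpFormula : ℕ → List M → Prop :=
  natFix fun c ih e => match c.unpair.1 with
    | 0 => False
    | 1 => interpTerm d c.unpair.2.unpair.1 e = interpTerm d c.unpair.2.unpair.2 e
    | 2 => ih c.unpair.2.unpair.1 e → ih c.unpair.2.unpair.2 e
    | _ => ∀ x, ih c.unpair.2 (e ++ [x])

theorem interpTerm_var (j : ℕ) (e : List M) : interpTerm d (Nat.pair 0 j) e = e.getD j default := by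
  rw [interpTerm, natFix_eq]
  simp only [Nat.unpair_pair]

theorem interpTerm_bot (j : ℕ) (e : List M) : interpTerm d (Nat.pair 1 j) e = bot d := by
  rw [interpTerm, natFix_eq]
  simp only [Nat.unpair_pair]

theorem interpTerm_top (j : ℕ) (e : List M) : interpTerm d (Nat.pair 2 j) e = top d := by
  rw [interpTerm, natFix_eq]
  simp only [Nat.unpair_pair]

theorem interpTerm_comp (i s : ℕ) (e : List M) : interpTerm d (Nat.pair 3 (Nat.pair i s)) e =
    comp d (Fin.ofNat (d + 1) i) (interpTerm d s e) := by
  conv_lhs => rw [interpTerm, natFix_eq]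
  simp only [Nat.unpair_pair, lt_pair_of_pos_of_le (Nat.succ_pos 2) (Nat.right_le_pair i s),
    if_true]
  rfl

theorem interpTerm_op (k s t : ℕ) (e : List M) : interpTerm d (Nat.pair (k + 4) (Nat.pair s t)) e =
    interpOp d k (interpTerm d s e) (interpTerm d t e) := by
  conv_lhs => rw [interpTerm, natFix_eq]
  simp only [Nat.unpair_pair, lt_pair_of_pos_of_le (Nat.succ_pos (k + 3)) (Nat.right_le_pair s t),
    lt_pair_of_pos_of_le (Nat.succ_pos (k + 3)) (Nat.left_le_pair s t), if_true]
  rfl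

theorem interpFormula_falsum (j : ℕ) (e : List M) : ¬ interpFormula d (Nat.pair 0 j) e := by
  rw [interpFormula, natFix_eq]
  simp only [Nat.unpair_pair, not_false_eq_true]

theorem interpFormula_equal (s t : ℕ) (e : List M) :
    interpFormula d (Nat.pair 1 (Nat.pair s t)) e ↔ interpTerm d s e = interpTerm d t e := by
  rw [interpFormula, natFix_eq]
  simp only [Nat.unpair_pair]

theorem interpFormula_imp (b c : ℕ) (e : List M) :
    interpFormula d (Nat.pair 2 (Nat.pair b c)) e ↔ (interpFormula d b e → interpFormula d c e) :=
        by
  conv_lhs => rw [interpFormula, natFix_eq]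
  simp only [Nat.unpair_pair, lt_pair_of_pos_of_le (Nat.succ_pos 1) (Nat.right_le_pair b c),
    lt_pair_of_pos_of_le (Nat.succ_pos 1) (Nat.left_le_pair b c), if_true]
  rfl

theorem interpFormula_all (c : ℕ) (e : List M) :
    interpFormula d (Nat.pair 3 c) e ↔ ∀ x, interpFormula d c (e ++ [x]) := by
  conv_lhs => rw [interpFormula, natFix_eq]
  simp only [Nat.unpair_pair, lt_pair_of_pos_of_le (Nat.succ_pos 2) le_rfl, if_true]
  rfl

variable {d}

theorem interpTerm_termCode {n : ℕ} (t : (lang d).Term (Empty ⊕ Fin n)) (xs : Fin n → M) :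
    interpTerm d (termCode t) (List.ofFn xs) = t.realize (Sum.elim default xs) := by
  induction t with
  | var x =>
    rcases x with e | i
    · exact e.elim
    · rw [termCode, interpTerm_var]
      simp [List.getD]
  | func f ts ih =>
    rw [Term.realize_func]
    have e1 : ∀ y : Fin 1 → M, y = ![y 0] := fun y => by funext j; fin_cases j; rfl
    have e2 : ∀ y : Fin 2 → M, y = ![y 0, y 1] := fun y => by funext j; fin_cases j <;> rfl
    cases f with
    | zero => rw [termCode, interpTerm_bot, bot]; congr 1; exact Subsingleton.elim _ _
    | one => rw [termCode, interpTerm_top, top]; congr 1; exact Subsingleton.elim _ _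
    | comp i =>
      rw [termCode, interpTerm_comp, ih 0, comp, e1 fun j => (ts j).realize _]
      simp
    | join => rw [termCode, interpTerm_op _ 0, ih 0, ih 1, e2 fun j => (ts j).realize _]; rfl
    | meet => rw [termCode, interpTerm_op _ 1, ih 0, ih 1, e2 fun j => (ts j).realize _]; rfl
    | diff => rw [termCode, interpTerm_op _ 2, ih 0, ih 1, e2 fun j => (ts j).realize _]; rfl

theorem ofFn_snoc {β : Type*} {n : ℕ} (xs : Fin n → β) (x : β) :
    List.ofFn (Fin.snoc xs x : Fin (n + 1) → β) = List.ofFn xs ++ [x] := by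
  rw [List.ofFn_succ', List.concat_eq_append]
  simp

theorem interpFormula_formulaCode {n : ℕ} (φ : (lang d).BoundedFormula Empty n) (xs : Fin n → M) :
    interpFormula d (formulaCode φ) (List.ofFn xs) ↔ φ.Realize default xs := by
  induction φ with
  | falsum => exact iff_of_false (interpFormula_falsum _ _ _) id
  | equal s t =>
    rw [formulaCode, interpFormula_equal, interpTerm_termCode, interpTerm_termCode]
    rfl
  | rel R => exact Empty.elim R
  | imp φ ψ ih₁ ih₂ =>
    rw [formulaCode, interpFormula_imp, ih₁, ih₂, BoundedFormula.realize_imp]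
  | all φ ih =>
    rw [formulaCode, interpFormula_all, BoundedFormula.realize_all]
    exact forall_congr' fun x => by rw [← ofFn_snoc, ih]

variable (d M) in
open Classical in
/-- The element of `M` with a given code. -/
noncomputable def interpCode : ℕ → M :=
  natFix fun n ih => match n.unpair.1 with
    | 1 => bot d
    | 2 => top d
    | 3 => comp d (Fin.ofNat (d + 1) n.unpair.2.unpair.1) (ih n.unpair.2.unpair.2)
    | 4 => interpOp d n.unpair.2.unpair.1 (ih n.unpair.2.unpair.2.unpair.1)
        (ih n.unpair.2.unpair.2.unpair.2)
    | 5 => interpTerm d n.unpair.2.unpair.1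
        ((Denumerable.ofNat (List ℕ) n.unpair.2.unpair.2).map ih)
    | 6 => Classical.epsilon fun x => ¬ interpFormula d n.unpair.2.unpair.1
        ((Denumerable.ofNat (List ℕ) n.unpair.2.unpair.2).map ih ++ [x])
    | _ => default

/-- This makes the calls of `interpCode` on the members of a coded list decrease. -/
theorem le_encode_of_mem {e : List ℕ} {x : ℕ} (hx : x ∈ e) : x ≤ Encodable.encode e := by
  induction e with
  | nil => simp at hx
  | cons a e ih =>
    rw [Encodable.encode_list_cons]
    rcases List.mem_cons.1 hx with rfl | hx
    · exact (Nat.left_le_pair _ _).trans (Nat.le_succ _)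
    · exact (ih hx).trans ((Nat.right_le_pair _ _).trans (Nat.le_succ _))

theorem interpCode_zero : interpCode d M 0 = default := by
  rw [interpCode, natFix_eq]
  simp only [Nat.unpair_zero]

theorem interpCode_bot : interpCode d M codeBot = bot d := by
  rw [interpCode, natFix_eq]
  simp only [codeBot, Nat.unpair_pair]

theorem interpCode_top : interpCode d M codeTop = top d := by
  rw [interpCode, natFix_eq]
  simp only [codeTop, Nat.unpair_pair]

theorem interpCode_comp (i x : ℕ) : interpCode d M (codeComp i x) =
    comp d (Fin.ofNat (d + 1) i) (interpCode d M x) := by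
  conv_lhs => rw [interpCode, natFix_eq]
  simp only [codeComp, Nat.unpair_pair,
    lt_pair_of_pos_of_le (Nat.succ_pos 2) (Nat.right_le_pair i x), if_true]
  rfl

theorem interpCode_op (k x y : ℕ) : interpCode d M (codeOp k x y) =
    interpOp d k (interpCode d M x) (interpCode d M y) := by
  conv_lhs => rw [interpCode, natFix_eq]
  simp only [codeOp, Nat.unpair_pair,
    lt_pair_of_pos_of_le (Nat.succ_pos 3) ((Nat.right_le_pair x y).trans (Nat.right_le_pair k _)),
    lt_pair_of_pos_of_le (Nat.succ_pos 3) ((Nat.left_le_pair x y).trans (Nat.right_le_pair k _)),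
    if_true]
  rfl

theorem map_ite_eq {k s : ℕ} (hk : 0 < k) (e : List ℕ) (f : ℕ → M) :
    e.map (fun m => if m < Nat.pair k (Nat.pair s (Encodable.encode e)) then f m else default) =
      e.map f :=
  List.map_congr_left fun _ hx => if_pos
    (lt_pair_of_pos_of_le hk ((le_encode_of_mem hx).trans (Nat.right_le_pair _ _)))

theorem interpCode_value (s : ℕ) (e : List ℕ) : interpCode d M (codeValue s e) =
    interpTerm d s (e.map (interpCode d M)) := by
  conv_lhs => rw [interpCode, natFix_eq]
  simp only [codeValue, Nat.unpair_pair, Denumerable.ofNat_encode]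
  exact congrArg (interpTerm d s) (map_ite_eq (by decide) e _)

theorem interpCode_witness (c : ℕ) (e : List ℕ) : interpCode d M (codeWitness c e) =
    Classical.epsilon fun x => ¬ interpFormula d c (e.map (interpCode d M) ++ [x]) := by
  conv_lhs => rw [interpCode, natFix_eq]
  simp only [codeWitness, Nat.unpair_pair, Denumerable.ofNat_encode]
  refine congrArg _ (funext fun x => ?_)
  exact congrArg (fun l => ¬ interpFormula d c (l ++ [x])) (map_ite_eq (by decide) e _)

variable (d M) in
open Classical in
/-- The valuation of the atoms which comes from a structure. -/
noncomputable def diagram (n : ℕ) : Bool :=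
  if n.unpair.1 = 0 then decide (interpFormula d n.unpair.2.unpair.1
    ((Denumerable.ofNat (List ℕ) n.unpair.2.unpair.2).map (interpCode d M)))
  else decide (interpCode d M n.unpair.2.unpair.1 = interpCode d M n.unpair.2.unpair.2)

open Classical in
theorem diagram_truthAtom (c : ℕ) (e : List ℕ) :
    diagram d M (truthAtom c e) = decide (interpFormula d c (e.map (interpCode d M))) := by
  simp [diagram, truthAtom]

open Classical in
theorem diagram_eqAtom (x y : ℕ) :
    diagram d M (eqAtom x y) = decide (interpCode d M x = interpCode d M y) := by
  simp [diagram, eqAtom]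

variable (d M) in
theorem isDiagram_diagram : IsDiagram (diagram d M) := by
  constructor
  all_goals
    intros
    simp only [diagram_truthAtom, diagram_eqAtom, decide_eq_true_eq, decide_eq_false_iff_not,
      interpCode_bot, interpCode_top, interpCode_comp, interpCode_op, interpCode_value,
          interpTerm_var,
      interpTerm_bot, interpTerm_top, interpTerm_comp, interpTerm_op, interpFormula_equal,
          interpFormula_imp,
      interpFormula_all, List.map_append, List.map_cons, List.map_nil, interpCode_witness]
  case eucl =>
    by_contra! h
    exact h.2.2 (h.1.symm.trans h.2.1)
  case comp =>
    by_contra! h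
    exact h.2 (congrArg _ h.1)
  case op =>
    by_contra! h
    exact h.2.2 (congrArg₂ _ h.1 h.2.1)
  -- Out of range, the code `0` on one side matches the default element on the other.
  case value_var j e => rw [← interpCode_zero (d := d), List.getD_map]
  case falsum => exact interpFormula_falsum _ _ _
  case of_all c e x =>
    by_contra! h
    exact h.2 (h.1 _)
  case all c e =>
    by_contra! h
    obtain ⟨⟨x, hx⟩, h2⟩ := h
    exact Classical.epsilon_spec (p := fun x => ¬ interpFormula d c (e.map (interpCode d M) ++ [x]))
      ⟨x, hx⟩ h2
  all_goals tauto

end Evaluation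

/-! ### The term model of a diagram. -/

section TermModel

variable {v : ℕ → Bool} (hv : IsDiagram v)

/-- Elements of the term model are natural numbers up to the equalities in the diagram. -/
def IsDiagram.setoid : Setoid ℕ where
  r x y := v (eqAtom x y) = true
  iseqv := by
    have symm : ∀ {x y}, v (eqAtom x y) = true → v (eqAtom y x) = true := fun {x y} h => by
      simpa [h, hv.refl x] using hv.eucl x y x
    exact ⟨hv.refl, symm, fun {x y z} h1 h2 => by simpa [symm h1, h2] using hv.eucl y x z⟩

/-- The term model of a diagram. -/
abbrev IsDiagram.Model : Type := Quotient hv.setoid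

/-- The element of the term model with a given code. -/
abbrev IsDiagram.code (x : ℕ) : hv.Model := Quotient.mk hv.setoid x

theorem IsDiagram.code_eq_iff {x y : ℕ} : hv.code x = hv.code y ↔ v (eqAtom x y) = true :=
  Quotient.eq (r := hv.setoid)

/-- The binary operation of index `k` on the term model. -/
def IsDiagram.modelOp (k : ℕ) : hv.Model → hv.Model → hv.Model :=
  Quotient.map₂ (codeOp k) fun x x' (h : v _ = true) y y' (h' : v _ = true) => by
    change v _ = true
    simpa [h, h'] using hv.op k x x' y y'

variable (d : ℕ)

/-- The term model of a diagram as a structure. -/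
abbrev IsDiagram.structure : (lang d).Structure hv.Model where
  funMap := fun {_} f => match f with
    | Fn.zero => fun _ => hv.code codeBot
    | Fn.one => fun _ => hv.code codeTop
    | Fn.comp i => fun xs => Quotient.map (codeComp i) (fun x y (h : v _ = true) => by
        change v _ = true
        simpa [h] using hv.comp i x y) (xs 0)
    | Fn.join => fun xs => hv.modelOp 0 (xs 0) (xs 1)
    | Fn.meet => fun xs => hv.modelOp 1 (xs 0) (xs 1)
    | Fn.diff => fun xs => hv.modelOp 2 (xs 0) (xs 1)
  RelMap := fun R => R.elim

variable {d}

theorem IsDiagram.code_value {n : ℕ} (t : (lang d).Term (Empty ⊕ Fin n)) (xs : Fin n → ℕ) :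
    hv.code (codeValue (termCode t) (List.ofFn xs)) =
      @Term.realize (lang d) hv.Model (hv.structure d) _
        (Sum.elim default fun i => hv.code (xs i)) t := by
  let := hv.structure d
  induction t with
  | var x =>
    rcases x with e | i
    · exact e.elim
    · have := hv.code_eq_iff.2 (hv.value_var i (List.ofFn xs))
      rw [termCode, this]
      simp [List.getD]
  | func f ts ih =>
    rw [Term.realize_func]
    cases f with
    | zero => exact hv.code_eq_iff.2 (hv.value_bot _ _)
    | one => exact hv.code_eq_iff.2 (hv.value_top _ _)
    | comp i =>
      rw [termCode, hv.code_eq_iff.2 (hv.value_comp _ _ _)]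
      exact congrArg (Quotient.map _ _) (ih 0)
    | join =>
      rw [termCode, hv.code_eq_iff.2 (hv.value_op 0 _ _ _)]
      exact congrArg₂ (hv.modelOp 0) (ih 0) (ih 1)
    | meet =>
      rw [termCode, hv.code_eq_iff.2 (hv.value_op 1 _ _ _)]
      exact congrArg₂ (hv.modelOp 1) (ih 0) (ih 1)
    | diff =>
      rw [termCode, hv.code_eq_iff.2 (hv.value_op 2 _ _ _)]
      exact congrArg₂ (hv.modelOp 2) (ih 0) (ih 1)

/-- The truth lemma of Henkin's construction. In the quantifier case every element of the model has
a code, which gives one direction, and the coded witness gives the other. -/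
theorem IsDiagram.truthAtom_iff {n : ℕ} (φ : (lang d).BoundedFormula Empty n) (xs : Fin n → ℕ) :
    v (truthAtom (formulaCode φ) (List.ofFn xs)) = true ↔
      @BoundedFormula.Realize (lang d) hv.Model (hv.structure d) _ _ φ default
        fun i => hv.code (xs i) := by
  let := hv.structure d
  induction φ with
  | falsum =>
    rw [formulaCode, hv.falsum]
    exact iff_of_false (by decide) id
  | equal s t =>
    rw [formulaCode]
    have h1 := hv.of_equal (termCode s) (termCode t) (List.ofFn xs)
    have h2 := hv.equal (termCode s) (termCode t) (List.ofFn xs)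
    rw [BoundedFormula.Realize, ← hv.code_value, ← hv.code_value, hv.code_eq_iff]
    grind
  | rel R => exact Empty.elim R
  | imp φ ψ ih₁ ih₂ =>
    rw [formulaCode, BoundedFormula.realize_imp]
    refine Iff.trans ?_ (imp_congr (ih₁ xs) (ih₂ xs))
    have h1 := hv.of_imp (formulaCode φ) (formulaCode ψ) (List.ofFn xs)
    have h2 := hv.imp_left (formulaCode φ) (formulaCode ψ) (List.ofFn xs)
    have h3 := hv.imp_right (formulaCode φ) (formulaCode ψ) (List.ofFn xs)
    grind
  | all φ ih =>
    rw [formulaCode, BoundedFormula.realize_all]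
    have h1 : ∀ x, v (truthAtom (formulaCode φ) (List.ofFn xs ++ [x])) = true ↔
        φ.Realize default (Fin.snoc (fun i => hv.code (xs i)) (hv.code x)) := fun x => by
      rw [← ofFn_snoc]
      refine (ih _).trans (iff_of_eq (congrArg _ (funext fun i => ?_)))
      induction i using Fin.lastCases <;> simp
    constructor
    · intro h a
      induction a using Quotient.inductionOn with
      | h x =>
        refine (h1 x).1 ?_
        have := hv.of_all (formulaCode φ) (List.ofFn xs) x
        grind
    · intro h
      have h2 := (h1 (codeWitness (formulaCode φ) (List.ofFn xs))).2 (h _)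
      have := hv.all (formulaCode φ) (List.ofFn xs)
      grind

end TermModel

/-! ### Decidability of complete theories given by one sentence. -/

section Decidability

variable {d : ℕ}

theorem realize_sentence_iff {M : Type w} [(lang d).Structure M] (φ : (lang d).Sentence)
    (v : Empty → M) (xs : Fin 0 → M) : M ⊨ φ ↔ BoundedFormula.Realize φ v xs := by
  obtain rfl : v = default := Subsingleton.elim _ _
  obtain rfl : xs = default := Subsingleton.elim _ _
  rfl

-- First-order satisfiability becomes propositional: a diagram yields its term model, and a nonempty
-- structure yields its diagram.
open Classical in
theorem exists_isDiagram_iff (φ ψ : (lang d).Sentence) (s t : Bool) :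
    (∃ v, IsDiagram v ∧ v (truthAtom (formulaCode φ) []) = s ∧
      v (truthAtom (formulaCode ψ) []) = t) ↔
    ∃ (M : Type) (_ : (lang d).Structure M), Nonempty M ∧ (M ⊨ φ ↔ s = true) ∧
      (M ⊨ ψ ↔ t = true) := by
  constructor
  · rintro ⟨v, hv, rfl, rfl⟩
    let := hv.structure d
    refine ⟨hv.Model, hv.structure d, ⟨hv.code 0⟩, ?_, ?_⟩
    · exact (realize_sentence_iff _ _ _).trans (hv.truthAtom_iff φ default).symm
    · exact (realize_sentence_iff _ _ _).trans (hv.truthAtom_iff ψ default).symm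
  · rintro ⟨M, _, ⟨a⟩, h1, h2⟩
    let : Inhabited M := ⟨a⟩
    have key : ∀ φ : (lang d).Sentence,
        diagram d M (truthAtom (formulaCode φ) []) = true ↔ M ⊨ φ := fun φ => by
      rw [diagram_truthAtom, decide_eq_true_eq, List.map_nil, ← List.ofFn_zero,
        interpFormula_formulaCode φ default]
      exact (realize_sentence_iff _ _ _).symm
    exact ⟨diagram d M, isDiagram_diagram d M, Bool.eq_iff_iff.2 ((key φ).trans h1),
      Bool.eq_iff_iff.2 ((key ψ).trans h2)⟩

/-- Truth of a sentence is computed from its code by `interpFormula`. This semantic form of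
injectivity suffices for questions about consequences. -/
theorem formulaCode_injective {φ ψ : (lang d).Sentence} (h : formulaCode φ = formulaCode ψ)
    (M : Type) [(lang d).Structure M] [Nonempty M] : M ⊨ φ ↔ M ⊨ ψ := by
  let : Inhabited M := Classical.inhabited_of_nonempty ‹_›
  have key := fun φ : (lang d).Sentence => interpFormula_formulaCode (M := M) φ default
  exact (realize_sentence_iff φ _ _).trans <| (key φ).symm.trans <| (h ▸ key ψ).trans
    (realize_sentence_iff ψ _ _).symm

end Decidability

section Decidability

variable {d : ℕ}

theorem exists_formulaCode_eq_iff {n : ℕ} :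
    (∃ φ : (lang d).Sentence, formulaCode φ = n) ↔ formulaArity d n = 1 :=
  formulaArity_iff.symm.trans (by omega)

/-- A complete theory which has the same models as a sentence is decidable. -/
theorem isDecidableTheory_of_isComplete {T : (lang d).Theory} (hT : T.IsComplete)
    {ψ : (lang d).Sentence}
    (hψ : ∀ (M : Type) [(lang d).Structure M] [Nonempty M], M ⊨ T ↔ M ⊨ ψ) :
    IsDecidableTheory T := by
  have hvalid : PrimrecPred fun n => formulaArity d n = 1 :=
    Primrec.eq.comp (primrec_formulaArity d) (.const 1)
  have htrue : IsClausal fun (_ : ℕ) v => v (truthAtom (formulaCode ψ) []) = true :=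
    IsClausal.clause₁ (.const _)
  have hn : ∀ s, IsClausal fun (n : ℕ) v => v (truthAtom n []) = s := fun s =>
    IsClausal.clause₁ (primrec_truthAtom Primrec.id (.const []))
  -- Since `T` and `ψ` have the same models, `φ` follows from `T` exactly when `ψ` and the negation
  -- of `φ` have no common model; `s = true` treats the negated sentence.
  have key : ∀ (φ : (lang d).Sentence) (s : Bool), (¬ ∃ v, IsDiagram v ∧
      v (truthAtom (formulaCode ψ) []) = true ∧ v (truthAtom (formulaCode φ) []) = s) ↔
      T ⊨ᵇ (bif s then φ.not else φ) := by
    intro φ s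
    rw [exists_isDiagram_iff, Theory.models_sentence_iff]
    constructor
    · intro h M
      by_contra hM
      refine h ⟨M, inferInstance, inferInstance, iff_of_true ((hψ M).1 M.is_model) rfl, ?_⟩
      cases s
      · exact iff_of_false hM (by decide)
      · rw [cond_true, Sentence.realize_not, not_not] at hM
        exact iff_of_true hM rfl
    · rintro h ⟨M, _, _, h1, h2⟩
      have hM : M ⊨ T := (hψ M).2 (h1.2 rfl)
      have h3 := h (Theory.ModelType.of T M)
      cases s
      · exact absurd (h2.1 h3) (by decide)
      · exact (Sentence.realize_not M).1 h3 (h2.2 rfl)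
  have uniq : ∀ φ φ' : (lang d).Sentence, formulaCode φ = formulaCode φ' → T ⊨ᵇ φ → T ⊨ᵇ φ' := by
    intro φ φ' h h1
    rw [Theory.models_sentence_iff] at h1 ⊢
    exact fun M => (formulaCode_injective h M).1 (h1 M)
  refine ComputablePred.computable_iff_re_compl_re'.2 ⟨?_, ?_⟩
  -- For a number that is not a code the system is trivially satisfiable, so the number is not
  -- enumerated.
  · refine (IsClausal.imp hvalid (isClausal_isDiagram.and (htrue.and (hn false)))).rePred.of_eq
      fun n => ?_
    by_cases h : formulaArity d n = 1
    · obtain ⟨φ, rfl⟩ := exists_formulaCode_eq_iff.2 h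
      simp only [h, forall_const]
      rw [key φ false]
      exact ⟨fun h1 => ⟨φ, rfl, h1⟩, fun ⟨φ', h1, h2⟩ => uniq φ' φ h1 h2⟩
    · refine iff_of_false (fun h1 => h1 ⟨default, fun h2 => absurd h2 h⟩) ?_
      rintro ⟨φ, h1, -⟩
      exact h (exists_formulaCode_eq_iff.1 ⟨φ, h1⟩)
  -- For the complement, completeness of `T` replaces non-consequence by consequence of the
  -- negation; a number that is not a code makes the system unsatisfiable and is enumerated.
  · refine ((IsClausal.const hvalid).and
      (isClausal_isDiagram.and (htrue.and (hn true)))).rePred.of_eq fun n => ?_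
    by_cases h : formulaArity d n = 1
    · obtain ⟨φ, rfl⟩ := exists_formulaCode_eq_iff.2 h
      simp only [h, true_and]
      rw [key φ true, cond_true]
      have h1 : (∃ φ', formulaCode φ' = formulaCode φ ∧ T ⊨ᵇ φ') ↔ T ⊨ᵇ φ :=
        ⟨fun ⟨φ', h1, h2⟩ => uniq φ' φ h1 h2, fun h1 => ⟨φ, rfl, h1⟩⟩
      rw [h1]
      exact hT.models_not_iff φ
    · refine iff_of_true (fun ⟨_, h1, _⟩ => h h1) ?_
      rintro ⟨φ, h1, -⟩
      exact h (exists_formulaCode_eq_iff.1 ⟨φ, h1⟩)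

theorem ComputablePred.and {p q : ℕ → Prop} (hp : ComputablePred p) (hq : ComputablePred q) :
    ComputablePred fun n => p n ∧ q n := by
  obtain ⟨f, hf, rfl⟩ := ComputablePred.computable_iff.1 hp
  obtain ⟨g, hg, rfl⟩ := ComputablePred.computable_iff.1 hq
  exact ComputablePred.computable_iff.2 ⟨fun n => f n && g n,
    Primrec.and.to_comp.comp hf hg, funext fun n => by simp⟩

theorem ComputablePred.forall_finite {ι : Type*} {s : Set ι} (hs : s.Finite) {p : ι → ℕ → Prop}
    (hp : ∀ i ∈ s, ComputablePred (p i)) : ComputablePred fun n => ∀ i ∈ s, p i n := by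
  induction s, hs using Set.Finite.induction_on with
  | empty => exact ComputablePred.computable_iff.2 ⟨fun _ => true, Computable.const _, by simp⟩
  | insert _ _ ih =>
    simp only [Set.forall_mem_insert] at hp ⊢
    exact ComputablePred.and hp.1 (ih hp.2)

end Decidability

/-! ### Back-and-forth between super scaled lattices. -/

section BackAndForth

variable {d : ℕ} {M : Type u} {N : Type v} [(lang d).Structure M] [(lang d).Structure N]

/-- Adding one element to a finitely generated substructure gives a finite lattice, by local
finiteness, so the extension theorem for finite lattices applies. -/
theorem IsSuperElementary.isExtensionPair (hM : IsSubscaled d M) (hN : IsSuperElementary d N) :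
    (lang d).IsExtensionPair M N := by
  refine isExtensionPair_iff_exists_embedding_closure_singleton_sup.2 fun S hS f m => ?_
  have hfin : Finite (Substructure.closure (lang d) {m} ⊔ S : (lang d).Substructure M) :=
    hM.finite_of_fg ((Substructure.fg_closure_singleton m).sup hS)
  let i := Substructure.inclusion (le_sup_right : S ≤ Substructure.closure (lang d) {m} ⊔ S)
  obtain ⟨E, hE⟩ := hN.exists_extension (hM.substructure _) i.toHom.range
    (f.comp i.equivRange.symm.toEmbedding)
  refine ⟨E, Embedding.ext fun x => ?_⟩
  have h : E (i x) = f (i.equivRange.symm (i.equivRange x)) := hE (i.equivRange x)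
  exact (h.trans (congrArg f (i.equivRange.symm_apply_apply x))).symm

/-- Countable super `d`-scaled lattices which contain copies of the same finite structure are
isomorphic. -/
theorem IsSuperScaled.nonempty_equiv (hM : IsSuperScaled d M) (hN : IsSuperScaled d N)
    [Countable M] [Countable N] {L : Type w} [(lang d).Structure L] [Finite L]
    (f : L ↪[lang d] M) (g : L ↪[lang d] N) : Nonempty (M ≃[lang d] N) := by
  have hM := isSuperScaled_iff.1 hM
  have hN := isSuperScaled_iff.1 hN
  let e : M ≃ₚ[lang d] N := ⟨f.toHom.range, g.toHom.range, g.equivRange.comp f.equivRange.symm⟩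
  have : Finite f.toHom.range := Finite.of_equiv _ f.equivRange.toEquiv
  obtain ⟨E, -⟩ := equiv_between_cg Structure.cg_of_countable Structure.cg_of_countable
    ⟨e, Substructure.FG.of_finite⟩ (hN.isExtensionPair hM.toIsSubscaled)
    (hM.isExtensionPair hN.toIsSubscaled)
  exact ⟨E⟩

end BackAndForth

/-! ### Prime subscaled lattices. -/

section Prime

variable {d : ℕ} {L : Type u} [(lang d).Structure L] {M : Type v} [(lang d).Structure M]

theorem IsPrimeSubscaled.isSubscaled (h : IsPrimeSubscaled d L) : IsSubscaled d L := h.1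

/-- Substructures of subscaled lattices are subscaled, so a prime one has no proper substructure at
all. -/
theorem IsPrimeSubscaled.substructure_eq_top (h : IsPrimeSubscaled d L)
    (S : (lang d).Substructure L) : S = ⊤ := h.2 S (h.1.substructure S)

theorem IsPrimeSubscaled.finite (h : IsPrimeSubscaled d L) :
    Finite L ∧ Nat.card L ≤ Nat.card (Set (TypeSpace d Empty d)) := by
  obtain ⟨S, -, h1, h2⟩ := h.isSubscaled.exists_finite_substructure (fun i : Empty => i.elim)
  have e : S ≃ L := (h.substructure_eq_top S ▸ Substructure.topEquiv.toEquiv)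
  exact ⟨Finite.of_equiv _ e, (Nat.card_congr e).symm.trans_le h2⟩

theorem IsPrimeSubscaled.of_equiv (h : IsPrimeSubscaled d L) (e : L ≃[lang d] M) :
    IsPrimeSubscaled d M := by
  refine ⟨.of_embedding e.symm.toEmbedding h.1, fun S _ => ?_⟩
  have h1 := h.substructure_eq_top (S.comap e.toHom)
  refine eq_top_iff.2 fun x _ => ?_
  obtain ⟨y, rfl⟩ := e.surjective x
  have : y ∈ S.comap e.toHom := h1 ▸ Substructure.mem_top y
  exact this

theorem IsSubscaled.isPrimeSubscaled_bot (h : IsSubscaled d M) :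
    IsPrimeSubscaled d (⊥ : (lang d).Substructure M) := by
  refine ⟨h.substructure _, fun S _ => ?_⟩
  refine eq_top_iff.2 fun x _ => ?_
  have h1 : (x : M) ∈ S.map (Substructure.subtype _).toHom := (bot_le : ⊥ ≤ S.map _) x.2
  obtain ⟨y, hy, hyx⟩ := h1
  obtain rfl : y = x := Subtype.ext hyx
  exact hy

theorem exists_equiv_fin (L : Type u) [(lang d).Structure L] [Finite L] :
    ∃ (_ : (lang d).Structure (Fin (Nat.card L))), Nonempty (L ≃[lang d] Fin (Nat.card L)) :=
  ⟨(Finite.equivFin L).inducedStructure, ⟨(Finite.equivFin L).inducedStructureEquiv⟩⟩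

theorem finite_structure (M : Type*) [Finite M] : Finite ((lang d).Structure M) := by
  let F : (lang d).Structure M → (Fin (d + 1) → M → M) × M × M × (M → M → M) × (M → M → M) ×
      (M → M → M) := fun _ => (comp d, bot d, top d, join d, meet d, diff d)
  refine Finite.of_injective F fun s t h => ?_
  simp only [F, Prod.mk.injEq] at h
  obtain ⟨h1, h2, h3, h4, h5, h6⟩ := h
  have e0 : ∀ y : Fin 0 → M, y = ![] := fun y => Subsingleton.elim _ _
  have e1 : ∀ y : Fin 1 → M, y = ![y 0] := fun y => by funext j; fin_cases j; rfl
  have e2 : ∀ y : Fin 2 → M, y = ![y 0, y 1] := fun y => by funext j; fin_cases j <;> rfl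
  refine Language.Structure.ext ?_ (funext fun _ => funext fun R => R.elim)
  funext n f y
  cases f with
  | zero => rw [e0 y]; exact h2
  | one => rw [e0 y]; exact h3
  | comp i => rw [e1 y]; exact congrFun (congrFun h1 i) (y 0)
  | join => rw [e2 y]; exact congrFun (congrFun h4 (y 0)) (y 1)
  | meet => rw [e2 y]; exact congrFun (congrFun h5 (y 0)) (y 1)
  | diff => rw [e2 y]; exact congrFun (congrFun h6 (y 0)) (y 1)

variable (d) in
/-- Up to isomorphism, there are only finitely many prime `d`-subscaled lattices. -/
theorem exists_finite_set_isPrimeSubscaled :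
    ∃ S : Set (CategoryTheory.Bundled.{0} (lang d).Structure), S.Finite ∧
      (∀ P ∈ S, IsPrimeSubscaled d P) ∧
      ∀ (L₀ : Type u) [(lang d).Structure L₀], IsPrimeSubscaled d L₀ →
        ∃ P ∈ S, Nonempty (L₀ ≃[lang d] P) := by
  let N := Nat.card (Set (TypeSpace d Empty d))
  -- Prime lattices have at most `N` elements, so copies of them all occur among the finitely many
  -- structures on the sets `Fin n` with `n ≤ N`.
  let F : (Σ n : Fin (N + 1), (lang d).Structure (Fin n)) →
      CategoryTheory.Bundled.{0} (lang d).Structure := fun x => ⟨Fin x.1, x.2⟩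
  have : ∀ n : Fin (N + 1), Finite ((lang d).Structure (Fin n)) := fun n => finite_structure _
  refine ⟨Set.range F ∩ {P | IsPrimeSubscaled d P}, (Set.finite_range F).inter_of_left _,
    fun P hP => hP.2, fun L₀ _ h => ?_⟩
  obtain ⟨h1, h2⟩ := h.finite
  obtain ⟨s, ⟨e⟩⟩ := exists_equiv_fin (d := d) L₀
  exact ⟨_, ⟨⟨⟨⟨Nat.card L₀, Nat.lt_succ_of_le h2⟩, s⟩, rfl⟩, h.of_equiv e⟩, ⟨e⟩⟩

end Prime

/-! ### Models, completeness and decidability of the theories. -/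

section Theories

variable {d : ℕ} {L₀ : Type u} [(lang d).Structure L₀]

theorem exists_sentence_over (L₀ : Type u) [(lang d).Structure L₀] [Finite L₀] :
    ∃ φ : (lang d).Sentence, ∀ (M : Type v) [(lang d).Structure M],
      M ⊨ φ ↔ IsSuperScaled d M ∧ Nonempty (L₀ ↪[lang d] M) :=
  ((IsDef.isSuperScaled d).and (IsDef.nonempty_embedding L₀)).exists_sentence

/-- The class is defined by a single sentence, which belongs to the theory of the class; so no other
structure is a model. -/
theorem model_superTheoryOver_iff [Finite L₀] {M : Type} [(lang d).Structure M] :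
    M ⊨ superTheoryOver d L₀ ↔ IsSuperScaled d M ∧ Nonempty (L₀ ↪[lang d] M) := by
  obtain ⟨φ, hφ⟩ := exists_sentence_over.{u, 0} (d := d) L₀
  constructor
  · intro h
    exact (hφ M).1 (h.realize_of_mem φ fun N _ h1 h2 => (hφ N).2 ⟨h1, h2⟩)
  · rintro ⟨h1, h2⟩
    exact ⟨fun ψ hψ => hψ M h1 h2⟩

theorem model_superTheory_iff {M : Type} [(lang d).Structure M] :
    M ⊨ superTheory d ↔ IsSuperScaled d M := by
  obtain ⟨φ, hφ⟩ := (IsDef.isSuperScaled.{0} d).exists_sentence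
  exact ⟨fun h => (hφ M).1 (h.realize_of_mem φ fun N _ h1 => (hφ N).2 h1),
    fun h => ⟨fun ψ hψ => hψ M h⟩⟩

theorem nonempty_equiv_of_countable [Finite L₀] (M N : Type v) [(lang d).Structure M]
    [(lang d).Structure N] [Countable M] [Countable N] (hM : M ⊨ superTheoryOver d L₀)
    (hN : N ⊨ superTheoryOver d L₀) : Nonempty (M ≃[lang d] N) := by
  have key : ∀ (M : Type v) [(lang d).Structure M] [Countable M], M ⊨ superTheoryOver d L₀ →
      ∃ (M' : Type) (_ : (lang d).Structure M'), Countable M' ∧ Nonempty (M ≃[lang d] M') ∧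
        M' ⊨ superTheoryOver d L₀ := by
    intro M _ _ h
    obtain ⟨f, hf⟩ := exists_injective_nat M
    -- The theory is defined through structures in `Type`, so a countable model in another universe
    -- is first copied to a set of natural numbers.
    let e := _root_.Equiv.ofInjective f hf
    let := e.inducedStructure (L := lang d)
    let e' := e.inducedStructureEquiv (L := lang d)
    exact ⟨Set.range f, inferInstance, inferInstance, ⟨e'⟩,
        (e'.toElementaryEmbedding.theory_model_iff _).1 h⟩
  obtain ⟨M', _, _, ⟨e⟩, hM'⟩ := key M hM
  obtain ⟨N', _, _, ⟨f⟩, hN'⟩ := key N hN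
  obtain ⟨h1, ⟨i⟩⟩ := model_superTheoryOver_iff.1 hM'
  obtain ⟨h2, ⟨j⟩⟩ := model_superTheoryOver_iff.1 hN'
  obtain ⟨g⟩ := h1.nonempty_equiv h2 i j
  exact ⟨f.symm.comp (g.comp e)⟩

theorem categorical_superTheoryOver [Finite L₀] :
    Cardinal.Categorical Cardinal.aleph0.{v} (superTheoryOver d L₀) := by
  intro M N hM hN
  have := Cardinal.mk_le_aleph0_iff.1 hM.le
  have := Cardinal.mk_le_aleph0_iff.1 hN.le
  exact nonempty_equiv_of_countable M N M.is_model N.is_model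

/-- A number which determines a function symbol among those of the same arity. -/
def Fn.index {d n : ℕ} : Fn d n → ℕ
  | .zero => 0
  | .one => 1
  | .join => 2
  | .meet => 3
  | .diff => 4
  | .comp i => i

theorem Fn.index_injective (n : ℕ) : Function.Injective (Fn.index : Fn d n → ℕ) := by
  intro f g h
  cases f <;> cases g <;> simp_all [Fn.index, Fin.ext_iff]

theorem card_lang_le : (lang d).card ≤ Cardinal.aleph0 := by
  have : ∀ n, Countable ((lang d).Functions n) := fun n => (Fn.index_injective n).countable
  have : ∀ n, Countable ((lang d).Relations n) := fun n => inferInstanceAs (Countable Empty)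
  have : Countable (lang d).Symbols := inferInstanceAs (Countable (_ ⊕ _))
  exact Cardinal.mk_le_aleph0

theorem exists_countable_elementary (M : Type) [(lang d).Structure M] :
    ∃ S : (lang d).ElementarySubstructure M, Countable S := by
  by_cases hM : Countable M
  · exact ⟨⊤, inferInstance⟩
  · obtain ⟨S, -, hS⟩ := exists_elementarySubstructure_card_eq (lang d) (∅ : Set M)
      Cardinal.aleph0.{0} le_rfl (by simp) (by simpa using card_lang_le)
      (by simpa using (not_le.1 fun h => hM (Cardinal.mk_le_aleph0_iff.1 h)).le)
    exact ⟨S, Cardinal.mk_le_aleph0_iff.1 (by simpa using hS.le)⟩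

theorem isSatisfiable_superTheoryOver (h : IsSubscaled d L₀) [Finite L₀] :
    (superTheoryOver d L₀).IsSatisfiable := by
  obtain ⟨_, ⟨e⟩⟩ := exists_equiv_fin (d := d) L₀
  obtain ⟨N, _, hN, ⟨f⟩⟩ := FiniteSubscaled.exists_super (d := d)
    ⟨Fin (Nat.card L₀), .of_embedding e.symm.toEmbedding h⟩
  have : N ⊨ superTheoryOver d L₀ := model_superTheoryOver_iff.2
    ⟨isSuperScaled_iff.2 hN, ⟨Embedding.comp f e.toEmbedding⟩⟩
  have : Nonempty N := ⟨bot d⟩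
  exact Theory.Model.isSatisfiable N

theorem isComplete_superTheoryOver (h : IsSubscaled d L₀) [Finite L₀] :
    (superTheoryOver d L₀).IsComplete := by
  have key : ∀ (M N : Type) [(lang d).Structure M] [(lang d).Structure N] (φ : (lang d).Sentence),
      M ⊨ superTheoryOver d L₀ → N ⊨ superTheoryOver d L₀ → M ⊨ φ → N ⊨ φ := by
    intro M N _ _ φ hM hN h
    -- Countable elementary substructures of the two models are isomorphic. Finite ones are allowed,
    -- so the infinitude of models is not needed.
    obtain ⟨S, hS⟩ := exists_countable_elementary (d := d) M
    obtain ⟨T, hT⟩ := exists_countable_elementary (d := d) N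
    have hSM : S ⊨ superTheoryOver d L₀ := (S.theory_model_iff _).2 hM
    have hTN : T ⊨ superTheoryOver d L₀ := (T.theory_model_iff _).2 hN
    obtain ⟨e⟩ := nonempty_equiv_of_countable S T hSM hTN
    exact (T.realize_sentence φ).1 ((StrongHomClass.realize_sentence e φ).1 ((S.realize_sentence
        φ).2 h))
  refine ⟨isSatisfiable_superTheoryOver h, fun φ => ?_⟩
  by_contra! hc
  simp only [Theory.models_sentence_iff, not_forall] at hc
  obtain ⟨⟨M, hM⟩, ⟨N, hN⟩⟩ := hc
  rw [Sentence.realize_not, not_not] at hN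
  exact hM (key N M φ N.is_model M.is_model hN)

theorem isDecidableTheory_superTheoryOver (h : IsSubscaled d L₀) [Finite L₀] :
    IsDecidableTheory (superTheoryOver d L₀) := by
  obtain ⟨φ, hφ⟩ := exists_sentence_over.{u, 0} (d := d) L₀
  exact isDecidableTheory_of_isComplete (isComplete_superTheoryOver h) (ψ := φ)
    fun M _ _ => model_superTheoryOver_iff.trans (hφ M).symm

/-- Every super `d`-scaled lattice contains the prime lattice generated by its constants, so it is a
model over some member of `S`. -/
theorem models_superTheory_iff {S : Set (CategoryTheory.Bundled.{0} (lang d).Structure)}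
    (hS : ∀ P ∈ S, IsPrimeSubscaled d P)
    (hS' : ∀ (L₀ : Type) [(lang d).Structure L₀], IsPrimeSubscaled d L₀ →
        ∃ P ∈ S, Nonempty (L₀ ≃[lang d] P)) (φ : (lang d).Sentence) :
    superTheory d ⊨ᵇ φ ↔ ∀ P ∈ S, superTheoryOver d P ⊨ᵇ φ := by
  simp only [Theory.models_sentence_iff]
  constructor
  · intro h P hP M
    have := (hS P hP).finite.1
    have hM : M ⊨ superTheory d :=
      model_superTheory_iff.2 (model_superTheoryOver_iff.1 M.is_model).1
    exact h (Theory.ModelType.of _ M)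
  · intro h M
    have hM := model_superTheory_iff.1 M.is_model
    obtain ⟨P, hP, ⟨e⟩⟩ := hS' _ hM.toIsSubscaled.isPrimeSubscaled_bot
    have := (hS P hP).finite.1
    have hM' : M ⊨ superTheoryOver d P := model_superTheoryOver_iff.2
      ⟨hM, ⟨(Substructure.subtype _).comp e.symm.toEmbedding⟩⟩
    exact h P hP (Theory.ModelType.of _ M)

theorem isDecidableTheory_superTheory (d : ℕ) : IsDecidableTheory (superTheory d) := by
  obtain ⟨S, hfin, hS, hS'⟩ := exists_finite_set_isPrimeSubscaled.{0} d
  -- Asking for a code separately provides one sentence for all members of `S`, whether or not `S`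
  -- is empty.
  have h1 : ComputablePred fun n => formulaArity d n = 1 :=
    (Primrec.eq.comp (primrec_formulaArity d) (.const 1)).computablePred
  have h2 : ComputablePred fun n => ∀ P ∈ S, ∃ φ : (lang d).Sentence,
      formulaCode φ = n ∧ superTheoryOver d P ⊨ᵇ φ :=
    ComputablePred.forall_finite hfin fun P hP => by
      have := (hS P hP).finite.1
      exact isDecidableTheory_superTheoryOver (hS P hP).isSubscaled
  refine (ComputablePred.and h1 h2).of_eq fun n => ?_
  constructor
  · rintro ⟨hn, h⟩
    obtain ⟨φ, rfl⟩ := exists_formulaCode_eq_iff.2 hn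
    refine ⟨φ, rfl, (models_superTheory_iff hS hS' φ).2 fun P hP => ?_⟩
    obtain ⟨ψ, hψ, h3⟩ := h P hP
    rw [Theory.models_sentence_iff] at h3 ⊢
    exact fun M => (formulaCode_injective hψ M).1 (h3 M)
  · rintro ⟨φ, rfl, h⟩
    exact ⟨exists_formulaCode_eq_iff.1 ⟨φ, rfl⟩, fun P hP => ⟨φ, rfl,
      (models_superTheory_iff hS hS' φ).1 h P hP⟩⟩

/-- Take for `L₀` the least substructure of a model of `T`. This model satisfies two complete
theories, so both consist of the sentences true in it, up to consequence. -/
theorem exists_superTheoryOver_of_isComplete {T : (lang d).Theory} (hT : T.IsComplete)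
    (h : ∀ φ ∈ superTheory d, T ⊨ᵇ φ) :
    ∃ (L₀ : Type) (_ : (lang d).Structure L₀), IsPrimeSubscaled d L₀ ∧
      ∀ φ : (lang d).Sentence, T ⊨ᵇ φ ↔ superTheoryOver d L₀ ⊨ᵇ φ := by
  obtain ⟨M⟩ := hT.1
  have hM : IsSuperScaled d M :=
    model_superTheory_iff.1 ⟨fun φ hφ => (h φ hφ).realize_sentence M⟩
  have hp := hM.toIsSubscaled.isPrimeSubscaled_bot
  have := hp.finite.1
  refine ⟨_, inferInstance, hp, fun φ => ?_⟩
  have hM' : M ⊨ superTheoryOver d (⊥ : (lang d).Substructure M) :=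
    model_superTheoryOver_iff.2 ⟨hM, ⟨Substructure.subtype _⟩⟩
  rw [← hT.realize_sentence_iff φ M,
    ← (isComplete_superTheoryOver hp.isSubscaled).realize_sentence_iff φ M]

end Theories

end ScaledLattice

theorem mainTheorem2 (d : ℕ) :
    (∀ (L₀ : Type u) [(lang d).Structure L₀], IsPrimeSubscaled d L₀ →
      Cardinal.Categorical Cardinal.aleph0.{v} (superTheoryOver d L₀) ∧
      (superTheoryOver d L₀).IsComplete ∧
      (∃ F : (lang d).Theory, F.Finite ∧ ∀ (M : Type v) [(lang d).Structure M],
        M ⊨ F ↔ IsSuperScaled d M ∧ Nonempty (L₀ ↪[lang d] M)) ∧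
      IsDecidableTheory (superTheoryOver d L₀)) ∧
    (∃ S : Set (CategoryTheory.Bundled.{0} (lang d).Structure), S.Finite ∧
      (∀ P ∈ S, IsPrimeSubscaled d P) ∧
      ∀ (L₀ : Type u) [(lang d).Structure L₀], IsPrimeSubscaled d L₀ →
        ∃ P ∈ S, Nonempty (L₀ ≃[lang d] P)) ∧
    (∀ T : (lang d).Theory, T.IsComplete → (∀ φ ∈ superTheory d, T ⊨ᵇ φ) →
      ∃ (L₀ : Type) (_ : (lang d).Structure L₀), IsPrimeSubscaled d L₀ ∧
        ∀ φ : (lang d).Sentence, T ⊨ᵇ φ ↔ superTheoryOver d L₀ ⊨ᵇ φ) ∧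
    IsDecidableTheory (superTheory d) := by
  refine ⟨fun L₀ _ h => ?_, exists_finite_set_isPrimeSubscaled d,
    fun T => exists_superTheoryOver_of_isComplete, isDecidableTheory_superTheory d⟩
  have := h.finite.1
  refine ⟨categorical_superTheoryOver, isComplete_superTheoryOver h.isSubscaled, ?_,
    isDecidableTheory_superTheoryOver h.isSubscaled⟩
  obtain ⟨φ, hφ⟩ := exists_sentence_over.{u, v} (d := d) L₀
  exact ⟨{φ}, Set.finite_singleton φ, fun M _ => Theory.model_singleton_iff.trans (hφ M)⟩
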